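/- An \emph{outerplane embedding} of a finite connected simple graph $G$ with at least one edge consists of a counterclockwise cyclic order of the incident edges at every vertex, such that the faces traced by these cyclic orders satisfy Euler's formula $|V|-|E|+|F|=2$, together with one of these faces, the outer face, that is incident to every vertex of $G$. An \emph{$SC_1$-layout} of $G$ is a planar drawing in which vertices are distinct points; every edge is either a single line segment or a single circular arc, leaving both of its endpoints horizontally or vertically (so segments are axis-aligned); at every vertex each of the four ports (right, top, left, bottom) is used by at most one edge; no edge passes through a vertex other than its endpoints; and two distinct edges meet only at vertices. It \emph{preserves} an outerplane embedding if the counterclockwise order of the edges around every vertex is the prescribed one and the unbounded face of the drawing is the prescribed outer face. \textbf{Theorem.} Let $G$ be a finite simple graph with at least two vertices that is biconnected (connected and without cut vertices) and has maximum degree at most $4$. Then for every outerplane embedding of $G$ there is an $SC_1$-layout of $G$ that preserves it. -/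

import Mathlib

open Topology

namespace SmoothOrthogonal

universe u

/-! ### Combinatorial side: biconnected graphs and outerplane embeddings -/

/-- A graph is biconnected if it is connected and has no cut vertex. -/
def Biconnected {V : Type u} (G : SimpleGraph V) : Prop :=
  G.Connected ∧ ∀ v : V, (G.induce {v}ᶜ).Preconnected

/-- A combinatorial embedding (rotation system): for every vertex, a cyclic order of the edges
around it. Half-edges are Mathlib's darts; a dart `d` sits at its tail `d.fst`, and `rot d` is the
counterclockwise successor of `d` among the darts with the same tail. -/
structure RotationSystem {V : Type u} (G : SimpleGraph V) where
  rot : Equiv.Perm G.Dart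
  rot_fst : ∀ d, (rot d).fst = d.fst
  rot_cyclic : ∀ d e : G.Dart, d.fst = e.fst → rot.SameCycle d e

/-- Reversal of darts, as a permutation. -/
def dartSymm {V : Type u} (G : SimpleGraph V) : Equiv.Perm G.Dart where
  toFun := SimpleGraph.Dart.symm
  invFun := SimpleGraph.Dart.symm
  left_inv := SimpleGraph.Dart.symm_symm
  right_inv := SimpleGraph.Dart.symm_symm

namespace RotationSystem

variable {V : Type u} {G : SimpleGraph V}

/-- Face tracing: walk along `d`, keeping the face on the right-hand side, and go on with the dart
that follows `d.symm` counterclockwise around the head of `d`. -/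
def faceNext (R : RotationSystem G) : Equiv.Perm G.Dart := (dartSymm G).trans R.rot

/-- The faces are the orbits of face tracing. -/
def Face (R : RotationSystem G) : Type u := Quotient (Equiv.Perm.SameCycle.setoid R.faceNext)

/-- The face to the right of a dart. -/
def faceOf (R : RotationSystem G) (d : G.Dart) : R.Face :=
  Quotient.mk (Equiv.Perm.SameCycle.setoid R.faceNext) d

end RotationSystem

/-- An outerplane embedding of a finite connected graph with at least one edge: a rotation system
of genus zero (Euler's formula `|V| - |E| + |F| = 2`) together with a face, the outer face, that
is incident to every vertex. -/
structure OuterplaneEmbedding {V : Type u} (G : SimpleGraph V) extends RotationSystem G where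
  euler : Nat.card V + Nat.card toRotationSystem.Face = Nat.card G.edgeSet + 2
  outer : toRotationSystem.Face
  mem_outer : ∀ v : V, ∃ d : G.Dart, d.fst = v ∧ toRotationSystem.faceOf d = outer

/-! ### Geometric side: layouts of smooth complexity one -/

/-- A parametrized line segment from `p` to `q`, or a parametrized arc of the circle with centre
`c` and radius `r`, running from angle `a` to angle `b` (counterclockwise if `a < b`, clockwise if
`b < a`). The plane is `ℂ`. -/
inductive Stroke where
  | segment (p q : ℂ)
  | arc (c : ℂ) (r a b : ℝ)

namespace Stroke

/-- The point at time `t`; the stroke is run through for `t` from `0` to `1`. -/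
noncomputable def point : Stroke → ℝ → ℂ
  | segment p q, t => p + t * (q - p)
  | arc c r a b, t => c + r * Complex.exp (((a + t * (b - a) : ℝ) : ℂ) * Complex.I)

/-- The velocity at time `t`, see `hasDerivAt_point`. -/
noncomputable def tangent : Stroke → ℝ → ℂ
  | segment p q, _ => q - p
  | arc _ r a b, t =>
      r * (Complex.exp (((a + t * (b - a) : ℝ) : ℂ) * Complex.I) * (((b - a : ℝ) : ℂ) * Complex.I))

theorem hasDerivAt_point (s : Stroke) (t : ℝ) : HasDerivAt s.point (s.tangent t) t := by
  cases s with
  | segment p q =>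
    have h : HasDerivAt (fun u : ℝ => p + (u : ℂ) * (q - p)) (1 * (q - p)) t :=
      ((hasDerivAt_id t).ofReal_comp.mul_const (q - p)).const_add p
    rw [one_mul] at h
    exact h
  | arc c r a b =>
    have h1 : HasDerivAt (fun t : ℝ => a + t * (b - a)) (b - a) t := by
      simpa using ((hasDerivAt_id t).mul_const (b - a)).const_add a
    exact (((h1.ofReal_comp.mul_const Complex.I).cexp).const_mul (r : ℂ)).const_add c

/-- The same curve, traversed backwards. -/
def reverse : Stroke → Stroke
  | segment p q => segment q p
  | arc c r a b => arc c r b a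

/-- A segment has distinct endpoints; an arc has positive radius and is neither a point nor a full
circle. -/
def Nondegenerate : Stroke → Prop
  | segment p q => p ≠ q
  | arc _ r a b => 0 < r ∧ a ≠ b ∧ |b - a| < 2 * Real.pi

/-- The set of points of a stroke, endpoints included. -/
def carrier (s : Stroke) : Set ℂ := s.point '' Set.Icc 0 1

end Stroke

/-- The four ports of a vertex, in counterclockwise order: `0` right, `1` top, `2` left,
`3` bottom. -/
noncomputable def portDir (k : ZMod 4) : ℂ := Complex.I ^ k.val

/-- The number of quarter turns, between `1` and `4`, of the counterclockwise rotation from port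
`i` to port `j`; it is `4` if `i = j`. -/
def quarterTurns (i j : ZMod 4) : ℕ := if i = j then 4 else (j - i).val

/-- A planar smooth orthogonal drawing of edge complexity one. Each edge is drawn as a single
segment or a single circular arc (the two darts of an edge carry the same curve in opposite
directions), which leaves its endpoints horizontally or vertically, at most one edge per port of a
vertex. In particular segments are axis-aligned. There are no crossings: no edge runs through a
vertex other than its endpoints, and distinct edges meet at vertices only. -/
structure SC1Layout {V : Type u} (G : SimpleGraph V) where
  pos : V → ℂ
  pos_injective : Function.Injective pos
  stroke : G.Dart → Stroke
  stroke_symm : ∀ d, stroke d.symm = (stroke d).reverse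
  nondegenerate : ∀ d, (stroke d).Nondegenerate
  start_eq : ∀ d, (stroke d).point 0 = pos d.fst
  end_eq : ∀ d, (stroke d).point 1 = pos d.snd
  port : G.Dart → ZMod 4
  tangent_eq : ∀ d, ∃ l : ℝ, 0 < l ∧ (stroke d).tangent 0 = l * portDir (port d)
  port_injective : ∀ d e : G.Dart, d.fst = e.fst → port d = port e → d = e
  vertex_on_edge : ∀ (v : V) (d : G.Dart), pos v ∈ (stroke d).carrier → v = d.fst ∨ v = d.snd
  no_crossing : ∀ d e : G.Dart, d.edge ≠ e.edge →
    (stroke d).carrier ∩ (stroke e).carrier ⊆ Set.range pos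

namespace SC1Layout

variable {V : Type u} {G : SimpleGraph V}

/-- All points of the plane that are covered by the drawing. -/
def support (L : SC1Layout G) : Set ℂ := Set.range L.pos ∪ ⋃ d, (L.stroke d).carrier

/-- The outer face of the drawing: the unbounded connected component of its complement. -/
def outerRegion (L : SC1Layout G) : Set ℂ :=
  {z | z ∈ L.supportᶜ ∧ ¬ Bornology.IsBounded (connectedComponentIn L.supportᶜ z)}

/-- The drawing realizes the given outerplane embedding. First, `rot d` is the first dart met when
turning counterclockwise around the tail of `d`, starting from `d`. Second, along every dart on
the boundary of the prescribed outer face, the points immediately to the right of the curve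
(direction `-i` times the velocity) lie in the outer face of the drawing. As the rotation system
already determines which darts have the same face to their right, this says that the outer face of
the drawing is the prescribed one. -/
def Preserves (L : SC1Layout G) (E : OuterplaneEmbedding G) : Prop :=
  (∀ d e : G.Dart, e.fst = d.fst →
    quarterTurns (L.port d) (L.port (E.rot d)) ≤ quarterTurns (L.port d) (L.port e)) ∧
  (∀ d : G.Dart, E.faceOf d = E.outer → ∀ t ∈ Set.Ioo (0 : ℝ) 1, ∀ᶠ ε : ℝ in 𝓝[>] 0,
    (L.stroke d).point t - ε * (Complex.I * (L.stroke d).tangent t) ∈ L.outerRegion)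

end SC1Layout

end SmoothOrthogonal

/-!
The combinatorial part rests on the Jordan curve theorem modulo two. By Euler's formula, the space
of cycles modulo two and the space of borders of sets of faces have the same dimension, so every
cycle is the border of a set of faces (`OuterplaneEmbedding.exists_potential`). As there is no cut
vertex, it follows that the outer face has one corner at every vertex
(`OuterplaneEmbedding.eq_of_faceOf_eq_outer`), hence its boundary meets every vertex exactly
once. If the vertices are numbered along this cycle then the other edges are noncrossing chords
(`OuterplaneEmbedding.not_crossing`), and the rotation at a vertex is the order of its neighbours
along the cycle (`OuterplaneEmbedding.snd_rot_lt`). Opening up the cycle at a chord that cuts off as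
few vertices as possible, one gets a root edge from `0` to `N` with the property that all vertices
after `N`, the leaves, have degree two (`OuterplaneEmbedding.exists_unfolding`).

The drawing is best described in coordinates rotated by 45 degrees, in which the ports point
diagonally: two of them upwards and two downwards. The vertices `0, …, N` are placed recursively
above the horizontal root edge. The new vertices of the face above an edge go on a horizontal row,
evenly spaced, at the height which makes the outermost edges of the face diagonal or vertical
(`ChordDisc.place`). Only five kinds of edges arise (`ChordDisc.framed_of_edge`). A horizontal edge
is a quarter circle that bulges downwards and leaves the two upper ports at each of its ends free; a
diagonal edge is a segment and leaves room for one more edge at its lower end; and a vertical edge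
is a quarter circle that has no room for edges above it, and needs none since the degrees are at
most four. What is drawn above an edge stays in a half-strip that may protrude a little beyond the
ends of the edge, and the half-strips of the edges of a face are disjoint; by induction, so are all
curves (`ChordDisc.cell_disjoint`). The leaves are put on a vertical line below `0`, with quarter
circles between them, and a semicircle joins the lowest one to `N` (`Unfolding.zone_disjoint`).

The ports at a vertex are integers modulo four that lift to integers which increase along the
rotation, from the outer face on, and span less than a full turn (`Unfolding.key_lt_key`,
`Unfolding.key_lt_add`); so the layout has the prescribed rotation system. The outer face is the
prescribed one because from every point on the outer side of an outer edge there is an explicit way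
to infinity that avoids the drawing: upwards for the edges of the disc other than the root edge
(`ChordDisc.eventually_escapes`), and sideways or downwards for the remaining ones
(`Unfolding.eventually_reachesInfinity_succ`, `Unfolding.eventually_reachesInfinity_last`).
-/

/-! ### Discs with noncrossing chords -/

namespace SmoothOrthogonal

section
open Finset
open scoped Classical

/-- A disc with noncrossing chords, in linear notation: the vertices on the boundary are `0, …, N`,
`E i j` says that `i < j` are joined by an edge, consecutive vertices are joined, and so are `0`
and `N`. Every vertex has degree at most four, and the ends of the root edge `(0, N)` have at most
two further neighbours. -/
structure ChordDisc where
  N : ℕ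
  E : ℕ → ℕ → Prop
  lt : ∀ {i j}, E i j → i < j
  le : ∀ {i j}, E i j → j ≤ N
  succ : ∀ {i}, i < N → E i (i + 1)
  root : E 0 N
  noncrossing : ∀ {a b c d}, E a c → E b d → a < b → b < c → c < d → False
  degree_le : ∀ k, 0 < k → k < N →
    #{l ∈ range k | E l k} + #{r ∈ Ioc k N | E k r} ≤ 4
  root_left : #{r ∈ Ioo 0 N | E 0 r} ≤ 2
  root_right : #{l ∈ Ioo 0 N | E l N} ≤ 2

namespace ChordDisc

variable (D : ChordDisc)

/-- The vertices, other than `i` and `j`, of the face on the far side of the edge `(i, j)`: those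
that no shorter edge below `(i, j)` hides. -/
noncomputable def face (i j : ℕ) : Finset ℕ :=
  {k ∈ Ioo i j | ∀ p q, D.E p q → i ≤ p → q ≤ j → p < k → k < q → p = i ∧ q = j}

/-- The position of a vertex on the path from `i` to `j` along the face above `(i, j)`. -/
noncomputable def rk (i j q : ℕ) : ℕ := #{s ∈ insert i (D.face i j) | s < q}

/-- The number of neighbours of `i` strictly between `i` and `j`. -/
noncomputable def inL (i j : ℕ) : ℕ := #{r ∈ Ioo i j | D.E i r}

/-- The number of neighbours of `j` strictly between `i` and `j`. -/
noncomputable def inR (i j : ℕ) : ℕ := #{l ∈ Ioo i j | D.E l j}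

/-- The number of neighbours of `i` beyond `j`. -/
noncomputable def outL (i j : ℕ) : ℕ := #{r ∈ Ioc j D.N | D.E i r}

/-- The number of neighbours of `j` before `i`. -/
noncomputable def outR (i j : ℕ) : ℕ := #{l ∈ range i | D.E l j}

/-- `(k, l)` is an edge, other than `(i, j)`, of the face above `(i, j)`. -/
structure IsChild (i j k l : ℕ) : Prop where
  parent : D.E i j
  edge : D.E k l
  le_left : i ≤ k
  le_right : l ≤ j
  ne : ¬ (k = i ∧ l = j)
  left_mem : k ∈ insert i (D.face i j)
  right_mem : l ∈ insert j (D.face i j)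

/-- The cell `(p, q)`, which is an edge if `p < q` and a vertex if `p = q`, lies strictly above the
edge `(i, j)`. -/
def Under (p q i j : ℕ) : Prop := i ≤ p ∧ q ≤ j ∧ i < q ∧ p < j ∧ ¬ (p = i ∧ q = j)

variable {D} {i j k l p q t : ℕ}

theorem mem_face : k ∈ D.face i j ↔ (i < k ∧ k < j) ∧
    ∀ p q, D.E p q → i ≤ p → q ≤ j → p < k → k < q → p = i ∧ q = j := by
  simp [face]

/-- Among the edges above `(i, j)` that cover `(p, q)`, a longest one is an edge of the face above
`(i, j)`. If an end of `(p, q)` is hidden, the edge that hides it covers `(p, q)`, since edges do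
not cross. -/
theorem exists_isChild_of_edge (h : D.E i j) : ∀ (n p q : ℕ), j - i - (q - p) = n → D.E p q →
    i ≤ p → q ≤ j → ¬ (p = i ∧ q = j) → ∃ k l, D.IsChild i j k l ∧ k ≤ p ∧ q ≤ l := by
  intro n
  induction n using Nat.strong_induction_on with
  | _ n ih =>
    intro p q hn hpq hip hqj hne
    have hlt := D.lt hpq
    by_cases hp : p ∈ insert i (D.face i j)
    · by_cases hq : q ∈ insert j (D.face i j)
      · exact ⟨p, q, ⟨h, hpq, hip, hqj, hne, hp, hq⟩, le_rfl, le_rfl⟩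
      · simp only [mem_insert, mem_face, not_or, not_and, not_forall] at hq
        obtain ⟨hqj', hq⟩ := hq
        obtain ⟨p', q', he, h1, h2, h3, h4, h5⟩ := hq ⟨by omega, by omega⟩
        have hp' : p' ≤ p := by
          by_contra hc
          exact D.noncrossing hpq he (by omega) h3 h4
        have hm : j - i - (q' - p') < n := by clear h5; omega
        obtain ⟨k, l, hc, h6, h7⟩ := ih _ hm p' q' rfl he h1 h2 (fun h => h5 h.1 h.2)
        exact ⟨k, l, hc, by omega, by omega⟩
    · simp only [mem_insert, mem_face, not_or, not_and, not_forall] at hp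
      obtain ⟨hqj', hp⟩ := hp
      obtain ⟨p', q', he, h1, h2, h3, h4, h5⟩ := hp ⟨by omega, by omega⟩
      have hp' : q ≤ q' := by
        by_contra hc
        exact D.noncrossing he hpq h3 h4 (by omega)
      have hm : j - i - (q' - p') < n := by clear h5; omega
      obtain ⟨k, l, hc, h6, h7⟩ := ih _ hm p' q' rfl he h1 h2 (fun h => h5 h.1 h.2)
      exact ⟨k, l, hc, by omega, by omega⟩

/-- Every cell above `(i, j)` is a vertex or an edge of the face above `(i, j)`, or lies above such
an edge. -/
theorem exists_isChild (h : D.E i j) (hc : p = q ∨ D.E p q) (hu : Under p q i j) :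
    (p = q ∧ p ∈ D.face i j) ∨
      ∃ k l, D.IsChild i j k l ∧ ((k = p ∧ l = q) ∨ Under p q k l) := by
  obtain ⟨h1, h2, h3, h4, h5⟩ := hu
  rcases hc with rfl | hc
  · by_cases hp : p ∈ D.face i j
    · exact Or.inl ⟨rfl, hp⟩
    · right
      simp only [mem_face, not_and, not_forall] at hp
      obtain ⟨p', q', he, h6, h7, h8, h9, h10⟩ := hp ⟨by omega, by omega⟩
      obtain ⟨k, l, hc, h11, h12⟩ := exists_isChild_of_edge h _ p' q' rfl he h6 h7 (by omega)
      exact ⟨k, l, hc, Or.inr ⟨by omega, by omega, by omega, by omega, by omega⟩⟩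
  · right
    have := D.lt hc
    obtain ⟨k, l, hc, h11, h12⟩ := exists_isChild_of_edge h _ p q rfl hc h1 h2 h5
    refine ⟨k, l, hc, ?_⟩
    by_cases he : k = p ∧ l = q
    · exact Or.inl he
    · exact Or.inr ⟨by omega, by omega, by omega, by omega, by omega⟩

theorem rk_left : D.rk i j i = 0 := by
  simp only [rk, card_eq_zero, filter_eq_empty_iff, mem_insert, mem_face]
  omega

theorem rk_right (h : i < j) : D.rk i j j = #(D.face i j) + 1 := by
  rw [rk, filter_true_of_mem, card_insert_of_notMem]
  · simp [mem_face]
  · simp only [mem_insert, mem_face]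
    omega

theorem rk_pos (h : i < q) : 0 < D.rk i j q := by
  rw [rk, card_pos]
  exact ⟨i, by simp [h]⟩

theorem rk_lt (hk : k ∈ insert i (D.face i j)) (h : k < q) : D.rk i j k < D.rk i j q := by
  apply card_lt_card
  rw [ssubset_iff_of_subset]
  · exact ⟨k, by simp [h, mem_insert.1 hk], by simp⟩
  · intro s
    simp only [mem_filter]
    exact fun hs => ⟨hs.1, hs.2.trans h⟩

theorem rk_le_card (h : k ∈ D.face i j) : D.rk i j k ≤ #(D.face i j) := by
  have h1 := (mem_face.1 h).1
  have h2 := rk_lt (mem_insert_of_mem h) h1.2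
  rw [rk_right (by omega)] at h2
  omega

namespace IsChild

variable (hc : D.IsChild i j k l)
include hc

theorem lt : k < l := D.lt hc.edge

theorem rk_succ : D.rk i j l = D.rk i j k + 1 := by
  have hkl := hc.lt
  have : ({s ∈ insert i (D.face i j) | s < l} : Finset ℕ)
      = insert k {s ∈ insert i (D.face i j) | s < k} := by
    ext s
    simp only [mem_filter, mem_insert]
    constructor
    · rintro ⟨hs, hsl⟩
      by_cases h1 : s < k
      · exact Or.inr ⟨hs, h1⟩
      · left
        by_contra hsk
        rcases hs with rfl | hs
        · have := hc.le_left
          omega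
        · exact hc.ne ((mem_face.1 hs).2 k l hc.edge hc.le_left hc.le_right (by omega) hsl)
    · rintro (rfl | ⟨hs, hsl⟩)
      · exact ⟨mem_insert.1 hc.left_mem, hkl⟩
      · exact ⟨hs, by omega⟩
  rw [rk, this, card_insert_of_notMem (by simp)]
  rfl

theorem right_eq_or : l = j ∨ l ∈ D.face i j := mem_insert.1 hc.right_mem

theorem left_eq_or : k = i ∨ k ∈ D.face i j := mem_insert.1 hc.left_mem

theorem under : Under k l i j := by
  have h1 := hc.lt
  have h2 := hc.le_left
  have h3 := hc.le_right
  have h4 := hc.ne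
  exact ⟨by omega, by omega, by omega, by omega, by omega⟩

theorem rk_le : D.rk i j k ≤ #(D.face i j) := by
  have h1 := rk_right (D := D) (D.lt hc.parent)
  have h2 := hc.rk_succ
  rcases hc.right_eq_or with rfl | h
  · omega
  · have := rk_le_card h
    omega

theorem right_eq (h : D.rk i j k = #(D.face i j)) : l = j := by
  rcases hc.right_eq_or with h1 | h1
  · exact h1
  · have := rk_le_card h1
    have := hc.rk_succ
    omega

theorem left_eq (h : D.rk i j k = 0) : k = i := by
  by_contra hne
  have := rk_pos (D := D) (j := j) (lt_of_le_of_ne hc.le_left (Ne.symm hne))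
  omega

theorem left_mem_face (h : D.rk i j k ≠ 0) : k ∈ D.face i j := by
  rcases hc.left_eq_or with rfl | h1
  · exact absurd rk_left h
  · exact h1

theorem right_mem_face (h : D.rk i j k ≠ #(D.face i j)) : l ∈ D.face i j := by
  rcases hc.right_eq_or with rfl | h1
  · have := hc.rk_succ
    rw [rk_right (D.lt hc.parent)] at this
    omega
  · exact h1

theorem outL_eq_zero (h : k ∈ D.face i j) : D.outL k l = 0 := by
  simp only [outL, card_eq_zero, filter_eq_empty_iff, mem_Ioc]
  rintro r ⟨h1, h2⟩ he
  have hk := mem_face.1 h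
  have hkl := hc.lt
  have hlj := hc.le_right
  by_cases hr : r ≤ j
  · rcases hc.right_eq_or with rfl | hl
    · omega
    · have := (mem_face.1 hl).2 k r he hc.le_left hr hkl h1
      omega
  · exact D.noncrossing hc.parent he (by omega) (by omega) (by omega)

theorem outR_eq_zero (h : l ∈ D.face i j) : D.outR k l = 0 := by
  simp only [outR, card_eq_zero, filter_eq_empty_iff, mem_range]
  rintro r h1 he
  have hk := mem_face.1 h
  have hkl := hc.lt
  have hlj := hc.le_left
  by_cases hr : i ≤ r
  · rcases hc.left_eq_or with rfl | hl
    · omega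
    · have := (mem_face.1 hl).2 r l he hr hc.le_right h1 hkl
      omega
  · exact D.noncrossing he hc.parent (by omega) (by omega) (by omega)

end IsChild

theorem card_face_pos (h : D.E i j) (hij : i + 1 < j) : 0 < #(D.face i j) := by
  have hN := D.le h
  obtain ⟨k, l, hc, h1, h2⟩ := exists_isChild_of_edge h _ i (i + 1) rfl
    (D.succ (by omega)) le_rfl (by omega) (by omega)
  have := hc.le_left
  have := hc.ne
  rcases hc.right_eq_or with h3 | h3
  · omega
  · exact card_pos.2 ⟨l, h3⟩

theorem IsChild.card_face_pos (hc : D.IsChild i j k l) : 0 < #(D.face i j) := by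
  apply ChordDisc.card_face_pos hc.parent
  obtain ⟨h1, h2, h3, h4, h5⟩ := hc.under
  have := hc.lt
  omega

theorem inL_eq_zero_iff (h : D.E i j) : D.inL i j = 0 ↔ j = i + 1 := by
  have h1 := D.lt h
  have h2 := D.le h
  simp only [inL, card_eq_zero, filter_eq_empty_iff, mem_Ioo]
  constructor
  · intro h3
    by_contra h4
    exact h3 (x := i + 1) (by omega) (D.succ (by omega))
  · intro h3
    omega

theorem inR_eq_zero_iff (h : D.E i j) : D.inR i j = 0 ↔ j = i + 1 := by
  have h1 := D.lt h
  have h2 := D.le h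
  simp only [inR, card_eq_zero, filter_eq_empty_iff, mem_Ioo]
  constructor
  · intro h3
    by_contra h4
    have := D.succ (i := j - 1) (by omega)
    rw [Nat.sub_add_cancel (by omega)] at this
    exact h3 (x := j - 1) (by omega) this
  · intro h3
    omega

theorem IsChild.inL_parent (hc : D.IsChild i j i l) : D.inL i j = D.inL i l + 1 := by
  have hl : l ∈ D.face i j := by
    rcases hc.right_eq_or with h | h
    · exact absurd ⟨rfl, h⟩ hc.ne
    · exact h
  have hl' := mem_face.1 hl
  have : ({r ∈ Ioo i j | D.E i r} : Finset ℕ) = insert l {r ∈ Ioo i l | D.E i r} := by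
    ext r
    simp only [mem_filter, mem_insert, mem_Ioo]
    constructor
    · rintro ⟨h1, h2⟩
      by_cases h3 : r < l
      · exact Or.inr ⟨⟨h1.1, h3⟩, h2⟩
      · left
        by_contra h4
        have := hl'.2 i r h2 le_rfl (by omega) (by omega) (by omega)
        omega
    · rintro (rfl | ⟨h1, h2⟩)
      · exact ⟨hl'.1, hc.edge⟩
      · exact ⟨by omega, h2⟩
  rw [inL, this, card_insert_of_notMem (by simp)]
  rfl

theorem IsChild.inR_parent (hc : D.IsChild i j k j) : D.inR i j = D.inR k j + 1 := by
  have hl : k ∈ D.face i j := by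
    rcases hc.left_eq_or with h | h
    · exact absurd ⟨h, rfl⟩ hc.ne
    · exact h
  have hl' := mem_face.1 hl
  have : ({r ∈ Ioo i j | D.E r j} : Finset ℕ) = insert k {r ∈ Ioo k j | D.E r j} := by
    ext r
    simp only [mem_filter, mem_insert, mem_Ioo]
    constructor
    · rintro ⟨h1, h2⟩
      by_cases h3 : k < r
      · exact Or.inr ⟨⟨h3, h1.2⟩, h2⟩
      · left
        by_contra h4
        have := hl'.2 r j h2 (by omega) le_rfl (by omega) (by omega)
        omega
    · rintro (rfl | ⟨h1, h2⟩)
      · exact ⟨hl'.1, hc.edge⟩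
      · exact ⟨by omega, h2⟩
  rw [inR, this, card_insert_of_notMem (by simp)]
  rfl

/-- Seen from `i`, the parent edge `(i, j)` is the next one beyond its first child `(i, l)`. -/
theorem IsChild.outL_parent (hc : D.IsChild i j i l) : D.outL i l = D.outL i j + 1 := by
  have hl : l ∈ D.face i j := by
    rcases hc.right_eq_or with h | h
    · exact absurd ⟨rfl, h⟩ hc.ne
    · exact h
  have hl' := mem_face.1 hl
  have hN := D.le hc.parent
  have : ({r ∈ Ioc l D.N | D.E i r} : Finset ℕ) = insert j {r ∈ Ioc j D.N | D.E i r} := by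
    ext r
    simp only [mem_filter, mem_insert, mem_Ioc]
    constructor
    · rintro ⟨h1, h2⟩
      by_cases h3 : j < r
      · exact Or.inr ⟨⟨h3, h1.2⟩, h2⟩
      · left
        exact (hl'.2 i r h2 le_rfl (by omega) (by omega) (by omega)).2
    · rintro (rfl | ⟨h1, h2⟩)
      · exact ⟨by omega, hc.parent⟩
      · exact ⟨by omega, h2⟩
  rw [outL, this, card_insert_of_notMem (by simp)]
  rfl

theorem IsChild.outR_parent (hc : D.IsChild i j k j) : D.outR k j = D.outR i j + 1 := by
  have hl : k ∈ D.face i j := by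
    rcases hc.left_eq_or with h | h
    · exact absurd ⟨h, rfl⟩ hc.ne
    · exact h
  have hl' := mem_face.1 hl
  have : ({r ∈ range k | D.E r j} : Finset ℕ) = insert i {r ∈ range i | D.E r j} := by
    ext r
    simp only [mem_filter, mem_insert, mem_range]
    constructor
    · rintro ⟨h1, h2⟩
      by_cases h3 : r < i
      · exact Or.inr ⟨h3, h2⟩
      · left
        exact (hl'.2 r j h2 (by omega) le_rfl (by omega) (by omega)).1
    · rintro (rfl | ⟨h1, h2⟩)
      · exact ⟨by omega, hc.parent⟩
      · exact ⟨by omega, h2⟩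
  rw [outR, this, card_insert_of_notMem (by simp)]
  rfl

/-- At a vertex `k`, two of the at most four edges are `(p, k)` and `(k, l)` themselves. -/
theorem inR_add_inL_le (hp : D.E p k) (hl : D.E k l) : D.inR p k + D.inL k l ≤ 2 := by
  have h1 := D.lt hp
  have h2 := D.lt hl
  have h3 := D.le hl
  have hd := D.degree_le k (by omega) (by omega)
  have h4 : D.inR p k + 1 ≤ #{l ∈ range k | D.E l k} := by
    rw [inR, ← card_insert_of_notMem (a := p) (by simp)]
    apply card_le_card
    intro r
    simp only [mem_insert, mem_filter, mem_range, mem_Ioo]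
    rintro (rfl | h)
    · exact ⟨h1, hp⟩
    · exact ⟨h.1.2, h.2⟩
  have h5 : D.inL k l + 1 ≤ #{r ∈ Ioc k D.N | D.E k r} := by
    rw [inL, ← card_insert_of_notMem (a := l) (by simp)]
    apply card_le_card
    intro r
    simp only [mem_insert, mem_filter, mem_Ioc, mem_Ioo]
    rintro (rfl | h)
    · exact ⟨⟨h2, h3⟩, hl⟩
    · exact ⟨by omega, h.2⟩
  omega

theorem inL_le_two (h0 : 0 < k) (h : D.E k l) : D.inL k l ≤ 2 := by
  have h2 := D.lt h
  have h3 := D.le h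
  have := D.succ (i := k - 1) (by omega)
  rw [Nat.sub_add_cancel h0] at this
  have := inR_add_inL_le this h
  omega

theorem inR_le_two (h0 : l < D.N) (h : D.E k l) : D.inR k l ≤ 2 := by
  have := inR_add_inL_le h (D.succ h0)
  omega

/-- Every vertex other than `0` and `N` is on the face above some edge. -/
theorem exists_mem_face (h0 : 0 < k) (hN : k < D.N) :
    ∃ e : ℕ × ℕ, D.E e.1 e.2 ∧ k ∈ D.face e.1 e.2 := by
  have : ∃ n, ∃ i j, D.E i j ∧ i < k ∧ k < j ∧ j - i = n := ⟨_, 0, D.N, D.root, h0, hN, rfl⟩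
  obtain ⟨i, j, he, h1, h2, h3⟩ := Nat.find_spec this
  refine ⟨(i, j), he, mem_face.2 ⟨⟨h1, h2⟩, fun p q hpq h4 h5 h6 h7 => ?_⟩⟩
  have := Nat.find_min' this ⟨p, q, hpq, h6, h7, rfl⟩
  constructor <;> omega

theorem mem_face_unique {i' j' : ℕ} (h : D.E i j) (h' : D.E i' j') (hk : k ∈ D.face i j)
    (hk' : k ∈ D.face i' j') : i = i' ∧ j = j' := by
  rw [mem_face] at hk hk'
  have h1 := @hk'.2 i j h
  have h2 := @hk.2 i' j' h'
  have h3 := D.noncrossing h h'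
  have h4 := D.noncrossing h' h
  grind

/-- Every edge other than the root edge is an edge of the face above another edge. -/
theorem exists_parent (h : D.E k l) (hne : ¬ (k = 0 ∧ l = D.N)) : ∃ i j, D.IsChild i j k l := by
  have : ∃ n, ∃ i j, D.E i j ∧ Under k l i j ∧ j - i = n := by
    have h1 := D.lt h
    have h2 := D.le h
    exact ⟨_, 0, D.N, D.root, ⟨by omega, by omega, by omega, by omega, by omega⟩, rfl⟩
  obtain ⟨i, j, he, h1, h2⟩ := Nat.find_spec this
  rcases exists_isChild he (Or.inr h) h1 with h3 | ⟨k', l', hc, h3 | h3⟩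
  · have := D.lt h
    omega
  · exact ⟨i, j, by rwa [h3.1, h3.2] at hc⟩
  · have := Nat.find_min' this ⟨k', l', hc.edge, h3, rfl⟩
    have := hc.under
    have := hc.lt
    simp only [Under] at *
    omega

end ChordDisc

end

end SmoothOrthogonal


/-! ### The position of the vertices of a disc -/

namespace SmoothOrthogonal

section
open Finset
open scoped Classical

namespace ChordDisc

/-- The position of the vertex with rank `t` on the face, with `m` new vertices, above an edge
from `P` to `Q`. In the rotated coordinates used here (see `toC`) the edge is horizontal, or it is
a diagonal that rises from `P` to `Q` or from `Q` to `P`. The new vertices lie on a horizontal row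
and are evenly spaced. -/
noncomputable def place (P Q : ℝ × ℝ) (m t : ℝ) : ℝ × ℝ :=
  if P.2 = Q.2 then (P.1 + t * ((Q.1 - P.1) / (m + 1)), P.2 + (Q.1 - P.1) / (m + 1))
  else if P.2 < Q.2 then (P.1 + (t - 1) * ((Q.1 - P.1) / m), Q.2 + (Q.1 - P.1) / m)
  else (P.1 + t * ((Q.1 - P.1) / m), P.2 + (Q.1 - P.1) / m)

variable (D : ChordDisc)

/-- The edge that has the vertex `k` on the face above it. -/
noncomputable def parent (k : ℕ) : ℕ × ℕ :=
  if h : 0 < k ∧ k < D.N then (exists_mem_face h.1 h.2).choose else (0, 0)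

theorem parent_spec {k : ℕ} (h0 : 0 < k) (hN : k < D.N) :
    D.E (D.parent k).1 (D.parent k).2 ∧ k ∈ D.face (D.parent k).1 (D.parent k).2 := by
  rw [parent, dif_pos ⟨h0, hN⟩]
  exact (exists_mem_face h0 hN).choose_spec

/-- A measure that decreases from a vertex to the ends of its parent edge. -/
noncomputable def depth (k : ℕ) : ℕ :=
  if 0 < k ∧ k < D.N then D.N - ((D.parent k).2 - (D.parent k).1) + 1 else 0

variable {D} in
theorem depth_lt {i j k q : ℕ} (h : D.E i j) (hk : k ∈ D.face i j) (hq : q = i ∨ q = j) :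
    D.depth q < D.depth k := by
  have h1 := D.le h
  have h2 := (mem_face.1 hk).1
  have h3 := D.lt h
  have hp := parent_spec D (k := k) (by omega) (by omega)
  obtain ⟨h4, h5⟩ := mem_face_unique h hp.1 hk hp.2
  have h6 : D.depth k = D.N - (j - i) + 1 := by
    rw [depth, if_pos ⟨by omega, by omega⟩, ← h4, ← h5]
  rw [h6]
  unfold depth
  split_ifs with h7
  · have hp' := parent_spec D h7.1 h7.2
    have h8 := D.le hp'.1
    have h9 := (mem_face.1 hp'.2).1
    have h10 := D.noncrossing h hp'.1
    have h11 := D.noncrossing hp'.1 h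
    rcases hq with rfl | rfl
    · have : j ≤ (D.parent q).2 := by
        by_contra hc
        exact h11 (by omega) (by omega) (by omega)
      omega
    · have : (D.parent q).1 ≤ i := by
        by_contra hc
        exact h10 (by omega) (by omega) (by omega)
      omega
  · omega

/-- The position of the vertices, in rotated coordinates. -/
noncomputable def pos (k : ℕ) : ℝ × ℝ :=
  if _h : 0 < k ∧ k < D.N then
    place (pos (D.parent k).1) (pos (D.parent k).2) #(D.face (D.parent k).1 (D.parent k).2)
      (D.rk (D.parent k).1 (D.parent k).2 k)
  else if k = 0 then (0, 0) else (1, 0)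
termination_by D.depth k
decreasing_by
  · exact depth_lt (parent_spec D _h.1 _h.2).1 (parent_spec D _h.1 _h.2).2 (Or.inl rfl)
  · exact depth_lt (parent_spec D _h.1 _h.2).1 (parent_spec D _h.1 _h.2).2 (Or.inr rfl)

theorem pos_zero : D.pos 0 = (0, 0) := by
  rw [pos]
  simp

theorem pos_N : D.pos D.N = (1, 0) := by
  have := D.lt D.root
  rw [pos]
  simp
  omega

variable {D} {i j k l p q : ℕ}

theorem pos_of_mem_face (h : D.E i j) (hk : k ∈ D.face i j) :
    D.pos k = place (D.pos i) (D.pos j) #(D.face i j) (D.rk i j k) := by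
  have h1 := D.le h
  have h2 := (mem_face.1 hk).1
  have hp := parent_spec D (k := k) (by omega) (by omega)
  obtain ⟨h3, h4⟩ := mem_face_unique h hp.1 hk hp.2
  rw [pos, dif_pos ⟨by omega, by omega⟩, ← h3, ← h4]

/-! ### The five kinds of edges -/

variable (D) in
/-- A horizontal edge; it is drawn as a quarter circle below its endpoints. -/
structure IsA (i j : ℕ) : Prop where
  y : (D.pos i).2 = (D.pos j).2
  x : (D.pos i).1 < (D.pos j).1
  outL : D.outL i j = 0
  outR : D.outR i j = 0
  inL : D.inL i j ≤ 2
  inR : D.inR i j ≤ 2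

variable (D) in
/-- A diagonal edge that rises to the right; it is drawn as a segment. -/
structure IsBL (i j : ℕ) : Prop where
  y : (D.pos j).2 - (D.pos i).2 = (D.pos j).1 - (D.pos i).1
  x : (D.pos i).1 < (D.pos j).1
  outL : D.outL i j = 1
  outR : D.outR i j = 0
  inL : D.inL i j ≤ 1
  inR : D.inR i j ≤ 2

variable (D) in
/-- A diagonal edge that falls to the right; it is drawn as a segment. -/
structure IsBR (i j : ℕ) : Prop where
  y : (D.pos i).2 - (D.pos j).2 = (D.pos j).1 - (D.pos i).1
  x : (D.pos i).1 < (D.pos j).1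
  outL : D.outL i j = 0
  outR : D.outR i j = 1
  inL : D.inL i j ≤ 2
  inR : D.inR i j ≤ 1

variable (D) in
/-- A vertical edge that rises; nothing is drawn above it, and it is drawn as a quarter circle to
the left of its endpoints. -/
structure IsCL (i j : ℕ) : Prop where
  y : (D.pos i).2 < (D.pos j).2
  x : (D.pos i).1 = (D.pos j).1
  outL : D.outL i j = 2
  outR : D.outR i j = 0
  succ : j = i + 1

variable (D) in
/-- A vertical edge that falls; nothing is drawn above it, and it is drawn as a quarter circle to
the right of its endpoints. -/
structure IsCR (i j : ℕ) : Prop where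
  y : (D.pos j).2 < (D.pos i).2
  x : (D.pos i).1 = (D.pos j).1
  outL : D.outL i j = 0
  outR : D.outR i j = 2
  succ : j = i + 1

variable (D) in
/-- The edge is of one of the five kinds. -/
def Framed (i j : ℕ) : Prop :=
  D.IsA i j ∨ D.IsBL i j ∨ D.IsBR i j ∨ D.IsCL i j ∨ D.IsCR i j

variable (D) in
/-- The new vertices of the face above `(i, j)` lie on the row at height `R`; the one with rank
`t` has abscissa `x + t * d`. -/
structure Row (i j : ℕ) (x d R : ℝ) : Prop where
  pos_d : 0 < d
  pos_eq : ∀ k ∈ D.face i j, D.pos k = (x + D.rk i j k * d, R)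

theorem IsA.row (h : D.IsA i j) (he : D.E i j) : ∃ x d R, D.Row i j x d R ∧
    D.pos i = (x, R - d) ∧ D.pos j = (x + (#(D.face i j) + 1) * d, R - d) := by
  have h1 := h.x
  have h2 := h.y
  have h3 : 0 < (#(D.face i j) : ℝ) + 1 := by positivity
  refine ⟨(D.pos i).1, ((D.pos j).1 - (D.pos i).1) / (#(D.face i j) + 1),
    (D.pos i).2 + ((D.pos j).1 - (D.pos i).1) / (#(D.face i j) + 1),
    ⟨div_pos (by linarith) h3, fun k hk => ?_⟩, ?_, ?_⟩
  · rw [pos_of_mem_face he hk, place, if_pos h2]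
  · ext <;> simp
  · ext
    · simp only
      field_simp
      ring
    · simp [h2]

theorem IsBL.row (h : D.IsBL i j) (he : D.E i j) (hm : 0 < #(D.face i j)) :
    ∃ x d R, D.Row i j x d R ∧ D.pos i = (x + d, R - d - #(D.face i j) * d) ∧
      D.pos j = (x + (#(D.face i j) + 1) * d, R - d) := by
  have h1 := h.x
  have h2 := h.y
  have h3 : 0 < (#(D.face i j) : ℝ) := by exact_mod_cast hm
  refine ⟨(D.pos i).1 - ((D.pos j).1 - (D.pos i).1) / #(D.face i j),
    ((D.pos j).1 - (D.pos i).1) / #(D.face i j),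
    (D.pos j).2 + ((D.pos j).1 - (D.pos i).1) / #(D.face i j),
    ⟨div_pos (by linarith) h3, fun k hk => ?_⟩, ?_, ?_⟩
  · rw [pos_of_mem_face he hk, place, if_neg (by linarith), if_pos (by linarith)]
    ext
    · simp only
      ring
    · rfl
  · ext
    · simp
    · simp only
      field_simp
      linear_combination -(#(D.face i j) : ℝ) * h2
  · ext
    · simp only
      field_simp
      ring
    · simp

theorem IsBR.row (h : D.IsBR i j) (he : D.E i j) (hm : 0 < #(D.face i j)) :
    ∃ x d R, D.Row i j x d R ∧ D.pos i = (x, R - d) ∧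
      D.pos j = (x + #(D.face i j) * d, R - d - #(D.face i j) * d) := by
  have h1 := h.x
  have h2 := h.y
  have h3 : 0 < (#(D.face i j) : ℝ) := by exact_mod_cast hm
  refine ⟨(D.pos i).1, ((D.pos j).1 - (D.pos i).1) / #(D.face i j),
    (D.pos i).2 + ((D.pos j).1 - (D.pos i).1) / #(D.face i j),
    ⟨div_pos (by linarith) h3, fun k hk => ?_⟩, ?_, ?_⟩
  · rw [pos_of_mem_face he hk, place, if_neg (by linarith), if_neg (by linarith)]
  · ext <;> simp
  · ext
    · simp only
      field_simp
      ring
    · simp only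
      field_simp
      linear_combination -(#(D.face i j) : ℝ) * h2

namespace IsChild

variable (hc : D.IsChild i j k l)
include hc

theorem isA {x d R : ℝ} (hr : D.Row i j x d R) (h0 : D.rk i j k ≠ 0)
    (hm : D.rk i j k ≠ #(D.face i j)) :
    D.IsA k l ∧ D.pos k = (x + D.rk i j k * d, R) ∧ D.pos l = (x + (D.rk i j k + 1) * d, R) := by
  have hk := hc.left_mem_face h0
  have hl := hc.right_mem_face hm
  have h1 := hr.pos_d
  have h2 := hr.pos_eq k hk
  have h3 : D.pos l = (x + (D.rk i j k + 1) * d, R) := by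
    rw [hr.pos_eq l hl, hc.rk_succ]
    push_cast
    rfl
  have h4 := mem_face.1 hl
  have h5 := D.le hc.parent
  have h6 := mem_face.1 hk
  refine ⟨⟨?_, ?_, hc.outL_eq_zero hk, hc.outR_eq_zero hl, inL_le_two (by omega) hc.edge,
    inR_le_two (by omega) hc.edge⟩, h2, h3⟩
  · rw [h2, h3]
  · rw [h2, h3]
    linarith

theorem rk_ne (h : D.rk i j k = 0) : D.rk i j k ≠ #(D.face i j) := by
  have := hc.card_face_pos
  omega

theorem pos_right_of_rk_eq_zero {x d R : ℝ} (hr : D.Row i j x d R) (h : D.rk i j k = 0) :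
    D.pos l = (x + d, R) := by
  rw [hr.pos_eq l (hc.right_mem_face (hc.rk_ne h)), hc.rk_succ, h]
  simp

theorem isBL {x d R : ℝ} (hr : D.Row i j x d R) (h : D.rk i j k = 0) (hi : D.pos i = (x, R - d))
    (h0 : D.outL i j = 0) (h1 : D.inL i j ≤ 2) : D.IsBL k l := by
  have hl := hc.right_mem_face (hc.rk_ne h)
  have h2 := hc.pos_right_of_rk_eq_zero hr h
  obtain rfl := hc.left_eq h
  have h3 := hr.pos_d
  have h4 := hc.outL_parent
  have h5 := hc.inL_parent
  have h6 := mem_face.1 hl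
  have h7 := D.le hc.parent
  refine ⟨?_, ?_, by omega, hc.outR_eq_zero hl, by omega, inR_le_two (by omega) hc.edge⟩
  · rw [h2, hi]
    ring
  · rw [h2, hi]
    linarith

theorem isCL {x d R y : ℝ} (hr : D.Row i j x d R) (h : D.rk i j k = 0) (hi : D.pos i = (x + d, y))
    (hy : y < R) (h0 : D.outL i j = 1) (h1 : D.inL i j ≤ 1) : D.IsCL k l := by
  have hl := hc.right_mem_face (hc.rk_ne h)
  have h2 := hc.pos_right_of_rk_eq_zero hr h
  obtain rfl := hc.left_eq h
  have h4 := hc.outL_parent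
  have h5 := hc.inL_parent
  refine ⟨?_, ?_, by omega, hc.outR_eq_zero hl, (inL_eq_zero_iff hc.edge).1 (by omega)⟩
  · rw [h2, hi]
    exact hy
  · rw [h2, hi]

theorem pos_left_of_rk_eq_card {x d R : ℝ} (hr : D.Row i j x d R)
    (h : D.rk i j k = #(D.face i j)) : D.pos k = (x + #(D.face i j) * d, R) := by
  have := hc.card_face_pos
  rw [hr.pos_eq k (hc.left_mem_face (by omega)), h]

theorem isBR {x d R : ℝ} (hr : D.Row i j x d R) (h : D.rk i j k = #(D.face i j))
    (hj : D.pos j = (x + (#(D.face i j) + 1) * d, R - d))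
    (h0 : D.outR i j = 0) (h1 : D.inR i j ≤ 2) : D.IsBR k l := by
  have := hc.card_face_pos
  have hl := hc.left_mem_face (by omega)
  have h2 := hc.pos_left_of_rk_eq_card hr h
  obtain rfl := hc.right_eq h
  have h3 := hr.pos_d
  have h4 := hc.outR_parent
  have h5 := hc.inR_parent
  have h6 := mem_face.1 hl
  refine ⟨?_, ?_, hc.outL_eq_zero hl, by omega, inL_le_two (by omega) hc.edge, by omega⟩
  · rw [h2, hj]
    ring
  · rw [h2, hj]
    linarith

theorem isCR {x d R y : ℝ} (hr : D.Row i j x d R) (h : D.rk i j k = #(D.face i j))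
    (hj : D.pos j = (x + #(D.face i j) * d, y)) (hy : y < R)
    (h0 : D.outR i j = 1) (h1 : D.inR i j ≤ 1) : D.IsCR k l := by
  have := hc.card_face_pos
  have hl := hc.left_mem_face (by omega)
  have h2 := hc.pos_left_of_rk_eq_card hr h
  obtain rfl := hc.right_eq h
  have h4 := hc.outR_parent
  have h5 := hc.inR_parent
  refine ⟨?_, ?_, hc.outL_eq_zero hl, by omega, (inR_eq_zero_iff hc.edge).1 (by omega)⟩
  · rw [h2, hj]
    exact hy
  · rw [h2, hj]

/-- The kind of an edge determines the kinds of its children: above a horizontal edge there are a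
rising diagonal, horizontal edges and a falling diagonal; above a rising diagonal the first child is
vertical instead, and above a falling diagonal the last one is. The degree bounds show that nothing
is above a vertical edge. -/
theorem framed (h : D.Framed i j) : D.Framed k l := by
  have hm := hc.card_face_pos
  have hm' : (0 : ℝ) < #(D.face i j) := by exact_mod_cast hm
  rcases h with h | h | h | h | h
  · obtain ⟨x, d, R, hr, hi, hj⟩ := h.row hc.parent
    by_cases h0 : D.rk i j k = 0
    · exact Or.inr (Or.inl (hc.isBL hr h0 hi h.outL h.inL))
    by_cases h1 : D.rk i j k = #(D.face i j)
    · exact Or.inr (Or.inr (Or.inl (hc.isBR hr h1 hj h.outR h.inR)))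
    · exact Or.inl (hc.isA hr h0 h1).1
  · obtain ⟨x, d, R, hr, hi, hj⟩ := h.row hc.parent hm
    have := mul_pos hm' hr.pos_d
    have := hr.pos_d
    by_cases h0 : D.rk i j k = 0
    · exact Or.inr (Or.inr (Or.inr (Or.inl (hc.isCL hr h0 hi (by linarith) h.outL h.inL))))
    by_cases h1 : D.rk i j k = #(D.face i j)
    · exact Or.inr (Or.inr (Or.inl (hc.isBR hr h1 hj h.outR h.inR)))
    · exact Or.inl (hc.isA hr h0 h1).1
  · obtain ⟨x, d, R, hr, hi, hj⟩ := h.row hc.parent hm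
    have := mul_pos hm' hr.pos_d
    have := hr.pos_d
    by_cases h0 : D.rk i j k = 0
    · exact Or.inr (Or.inl (hc.isBL hr h0 hi h.outL h.inL))
    by_cases h1 : D.rk i j k = #(D.face i j)
    · exact Or.inr (Or.inr (Or.inr (Or.inr (hc.isCR hr h1 hj (by linarith) h.outR h.inR))))
    · exact Or.inl (hc.isA hr h0 h1).1
  all_goals
    have h1 := h.succ
    obtain ⟨h2, h3, h4, h5, h6⟩ := hc.under
    have := hc.lt
    omega

end IsChild

theorem isA_root : D.IsA 0 D.N where
  y := by rw [pos_zero, pos_N]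
  x := by rw [pos_zero, pos_N]; exact one_pos
  outL := by simp [outL]
  outR := by simp [outR]
  inL := D.root_left
  inR := D.root_right

theorem framed_of_edge (h : D.E k l) : D.Framed k l := by
  have key : ∀ n k l, D.N - (l - k) = n → D.E k l → D.Framed k l := by
    intro n
    induction n using Nat.strong_induction_on with
    | _ n ih =>
      intro k l hn he
      by_cases hne : k = 0 ∧ l = D.N
      · rw [hne.1, hne.2]
        exact Or.inl isA_root
      · obtain ⟨i, j, hc⟩ := exists_parent he hne
        refine hc.framed (ih (D.N - (j - i)) ?_ i j rfl hc.parent)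
        obtain ⟨h2, h3, h4, h5, h6⟩ := hc.under
        have := hc.lt
        have := D.le hc.parent
        omega
  exact key _ k l rfl h

end ChordDisc

end

end SmoothOrthogonal


/-! ### Zones, regions and cells -/

namespace SmoothOrthogonal

section
open Finset
open scoped Classical

namespace ChordDisc

/-- A set, described by linear inequalities, that contains the interior of the curve which joins
`P` to `Q`. A quarter circle over a chord of length `s` bulges by `(√2 - 1) / 2 * s`, which is less
than `9 / 40 * s`. -/
def zone (P Q p : ℝ × ℝ) : Prop :=
  if P.2 = Q.2 then P.1 < p.1 ∧ p.1 < Q.1 ∧ p.2 < P.2 ∧ P.2 - (Q.1 - P.1) / 4 < p.2 ∧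
    P.1 - p.1 < p.2 - P.2 ∧ p.1 - Q.1 < p.2 - P.2
  else if P.1 = Q.1 then
    if P.2 < Q.2 then p.1 < P.1 ∧ P.1 - 9 / 40 * (Q.2 - P.2) < p.1 ∧ P.2 < p.2 ∧ p.2 < Q.2 ∧
      P.1 - p.1 < p.2 - P.2 ∧ P.1 - p.1 < Q.2 - p.2
    else Q.1 < p.1 ∧ p.1 < Q.1 + 9 / 40 * (P.2 - Q.2) ∧ Q.2 < p.2 ∧ p.2 < P.2 ∧
      p.1 - Q.1 < p.2 - Q.2 ∧ p.1 - Q.1 < P.2 - p.2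
  else P.1 < p.1 ∧ p.1 < Q.1 ∧ if P.2 < Q.2 then p.2 - P.2 = p.1 - P.1 else p.2 - P.2 = P.1 - p.1

/-- The region that is reserved for what is drawn above an edge from `P` to `Q`. It is an upward
half-strip; on the side of an end with two edges above `(P, Q)`, it may protrude beyond that end,
by the fraction `c` of the size of the outermost of these edges. The numbers of edges at the two
ends are `K` and `L`.

As `c ≤ 1 / 2`, the protrusions of two edges on a row do not meet over an edge between them, and as
`9 / 20 = 2 * (9 / 40)` is at most `c`, there is room for the bulge of a vertical edge, whose length
is at most twice the width of its parent. -/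
def reg (c : ℝ) (K L : ℕ) (P Q p : ℝ × ℝ) : Prop :=
  if P.2 = Q.2 then P.2 < p.2 ∧
    (P.1 < p.1 ∨ K = 2 ∧ P.1 - c * ((Q.1 - P.1) / 2) < p.1 ∧ P.1 - p.1 < p.2 - P.2) ∧
    (p.1 < Q.1 ∨ L = 2 ∧ p.1 < Q.1 + c * ((Q.1 - P.1) / 2) ∧ p.1 - Q.1 < p.2 - P.2)
  else if P.2 < Q.2 then P.1 - c * (Q.1 - P.1) < p.1 ∧ P.1 - p.1 < p.2 - P.2 ∧
    p.1 - P.1 < p.2 - P.2 ∧ (p.1 < Q.1 ∨ L = 2 ∧ p.1 < Q.1 + c * (Q.1 - P.1))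
  else p.1 < Q.1 + c * (Q.1 - P.1) ∧ p.1 - Q.1 < p.2 - Q.2 ∧
    Q.1 - p.1 < p.2 - Q.2 ∧ (P.1 < p.1 ∨ K = 2 ∧ P.1 - c * (Q.1 - P.1) < p.1)

variable (D : ChordDisc)

/-- A set that contains the interior of the curve drawn for the edge `(i, j)`. -/
def Zone (i j : ℕ) (p : ℝ × ℝ) : Prop := zone (D.pos i) (D.pos j) p

/-- The region that is reserved for what is drawn above the edge `(i, j)`; it is empty if there is
nothing above the edge. -/
def Reg (c : ℝ) (i j : ℕ) (p : ℝ × ℝ) : Prop :=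
  D.inL i j ≠ 0 ∧ reg c (D.inL i j) (D.inR i j) (D.pos i) (D.pos j) p

/-- The part of the plane that belongs to the cell `(i, j)` and everything above it: for a vertex,
that is, if `i = j`, its position, and for an edge the zone of its curve and the region above. -/
def Cell (c : ℝ) (i j : ℕ) (p : ℝ × ℝ) : Prop :=
  if i = j then p = D.pos i else D.Zone i j p ∨ D.Reg c i j p

variable {D} {i j k l : ℕ} {c x d R : ℝ} {p : ℝ × ℝ}

theorem IsChild.cell_iff (hc : D.IsChild i j k l) :
    D.Cell c k l p ↔ D.Zone k l p ∨ D.Reg c k l p := by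
  rw [Cell, if_neg hc.lt.ne]

theorem IsA.zone_iff (h : D.IsA i j) : D.Zone i j p ↔
    (D.pos i).1 < p.1 ∧ p.1 < (D.pos j).1 ∧ p.2 < (D.pos i).2 ∧
      (D.pos i).2 - ((D.pos j).1 - (D.pos i).1) / 4 < p.2 ∧
      (D.pos i).1 - p.1 < p.2 - (D.pos i).2 ∧ p.1 - (D.pos j).1 < p.2 - (D.pos i).2 := by
  rw [Zone, zone, if_pos h.y]

theorem IsBL.zone_iff (h : D.IsBL i j) : D.Zone i j p ↔
    (D.pos i).1 < p.1 ∧ p.1 < (D.pos j).1 ∧ p.2 - (D.pos i).2 = p.1 - (D.pos i).1 := by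
  have h1 := h.x
  have h2 := h.y
  rw [Zone, zone, if_neg (by linarith), if_neg (by linarith), if_pos (by linarith)]

theorem IsBR.zone_iff (h : D.IsBR i j) : D.Zone i j p ↔
    (D.pos i).1 < p.1 ∧ p.1 < (D.pos j).1 ∧ p.2 - (D.pos i).2 = (D.pos i).1 - p.1 := by
  have h1 := h.x
  have h2 := h.y
  rw [Zone, zone, if_neg (by linarith), if_neg (by linarith), if_neg (by linarith)]

theorem IsCL.zone_iff (h : D.IsCL i j) : D.Zone i j p ↔ p.1 < (D.pos i).1 ∧
    (D.pos i).1 - 9 / 40 * ((D.pos j).2 - (D.pos i).2) < p.1 ∧ (D.pos i).2 < p.2 ∧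
    p.2 < (D.pos j).2 ∧ (D.pos i).1 - p.1 < p.2 - (D.pos i).2 ∧
    (D.pos i).1 - p.1 < (D.pos j).2 - p.2 := by
  have h1 := h.x
  have h2 := h.y
  rw [Zone, zone, if_neg (by linarith), if_pos h1, if_pos h2]

theorem IsCR.zone_iff (h : D.IsCR i j) : D.Zone i j p ↔ (D.pos j).1 < p.1 ∧
    p.1 < (D.pos j).1 + 9 / 40 * ((D.pos i).2 - (D.pos j).2) ∧ (D.pos j).2 < p.2 ∧
    p.2 < (D.pos i).2 ∧ p.1 - (D.pos j).1 < p.2 - (D.pos j).2 ∧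
    p.1 - (D.pos j).1 < (D.pos i).2 - p.2 := by
  have h1 := h.x
  have h2 := h.y
  rw [Zone, zone, if_neg (by linarith), if_pos h1, if_neg (by linarith)]

theorem IsA.reg_iff (h : D.IsA i j) : D.Reg c i j p ↔ D.inL i j ≠ 0 ∧ (D.pos i).2 < p.2 ∧
    ((D.pos i).1 < p.1 ∨ D.inL i j = 2 ∧
      (D.pos i).1 - c * (((D.pos j).1 - (D.pos i).1) / 2) < p.1 ∧
      (D.pos i).1 - p.1 < p.2 - (D.pos i).2) ∧
    (p.1 < (D.pos j).1 ∨ D.inR i j = 2 ∧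
      p.1 < (D.pos j).1 + c * (((D.pos j).1 - (D.pos i).1) / 2) ∧
      p.1 - (D.pos j).1 < p.2 - (D.pos i).2) := by
  rw [Reg, reg, if_pos h.y]

theorem IsBL.reg_iff (h : D.IsBL i j) : D.Reg c i j p ↔ D.inL i j ≠ 0 ∧
    (D.pos i).1 - c * ((D.pos j).1 - (D.pos i).1) < p.1 ∧
    (D.pos i).1 - p.1 < p.2 - (D.pos i).2 ∧ p.1 - (D.pos i).1 < p.2 - (D.pos i).2 ∧
    (p.1 < (D.pos j).1 ∨
      D.inR i j = 2 ∧ p.1 < (D.pos j).1 + c * ((D.pos j).1 - (D.pos i).1)) := by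
  have h1 := h.x
  have h2 := h.y
  rw [Reg, reg, if_neg (by linarith), if_pos (by linarith)]

theorem IsBR.reg_iff (h : D.IsBR i j) : D.Reg c i j p ↔ D.inL i j ≠ 0 ∧
    p.1 < (D.pos j).1 + c * ((D.pos j).1 - (D.pos i).1) ∧
    p.1 - (D.pos j).1 < p.2 - (D.pos j).2 ∧ (D.pos j).1 - p.1 < p.2 - (D.pos j).2 ∧
    ((D.pos i).1 < p.1 ∨
      D.inL i j = 2 ∧ (D.pos i).1 - c * ((D.pos j).1 - (D.pos i).1) < p.1) := by
  have h1 := h.x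
  have h2 := h.y
  rw [Reg, reg, if_neg (by linarith), if_neg (by linarith)]

theorem not_reg (he : D.E i j) (h : j = i + 1) : ¬ D.Reg c i j p :=
  fun hr => hr.1 ((inL_eq_zero_iff he).2 h)

theorem not_reg_of_zone (he : D.E i j) (hz : D.Zone i j p) : ¬ D.Reg c i j p := by
  intro hr
  rcases framed_of_edge he with h | h | h | h | h
  · rw [h.zone_iff] at hz
    rw [h.reg_iff] at hr
    linarith
  · rw [h.zone_iff] at hz
    rw [h.reg_iff] at hr
    linarith
  · rw [h.zone_iff] at hz
    rw [h.reg_iff] at hr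
    have := h.y
    linarith
  · exact not_reg he h.succ hr
  · exact not_reg he h.succ hr

/-! ### Neighbouring edges of a face keep apart -/

/-- The bounds on the cell of an edge with rank `t` on a face with `m` new vertices: it stays
between the vertical lines through its endpoints, except above the row and next to an endpoint at
which there are two edges above it. -/
def Slab (c x d R : ℝ) (t m K L : ℕ) (p : ℝ × ℝ) : Prop :=
  (t = 0 ∨ x + t * d < p.1 ∨ K = 2 ∧ x + t * d - c * d < p.1 ∧ x + t * d - p.1 < p.2 - R) ∧
  (t = m ∨ p.1 < x + (t + 1) * d ∨
    L = 2 ∧ p.1 < x + (t + 1) * d + c * d ∧ p.1 - (x + (t + 1) * d) < p.2 - R) ∧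
  (K = 0 → p.2 < R)

theorem IsChild.slab_of_isA (hc : D.IsChild i j k l) (hr : D.Row i j x d R)
    (h0 : D.rk i j k ≠ 0) (hm : D.rk i j k ≠ #(D.face i j)) (hc0 : 0 ≤ c)
    (hp : D.Zone k l p ∨ D.Reg c k l p) :
    Slab c x d R (D.rk i j k) #(D.face i j) (D.inL k l) (D.inR k l) p := by
  obtain ⟨hA, hk, hl⟩ := hc.isA hr h0 hm
  have hd := hr.pos_d
  have hcd := mul_nonneg hc0 hd.le
  rw [hA.zone_iff, hA.reg_iff, hk, hl] at hp
  simp only at hp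
  have e : c * ((x + (D.rk i j k + 1) * d - (x + D.rk i j k * d)) / 2) = c * d / 2 := by ring
  rw [e] at hp
  rcases hp with hp | hp
  · exact ⟨Or.inr (Or.inl (by linarith)), Or.inr (Or.inl (by linarith)), fun _ => by linarith⟩
  · refine ⟨Or.inr (hp.2.2.1.imp id fun h => ⟨h.1, by linarith, by linarith⟩),
      Or.inr (hp.2.2.2.imp id fun h => ⟨h.1, by linarith, by linarith⟩), fun h => absurd h hp.1⟩

theorem IsChild.slab_of_isBL (hc : D.IsChild i j k l) (hr : D.Row i j x d R)
    (h0 : D.rk i j k = 0) (hi : D.pos i = (x, R - d)) (hBL : D.IsBL k l)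
    (hp : D.Zone k l p ∨ D.Reg c k l p) :
    Slab c x d R (D.rk i j k) #(D.face i j) (D.inL k l) (D.inR k l) p := by
  have hl := hc.pos_right_of_rk_eq_zero hr h0
  have hd := hr.pos_d
  obtain rfl := hc.left_eq h0
  rw [hBL.zone_iff, hBL.reg_iff, hi, hl] at hp
  refine ⟨Or.inl h0, Or.inr ?_, fun h => ?_⟩ <;> rw [h0] at * <;> simp only [Nat.cast_zero] at *
  · rcases hp with hp | hp
    · exact Or.inl (by linarith)
    · rw [add_sub_cancel_left] at hp
      exact hp.2.2.2.2.imp (fun h => by linarith) fun h => ⟨h.1, by linarith, by linarith⟩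
  · rcases hp with hp | hp
    · linarith
    · exact absurd h hp.1

theorem IsChild.slab_of_isCL (hc : D.IsChild i j k l) (hr : D.Row i j x d R)
    (h0 : D.rk i j k = 0) {y : ℝ} (hi : D.pos i = (x + d, y)) (hCL : D.IsCL k l)
    (hp : D.Zone k l p ∨ D.Reg c k l p) :
    Slab c x d R (D.rk i j k) #(D.face i j) (D.inL k l) (D.inR k l) p := by
  have hl := hc.pos_right_of_rk_eq_zero hr h0
  have hp := hp.resolve_right (not_reg hc.edge hCL.succ)
  obtain rfl := hc.left_eq h0
  rw [hCL.zone_iff, hi, hl] at hp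
  refine ⟨Or.inl h0, Or.inr (Or.inl ?_), fun h => ?_⟩ <;> rw [h0] at * <;>
    simp only [Nat.cast_zero] at * <;> linarith

theorem IsChild.slab_of_isBR (hc : D.IsChild i j k l) (hr : D.Row i j x d R)
    (h0 : D.rk i j k = #(D.face i j)) (hj : D.pos j = (x + (#(D.face i j) + 1) * d, R - d))
    (hBR : D.IsBR k l) (hp : D.Zone k l p ∨ D.Reg c k l p) :
    Slab c x d R (D.rk i j k) #(D.face i j) (D.inL k l) (D.inR k l) p := by
  have hl := hc.pos_left_of_rk_eq_card hr h0
  have hd := hr.pos_d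
  obtain rfl := hc.right_eq h0
  rw [hBR.zone_iff, hBR.reg_iff, hj, hl] at hp
  have e : x + (#(D.face i l) + 1) * d - (x + #(D.face i l) * d) = d := by ring
  simp only at hp
  rw [e] at hp
  refine ⟨Or.inr ?_, Or.inl h0, fun h => ?_⟩ <;> try rw [h0]
  · rcases hp with hp | hp
    · exact Or.inl (by linarith)
    · exact hp.2.2.2.2.imp (fun h => by linarith) fun h => ⟨h.1, by linarith, by linarith⟩
  · rcases hp with hp | hp
    · linarith
    · exact absurd h hp.1

theorem IsChild.slab_of_isCR (hc : D.IsChild i j k l) (hr : D.Row i j x d R)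
    (h0 : D.rk i j k = #(D.face i j)) {y : ℝ} (hj : D.pos j = (x + #(D.face i j) * d, y))
    (hCR : D.IsCR k l) (hp : D.Zone k l p ∨ D.Reg c k l p) :
    Slab c x d R (D.rk i j k) #(D.face i j) (D.inL k l) (D.inR k l) p := by
  have hl := hc.pos_left_of_rk_eq_card hr h0
  have hp := hp.resolve_right (not_reg hc.edge hCR.succ)
  obtain rfl := hc.right_eq h0
  rw [hCR.zone_iff, hj, hl] at hp
  refine ⟨Or.inr (Or.inl ?_), Or.inl h0, fun h => ?_⟩ <;> rw [h0] at * <;> linarith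

variable (D) in
/-- The ends of the edge `(i, j)` in terms of the row above it. -/
def Ends (i j : ℕ) (x d R : ℝ) : Prop :=
  (D.IsA i j ∧ D.pos i = (x, R - d) ∧ D.pos j = (x + (#(D.face i j) + 1) * d, R - d)) ∨
  (D.IsBL i j ∧ D.pos i = (x + d, R - d - #(D.face i j) * d) ∧
    D.pos j = (x + (#(D.face i j) + 1) * d, R - d)) ∨
  (D.IsBR i j ∧ D.pos i = (x, R - d) ∧
    D.pos j = (x + #(D.face i j) * d, R - d - #(D.face i j) * d))

/-- The data of a face with new vertices: its row, and for each child edge the slab that contains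
its cell. -/
theorem exists_row (he : D.E i j) (hm : 0 < #(D.face i j)) : ∃ x d R, D.Row i j x d R ∧
    D.Ends i j x d R ∧ ∀ c p k l, 0 ≤ c → D.IsChild i j k l → D.Cell c k l p →
      Slab c x d R (D.rk i j k) #(D.face i j) (D.inL k l) (D.inR k l) p := by
  have hm' : (0 : ℝ) < #(D.face i j) := by exact_mod_cast hm
  rcases framed_of_edge he with h | h | h | h | h
  · obtain ⟨x, d, R, hr, hi, hj⟩ := h.row he
    refine ⟨x, d, R, hr, Or.inl ⟨h, hi, hj⟩, fun c p k l hc0 hc hp => ?_⟩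
    rw [hc.cell_iff] at hp
    by_cases h0 : D.rk i j k = 0
    · exact hc.slab_of_isBL hr h0 hi (hc.isBL hr h0 hi h.outL h.inL) hp
    by_cases h1 : D.rk i j k = #(D.face i j)
    · exact hc.slab_of_isBR hr h1 hj (hc.isBR hr h1 hj h.outR h.inR) hp
    · exact hc.slab_of_isA hr h0 h1 hc0 hp
  · obtain ⟨x, d, R, hr, hi, hj⟩ := h.row he hm
    have := mul_pos hm' hr.pos_d
    have := hr.pos_d
    refine ⟨x, d, R, hr, Or.inr (Or.inl ⟨h, hi, hj⟩), fun c p k l hc0 hc hp => ?_⟩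
    rw [hc.cell_iff] at hp
    by_cases h0 : D.rk i j k = 0
    · exact hc.slab_of_isCL hr h0 hi (hc.isCL hr h0 hi (by linarith) h.outL h.inL) hp
    by_cases h1 : D.rk i j k = #(D.face i j)
    · exact hc.slab_of_isBR hr h1 hj (hc.isBR hr h1 hj h.outR h.inR) hp
    · exact hc.slab_of_isA hr h0 h1 hc0 hp
  · obtain ⟨x, d, R, hr, hi, hj⟩ := h.row he hm
    have := mul_pos hm' hr.pos_d
    have := hr.pos_d
    refine ⟨x, d, R, hr, Or.inr (Or.inr ⟨h, hi, hj⟩), fun c p k l hc0 hc hp => ?_⟩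
    rw [hc.cell_iff] at hp
    by_cases h0 : D.rk i j k = 0
    · exact hc.slab_of_isBL hr h0 hi (hc.isBL hr h0 hi h.outL h.inL) hp
    by_cases h1 : D.rk i j k = #(D.face i j)
    · exact hc.slab_of_isCR hr h1 hj (hc.isCR hr h1 hj (by linarith) h.outR h.inR) hp
    · exact hc.slab_of_isA hr h0 h1 hc0 hp
  all_goals
    obtain ⟨k, hk⟩ := card_pos.1 hm
    have h1 := (mem_face.1 hk).1
    have h2 := h.succ
    omega

theorem IsChild.eq_of_rk_eq {k' l' : ℕ} (hc : D.IsChild i j k l) (hc' : D.IsChild i j k' l')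
    (h : D.rk i j k = D.rk i j k') : k = k' ∧ l = l' := by
  have hk : k = k' := by
    rcases lt_trichotomy k k' with h1 | h1 | h1
    · have := rk_lt hc.left_mem h1
      omega
    · exact h1
    · have := rk_lt hc'.left_mem h1
      omega
  refine ⟨hk, ?_⟩
  subst hk
  have h2 := hc.rk_succ
  have h3 := hc'.rk_succ
  by_contra h1
  rcases hc.right_eq_or with h4 | h4
  · have h5 := hc'.right_eq_or.resolve_left (by omega)
    have := rk_lt (mem_insert_of_mem h5) (mem_face.1 h5).1.2
    rw [h4] at h2
    omega
  · rcases Nat.lt_or_gt_of_ne h1 with h5 | h5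
    · have := rk_lt (mem_insert_of_mem h4) h5
      omega
    · have h6 := hc'.right_eq_or.resolve_left (by have := hc.le_right; omega)
      have := rk_lt (mem_insert_of_mem h6) h5
      omega

/-- Slabs of different edges of a face are disjoint. Adjacent slabs cannot both protrude over their
common vertex, as this takes two further edges on either side; and if one of them protrudes, then
the other one stays below the row. -/
theorem Slab.disjoint {t t' m K L K' L' : ℕ} (hd : 0 < d) (htt : t < t') (htm : t' ≤ m)
    (hc : c ≤ 1 / 2) (hKL : t' = t + 1 → L + K' ≤ 2) (hLK : L = 0 → K = 0)
    (h : Slab c x d R t m K L p) (h' : Slab c x d R t' m K' L' p) : False := by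
  obtain ⟨-, h2, h3⟩ := h
  obtain ⟨h4, -, h6⟩ := h'
  have h2 := h2.resolve_left (by omega)
  have h4 := h4.resolve_left (by omega)
  have hcd : c * d ≤ d / 2 := by nlinarith
  rcases Nat.lt_or_ge (t + 1) t' with h7 | h7
  · have h8 : (t : ℝ) + 2 ≤ t' := by exact_mod_cast h7
    have h9 : ((t : ℝ) + 2) * d ≤ t' * d := mul_le_mul_of_nonneg_right h8 hd.le
    have h10 : p.1 < x + (t + 1) * d + d / 2 := by
      rcases h2 with h2 | h2 <;> linarith
    have h11 : x + t' * d - d / 2 < p.1 := by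
      rcases h4 with h4 | h4 <;> linarith
    linarith
  · obtain rfl : t' = t + 1 := by omega
    have h8 := hKL rfl
    push_cast at h4
    rcases h2 with h2 | h2
    · rcases h4 with h4 | h4
      · linarith
      · have h9 := h4.1
        have := h3 (hLK (by omega))
        linarith
    · have h9 := h2.1
      have := h6 (by omega)
      rcases h4 with h4 | h4
      · linarith
      · have := h4.1
        omega

theorem Slab.vertex {s t m K L : ℕ} (hd : 0 < d) (hs : 0 < s) (hsm : s ≤ m)
    (hc : c ≤ 1 / 2) (h : Slab c x d R t m K L (x + s * d, R)) : False := by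
  obtain ⟨h1, h2, -⟩ := h
  have hcd : c * d ≤ d / 2 := by nlinarith
  simp only at h1 h2
  rcases Nat.lt_or_ge t s with h3 | h3
  · have h2 := h2.resolve_left (by omega)
    have h8 : (t : ℝ) + 1 ≤ s := by exact_mod_cast h3
    have h9 : ((t : ℝ) + 1) * d ≤ s * d := mul_le_mul_of_nonneg_right h8 hd.le
    rcases Nat.lt_or_ge (t + 1) s with h7 | h7
    · have h8 : (t : ℝ) + 2 ≤ s := by exact_mod_cast h7
      have h9 : ((t : ℝ) + 2) * d ≤ s * d := mul_le_mul_of_nonneg_right h8 hd.le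
      rcases h2 with h2 | h2 <;> linarith
    · obtain rfl : s = t + 1 := by omega
      push_cast at h2
      rcases h2 with h2 | h2 <;> linarith
  · have h1 := h1.resolve_left (by omega)
    have h8 : (s : ℝ) ≤ t := by exact_mod_cast h3
    have h9 : (s : ℝ) * d ≤ t * d := mul_le_mul_of_nonneg_right h8 hd.le
    rcases Nat.lt_or_ge s t with h7 | h7
    · have h8 : (s : ℝ) + 1 ≤ t := by exact_mod_cast h7
      have h9 : ((s : ℝ) + 1) * d ≤ t * d := mul_le_mul_of_nonneg_right h8 hd.le
      rcases h1 with h1 | h1 <;> linarith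
    · obtain rfl : s = t := by omega
      rcases h1 with h1 | h1 <;> linarith

/-! ### The region above an edge contains the cells above it -/

theorem IsChild.inL_parent_ne_zero (hc : D.IsChild i j k l) : D.inL i j ≠ 0 := by
  intro h
  obtain ⟨h2, h3, h4, h5, h6⟩ := hc.under
  have := (inL_eq_zero_iff hc.parent).1 h
  have := hc.lt
  omega

/-- The cell of a child is in the region above its parent. Only the outermost children may protrude
beyond the ends of the parent, and if they do then there are two edges above the parent at that
end. -/
theorem IsA.reg_of_cell (h : D.IsA i j) (hc : D.IsChild i j k l) (hc0 : 9 / 20 ≤ c)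
    (hc1 : c ≤ 1 / 2) (hp : D.Cell c k l p) : D.Reg c i j p := by
  have hne := hc.inL_parent_ne_zero
  have hm := hc.card_face_pos
  have hm' : (1 : ℝ) ≤ #(D.face i j) := by exact_mod_cast hm
  obtain ⟨x, d, R, hr, hi, hj⟩ := h.row hc.parent
  have hd := hr.pos_d
  have hcd : c * d ≤ d / 2 := by nlinarith
  have hcd0 : 0 ≤ c * d := by positivity
  have hmd : d ≤ #(D.face i j) * d := by nlinarith
  have hmd' : c * d ≤ c * (#(D.face i j) * d) := mul_le_mul_of_nonneg_left hmd (by linarith)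
  have e1 : c * ((x + (#(D.face i j) + 1) * d - x) / 2)
      = (c * (#(D.face i j) * d) + c * d) / 2 := by ring
  rw [hc.cell_iff] at hp
  rw [h.reg_iff, hi, hj]
  simp only
  rw [e1]
  refine ⟨hne, ?_⟩
  by_cases h0 : D.rk i j k = 0
  · have h2 := hc.isBL hr h0 hi h.outL h.inL
    have hl := hc.pos_right_of_rk_eq_zero hr h0
    obtain rfl := hc.left_eq h0
    have h3 := hc.inL_parent
    have h4 := h.inL
    rw [h2.zone_iff, h2.reg_iff, hi, hl] at hp
    simp only [add_sub_cancel_left] at hp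
    rcases hp with hp | hp
    · exact ⟨by linarith, Or.inl (by linarith), Or.inl (by linarith)⟩
    · have h5 := hp.1
      have h6 : p.1 < x + d + d / 2 := by rcases hp.2.2.2.2 with h6 | h6 <;> linarith
      exact ⟨by linarith, Or.inr ⟨by omega, by linarith, by linarith⟩, Or.inl (by linarith)⟩
  by_cases h1 : D.rk i j k = #(D.face i j)
  · have h2 := hc.isBR hr h1 hj h.outR h.inR
    have hl := hc.pos_left_of_rk_eq_card hr h1
    obtain rfl := hc.right_eq h1
    have h3 := hc.inR_parent
    have h4 := h.inR
    rw [h2.zone_iff, h2.reg_iff, hj, hl] at hp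
    have e : x + (#(D.face i l) + 1) * d - (x + #(D.face i l) * d) = d := by ring
    simp only at hp
    rw [e] at hp
    rcases hp with hp | hp
    · exact ⟨by linarith, Or.inl (by linarith), Or.inl (by linarith)⟩
    · have h5 := hp.1
      have h6 : x + #(D.face i l) * d - d / 2 < p.1 := by
        rcases hp.2.2.2.2 with h6 | h6 <;> linarith
      have h7 : D.inR k l ≠ 0 := by
        rwa [Ne, inR_eq_zero_iff hc.edge, ← inL_eq_zero_iff hc.edge]
      exact ⟨by linarith, Or.inl (by linarith), Or.inr ⟨by omega, by linarith, by linarith⟩⟩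
  · obtain ⟨h2, hk, hl⟩ := hc.isA hr h0 h1
    have ht0 : (1 : ℝ) ≤ D.rk i j k := by exact_mod_cast Nat.one_le_iff_ne_zero.2 h0
    have ht1 : (D.rk i j k : ℝ) + 1 ≤ #(D.face i j) := by
      exact_mod_cast Nat.succ_le_of_lt (lt_of_le_of_ne hc.rk_le h1)
    have ht2 : d ≤ D.rk i j k * d := by nlinarith
    have ht3 : (D.rk i j k + 1) * d ≤ #(D.face i j) * d :=
      mul_le_mul_of_nonneg_right ht1 hd.le
    rw [h2.zone_iff, h2.reg_iff, hk, hl] at hp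
    have e : c * ((x + (D.rk i j k + 1) * d - (x + D.rk i j k * d)) / 2) = c * d / 2 := by ring
    simp only at hp
    rw [e] at hp
    rcases hp with hp | hp
    · exact ⟨by linarith, Or.inl (by linarith), Or.inl (by linarith)⟩
    · have h6 : x + D.rk i j k * d - d / 4 < p.1 := by
        rcases hp.2.2.1 with h6 | h6 <;> linarith
      have h7 : p.1 < x + (D.rk i j k + 1) * d + d / 4 := by
        rcases hp.2.2.2 with h6 | h6 <;> linarith
      exact ⟨by linarith, Or.inl (by linarith), Or.inl (by linarith)⟩

theorem IsBL.reg_of_cell (h : D.IsBL i j) (hc : D.IsChild i j k l) (hc0 : 9 / 20 ≤ c)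
    (hc1 : c ≤ 1 / 2) (hp : D.Cell c k l p) : D.Reg c i j p := by
  have hne := hc.inL_parent_ne_zero
  have hm := hc.card_face_pos
  have hm' : (1 : ℝ) ≤ #(D.face i j) := by exact_mod_cast hm
  obtain ⟨x, d, R, hr, hi, hj⟩ := h.row hc.parent hm
  have hd := hr.pos_d
  have hcd : c * d ≤ d / 2 := by nlinarith
  have hcd0 : 0 ≤ c * d := by positivity
  have hmd : d ≤ #(D.face i j) * d := by nlinarith
  have hmd' : c * d ≤ c * (#(D.face i j) * d) := mul_le_mul_of_nonneg_left hmd (by linarith)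
  have hmd'' : 9 / 20 * (#(D.face i j) * d) ≤ c * (#(D.face i j) * d) :=
    mul_le_mul_of_nonneg_right hc0 (by linarith)
  have e1 : x + (#(D.face i j) + 1) * d - (x + d) = #(D.face i j) * d := by ring
  rw [hc.cell_iff] at hp
  rw [h.reg_iff, hi, hj]
  simp only
  rw [e1]
  refine ⟨hne, ?_⟩
  by_cases h0 : D.rk i j k = 0
  · have h2 := hc.isCL hr h0 hi (by linarith) h.outL h.inL
    have hl := hc.pos_right_of_rk_eq_zero hr h0
    have hp := hp.resolve_right (not_reg hc.edge h2.succ)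
    obtain rfl := hc.left_eq h0
    rw [h2.zone_iff, hi, hl] at hp
    simp only at hp
    exact ⟨by linarith, by linarith, by linarith, Or.inl (by linarith)⟩
  by_cases h1 : D.rk i j k = #(D.face i j)
  · have h2 := hc.isBR hr h1 hj h.outR h.inR
    have hl := hc.pos_left_of_rk_eq_card hr h1
    obtain rfl := hc.right_eq h1
    have h3 := hc.inR_parent
    have h4 := h.inR
    rw [h2.zone_iff, h2.reg_iff, hj, hl] at hp
    have e : x + (#(D.face i l) + 1) * d - (x + #(D.face i l) * d) = d := by ring
    simp only at hp
    rw [e] at hp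
    rcases hp with hp | hp
    · exact ⟨by linarith, by linarith, by linarith, Or.inl (by linarith)⟩
    · have h5 := hp.1
      have h6 : x + #(D.face i l) * d - c * d < p.1 := by
        rcases hp.2.2.2.2 with h6 | h6 <;> linarith
      have h7 : D.inR k l ≠ 0 := by
        rwa [Ne, inR_eq_zero_iff hc.edge, ← inL_eq_zero_iff hc.edge]
      exact ⟨by linarith, by linarith, by linarith, Or.inr ⟨by omega, by linarith⟩⟩
  · obtain ⟨h2, hk, hl⟩ := hc.isA hr h0 h1
    have ht0 : (1 : ℝ) ≤ D.rk i j k := by exact_mod_cast Nat.one_le_iff_ne_zero.2 h0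
    have ht1 : (D.rk i j k : ℝ) + 1 ≤ #(D.face i j) := by
      exact_mod_cast Nat.succ_le_of_lt (lt_of_le_of_ne hc.rk_le h1)
    have ht2 : d ≤ D.rk i j k * d := by nlinarith
    have ht3 : (D.rk i j k + 1) * d ≤ #(D.face i j) * d :=
      mul_le_mul_of_nonneg_right ht1 hd.le
    rw [h2.zone_iff, h2.reg_iff, hk, hl] at hp
    have e : c * ((x + (D.rk i j k + 1) * d - (x + D.rk i j k * d)) / 2) = c * d / 2 := by ring
    simp only at hp
    rw [e] at hp
    rcases hp with hp | hp
    · exact ⟨by linarith, by linarith, by linarith, Or.inl (by linarith)⟩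
    · have h6 : x + D.rk i j k * d - c * d / 2 < p.1 := by
        rcases hp.2.2.1 with h6 | h6 <;> linarith
      have h7 : p.1 < x + (D.rk i j k + 1) * d + d / 4 := by
        rcases hp.2.2.2 with h6 | h6 <;> linarith
      exact ⟨by linarith, by linarith, by linarith, Or.inl (by linarith)⟩

theorem IsBR.reg_of_cell (h : D.IsBR i j) (hc : D.IsChild i j k l) (hc0 : 9 / 20 ≤ c)
    (hc1 : c ≤ 1 / 2) (hp : D.Cell c k l p) : D.Reg c i j p := by
  have hne := hc.inL_parent_ne_zero
  have hm := hc.card_face_pos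
  have hm' : (1 : ℝ) ≤ #(D.face i j) := by exact_mod_cast hm
  obtain ⟨x, d, R, hr, hi, hj⟩ := h.row hc.parent hm
  have hd := hr.pos_d
  have hcd : c * d ≤ d / 2 := by nlinarith
  have hcd0 : 0 ≤ c * d := by positivity
  have hmd : d ≤ #(D.face i j) * d := by nlinarith
  have hmd' : c * d ≤ c * (#(D.face i j) * d) := mul_le_mul_of_nonneg_left hmd (by linarith)
  have hmd'' : 9 / 20 * (#(D.face i j) * d) ≤ c * (#(D.face i j) * d) :=
    mul_le_mul_of_nonneg_right hc0 (by linarith)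
  rw [hc.cell_iff] at hp
  rw [h.reg_iff, hi, hj]
  simp only [add_sub_cancel_left]
  refine ⟨hne, ?_⟩
  by_cases h0 : D.rk i j k = 0
  · have h2 := hc.isBL hr h0 hi h.outL h.inL
    have hl := hc.pos_right_of_rk_eq_zero hr h0
    obtain rfl := hc.left_eq h0
    have h3 := hc.inL_parent
    have h4 := h.inL
    rw [h2.zone_iff, h2.reg_iff, hi, hl] at hp
    simp only [add_sub_cancel_left] at hp
    rcases hp with hp | hp
    · exact ⟨by linarith, by linarith, by linarith, Or.inl (by linarith)⟩
    · have h5 := hp.1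
      have h6 : p.1 < x + d + c * d := by rcases hp.2.2.2.2 with h6 | h6 <;> linarith
      exact ⟨by linarith, by linarith, by linarith, Or.inr ⟨by omega, by linarith⟩⟩
  by_cases h1 : D.rk i j k = #(D.face i j)
  · have h2 := hc.isCR hr h1 hj (by linarith) h.outR h.inR
    have hl := hc.pos_left_of_rk_eq_card hr h1
    have hp := hp.resolve_right (not_reg hc.edge h2.succ)
    obtain rfl := hc.right_eq h1
    rw [h2.zone_iff, hj, hl] at hp
    simp only at hp
    exact ⟨by linarith, by linarith, by linarith, Or.inl (by linarith)⟩
  · obtain ⟨h2, hk, hl⟩ := hc.isA hr h0 h1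
    have ht0 : (1 : ℝ) ≤ D.rk i j k := by exact_mod_cast Nat.one_le_iff_ne_zero.2 h0
    have ht1 : (D.rk i j k : ℝ) + 1 ≤ #(D.face i j) := by
      exact_mod_cast Nat.succ_le_of_lt (lt_of_le_of_ne hc.rk_le h1)
    have ht2 : d ≤ D.rk i j k * d := by nlinarith
    have ht3 : (D.rk i j k + 1) * d ≤ #(D.face i j) * d :=
      mul_le_mul_of_nonneg_right ht1 hd.le
    rw [h2.zone_iff, h2.reg_iff, hk, hl] at hp
    have e : c * ((x + (D.rk i j k + 1) * d - (x + D.rk i j k * d)) / 2) = c * d / 2 := by ring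
    simp only at hp
    rw [e] at hp
    rcases hp with hp | hp
    · exact ⟨by linarith, by linarith, by linarith, Or.inl (by linarith)⟩
    · have h6 : x + D.rk i j k * d - d / 4 < p.1 := by
        rcases hp.2.2.1 with h6 | h6 <;> linarith
      have h7 : p.1 < x + (D.rk i j k + 1) * d + c * d / 2 := by
        rcases hp.2.2.2 with h6 | h6 <;> linarith
      exact ⟨by linarith, by linarith, by linarith, Or.inl (by linarith)⟩

theorem IsChild.reg_of_cell (hc : D.IsChild i j k l) (hc0 : 9 / 20 ≤ c) (hc1 : c ≤ 1 / 2)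
    (hp : D.Cell c k l p) : D.Reg c i j p := by
  rcases framed_of_edge hc.parent with h | h | h | h | h
  · exact h.reg_of_cell hc hc0 hc1 hp
  · exact h.reg_of_cell hc hc0 hc1 hp
  · exact h.reg_of_cell hc hc0 hc1 hp
  all_goals
    exact absurd ((inL_eq_zero_iff hc.parent).2 h.succ) hc.inL_parent_ne_zero

theorem reg_pos_of_mem_face (he : D.E i j) (hk : k ∈ D.face i j) (hc0 : 9 / 20 ≤ c) :
    D.Reg c i j (D.pos k) := by
  have hm := card_pos.2 ⟨k, hk⟩
  have hne : D.inL i j ≠ 0 := by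
    rw [Ne, inL_eq_zero_iff he]
    have := (mem_face.1 hk).1
    omega
  have hm' : (1 : ℝ) ≤ #(D.face i j) := by exact_mod_cast hm
  have ht0 : (1 : ℝ) ≤ D.rk i j k := by exact_mod_cast rk_pos (mem_face.1 hk).1.1
  have ht1 : (D.rk i j k : ℝ) ≤ #(D.face i j) := by exact_mod_cast rk_le_card hk
  rcases framed_of_edge he with h | h | h | h | h
  · obtain ⟨x, d, R, hr, hi, hj⟩ := h.row he
    have hd := hr.pos_d
    have ht2 : d ≤ D.rk i j k * d := by nlinarith
    have ht3 : D.rk i j k * d ≤ #(D.face i j) * d := mul_le_mul_of_nonneg_right ht1 hd.le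
    rw [h.reg_iff, hi, hj, hr.pos_eq k hk]
    exact ⟨hne, by simp only; linarith, Or.inl (by simp only; linarith),
      Or.inl (by simp only; linarith)⟩
  · obtain ⟨x, d, R, hr, hi, hj⟩ := h.row he hm
    have hd := hr.pos_d
    have ht2 : d ≤ D.rk i j k * d := by nlinarith
    have ht3 : D.rk i j k * d ≤ #(D.face i j) * d := mul_le_mul_of_nonneg_right ht1 hd.le
    have e1 : x + (#(D.face i j) + 1) * d - (x + d) = #(D.face i j) * d := by ring
    have hmd : 9 / 20 * (#(D.face i j) * d) ≤ c * (#(D.face i j) * d) :=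
      mul_le_mul_of_nonneg_right hc0 (by linarith)
    rw [h.reg_iff, hi, hj, hr.pos_eq k hk]
    simp only
    rw [e1]
    exact ⟨hne, by linarith, by linarith, by linarith, Or.inl (by linarith)⟩
  · obtain ⟨x, d, R, hr, hi, hj⟩ := h.row he hm
    have hd := hr.pos_d
    have ht2 : d ≤ D.rk i j k * d := by nlinarith
    have ht3 : D.rk i j k * d ≤ #(D.face i j) * d := mul_le_mul_of_nonneg_right ht1 hd.le
    have hmd : 9 / 20 * (#(D.face i j) * d) ≤ c * (#(D.face i j) * d) :=
      mul_le_mul_of_nonneg_right hc0 (by linarith)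
    rw [h.reg_iff, hi, hj, hr.pos_eq k hk]
    simp only [add_sub_cancel_left]
    exact ⟨hne, by linarith, by linarith, by linarith, Or.inl (by linarith)⟩
  all_goals exact absurd ((inL_eq_zero_iff he).2 h.succ) hne

/-! ### Cells are disjoint unless nested -/

theorem reg_of_under {r s : ℕ} (he : D.E i j) (hcell : r = s ∨ D.E r s) (hu : Under r s i j)
    (hc0 : 9 / 20 ≤ c) (hc1 : c ≤ 1 / 2) (hp : D.Cell c r s p) : D.Reg c i j p := by
  have key : ∀ n i j, j - i = n → D.E i j → Under r s i j → D.Reg c i j p := by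
    intro n
    induction n using Nat.strong_induction_on with
    | _ n ih =>
      intro i j hn he hu
      rcases exists_isChild he hcell hu with ⟨rfl, h⟩ | ⟨k, l, hc, h | h⟩
      · rw [Cell, if_pos rfl] at hp
        rw [hp]
        exact reg_pos_of_mem_face he h hc0
      · rw [← h.1, ← h.2] at hp
        exact hc.reg_of_cell hc0 hc1 hp
      · obtain ⟨h2, h3, h4, h5, h6⟩ := hc.under
        have := hc.lt
        have := ih (l - k) (by omega) k l rfl hc.edge h
        exact hc.reg_of_cell hc0 hc1 (hc.cell_iff.2 (Or.inr this))
  exact key _ i j rfl he hu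

theorem IsChild.disjoint {k' l' : ℕ} (h : D.IsChild i j k l) (h' : D.IsChild i j k' l')
    (hne : ¬ (k = k' ∧ l = l')) (hc0 : 9 / 20 ≤ c) (hc1 : c ≤ 1 / 2)
    (hp : D.Cell c k l p) (hp' : D.Cell c k' l' p) : False := by
  obtain ⟨x, d, R, hr, -, hs⟩ := exists_row h.parent h.card_face_pos
  have h1 := hs c p k l (by linarith) h hp
  have h2 := hs c p k' l' (by linarith) h' hp'
  have key : ∀ {k l k' l' : ℕ}, D.IsChild i j k l → D.IsChild i j k' l' →
      D.rk i j k' = D.rk i j k + 1 → D.inR k l + D.inL k' l' ≤ 2 := by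
    intro k l k' l' h h' hrk
    have h3 := h.rk_succ
    have h4 : k' ∈ D.face i j := h'.left_mem_face (by omega)
    have h5 : k' = l := by
      rcases lt_trichotomy k' l with h6 | h6 | h6
      · have := rk_lt (mem_insert_of_mem h4) h6
        omega
      · exact h6
      · rcases h.right_eq_or with h7 | h7
        · have := (mem_face.1 h4).1
          omega
        · have := rk_lt (mem_insert_of_mem h7) h6
          omega
    subst h5
    exact inR_add_inL_le h.edge h'.edge
  have hLK : ∀ {k l : ℕ}, D.E k l → D.inR k l = 0 → D.inL k l = 0 := fun he h => by
    rwa [inL_eq_zero_iff he, ← inR_eq_zero_iff he]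
  rcases lt_trichotomy (D.rk i j k) (D.rk i j k') with h3 | h3 | h3
  · exact Slab.disjoint hr.pos_d h3 h'.rk_le hc1 (key h h') (hLK h.edge) h1 h2
  · exact hne (h.eq_of_rk_eq h' h3)
  · exact Slab.disjoint hr.pos_d h3 h.rk_le hc1 (key h' h) (hLK h'.edge) h2 h1

theorem IsChild.not_cell_pos {s : ℕ} (h : D.IsChild i j k l) (hs : s ∈ D.face i j)
    (hc0 : 9 / 20 ≤ c) (hc1 : c ≤ 1 / 2) : ¬ D.Cell c k l (D.pos s) := by
  intro hp
  obtain ⟨x, d, R, hr, -, hsl⟩ := exists_row h.parent h.card_face_pos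
  have h1 := hsl c _ k l (by linarith) h hp
  rw [hr.pos_eq s hs] at h1
  exact Slab.vertex hr.pos_d (rk_pos (mem_face.1 hs).1.1) (rk_le_card hs) hc1 h1

theorem pos_injOn_face {s s' : ℕ} (he : D.E i j) (hs : s ∈ D.face i j) (hs' : s' ∈ D.face i j)
    (h : D.pos s = D.pos s') : s = s' := by
  obtain ⟨x, d, R, hr, -, -⟩ := exists_row he (card_pos.2 ⟨s, hs⟩)
  rw [hr.pos_eq s hs, hr.pos_eq s' hs'] at h
  have h1 : (D.rk i j s : ℝ) = D.rk i j s' := by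
    have := congrArg Prod.fst h
    simp only [add_right_inj] at this
    exact mul_right_cancel₀ hr.pos_d.ne' this
  have h2 : D.rk i j s = D.rk i j s' := by exact_mod_cast h1
  rcases lt_trichotomy s s' with h3 | h3 | h3
  · have := rk_lt (mem_insert_of_mem hs) h3
    omega
  · exact h3
  · have := rk_lt (mem_insert_of_mem hs') h3
    omega

/-- Two cells above `(i, j)`, neither of which is above the other, are in cells of different
children of `(i, j)`, or both above the same child. -/
theorem disjoint_of_under {r s r' s' : ℕ} (he : D.E i j) (hrs : r = s ∨ D.E r s)
    (hrs' : r' = s' ∨ D.E r' s') (hu : Under r s i j) (hu' : Under r' s' i j)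
    (hne : ¬ (r = r' ∧ s = s')) (h1 : ¬ Under r s r' s') (h2 : ¬ Under r' s' r s)
    (hc0 : 9 / 20 ≤ c) (hc1 : c ≤ 1 / 2) (hp : D.Cell c r s p) (hp' : D.Cell c r' s' p) :
    False := by
  have key : ∀ n i j, j - i = n → D.E i j → Under r s i j → Under r' s' i j → False := by
    intro n
    induction n using Nat.strong_induction_on with
    | _ n ih =>
      intro i j hn he hu hu'
      have hup : ∀ {a b k l : ℕ}, D.IsChild i j k l → (a = b ∨ D.E a b) →
          ((k = a ∧ l = b) ∨ Under a b k l) → D.Cell c a b p → D.Cell c k l p := by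
        intro a b k l hc hab h h3
        rcases h with h | h
        · rwa [h.1, h.2]
        · exact hc.cell_iff.2 (Or.inr (reg_of_under hc.edge hab h hc0 hc1 h3))
      rcases exists_isChild he hrs hu with ⟨rfl, h⟩ | ⟨k, l, hc, h⟩ <;>
      rcases exists_isChild he hrs' hu' with ⟨rfl, h'⟩ | ⟨k', l', hc', h'⟩
      · rw [Cell, if_pos rfl] at hp hp'
        exact hne ⟨pos_injOn_face he h h' (by rw [← hp, hp']),
          pos_injOn_face he h h' (by rw [← hp, hp'])⟩
      · rw [Cell, if_pos rfl] at hp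
        have := hup hc' hrs' h' hp'
        rw [hp] at this
        exact hc'.not_cell_pos h hc0 hc1 this
      · rw [Cell, if_pos rfl] at hp'
        have := hup hc hrs h hp
        rw [hp'] at this
        exact hc.not_cell_pos h' hc0 hc1 this
      · by_cases hkl : k = k' ∧ l = l'
        · obtain ⟨rfl, rfl⟩ := hkl
          rcases h with h | h <;> rcases h' with h' | h'
          · exact hne ⟨by rw [← h.1, h'.1], by rw [← h.2, h'.2]⟩
          · rw [h.1, h.2] at h'
            exact h2 h'
          · rw [h'.1, h'.2] at h
            exact h1 h
          · obtain ⟨h3, h4, h5, h6, h7⟩ := hc.under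
            have := hc.lt
            exact ih (l - k) (by omega) k l rfl hc.edge h h'
        · exact hc.disjoint hc' hkl hc0 hc1 (hup hc hrs h hp) (hup hc' hrs' h' hp')
  exact key _ i j rfl he hu hu'

theorem not_cell_pos_left (he : D.E i j) : ¬ D.Cell c i j (D.pos i) := by
  have hlt := D.lt he
  rw [Cell, if_neg hlt.ne]
  rintro (h | h) <;> rcases framed_of_edge he with h' | h' | h' | h' | h'
  iterate 5
    rw [h'.zone_iff] at h
    linarith
  · rw [h'.reg_iff] at h
    linarith
  · rw [h'.reg_iff] at h
    linarith
  · rw [h'.reg_iff] at h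
    have := h'.y
    linarith
  all_goals exact not_reg he h'.succ h

theorem not_cell_pos_right (he : D.E i j) : ¬ D.Cell c i j (D.pos j) := by
  have hlt := D.lt he
  rw [Cell, if_neg hlt.ne]
  rintro (h | h) <;> rcases framed_of_edge he with h' | h' | h' | h' | h'
  iterate 5
    rw [h'.zone_iff] at h
    linarith
  · rw [h'.reg_iff] at h
    have := h'.y
    linarith
  · rw [h'.reg_iff] at h
    have := h'.y
    linarith
  · rw [h'.reg_iff] at h
    have := h'.y
    linarith
  all_goals exact not_reg he h'.succ h

/-- Two cells are disjoint unless one is above the other. -/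
theorem cell_disjoint {r s r' s' : ℕ} (hrs : r = s ∧ s ≤ D.N ∨ D.E r s)
    (hrs' : r' = s' ∧ s' ≤ D.N ∨ D.E r' s')
    (hne : ¬ (r = r' ∧ s = s')) (h1 : ¬ Under r s r' s') (h2 : ¬ Under r' s' r s)
    (hc0 : 9 / 20 ≤ c) (hc1 : c ≤ 1 / 2) (hp : D.Cell c r s p) (hp' : D.Cell c r' s' p) :
    False := by
  have hN := D.lt D.root
  have h0N : ¬ D.Cell c 0 D.N (D.pos 0) := not_cell_pos_left D.root
  have h0N' : ¬ D.Cell c 0 D.N (D.pos D.N) := not_cell_pos_right D.root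
  have hle : ∀ {r s : ℕ}, (r = s ∧ s ≤ D.N ∨ D.E r s) → D.Cell c r s p → r ≤ s ∧ s ≤ D.N ∧
      (Under r s 0 D.N ∨ (r = 0 ∧ s = D.N) ∨ p = D.pos 0 ∧ r = 0 ∧ s = 0 ∨
        p = D.pos D.N ∧ r = D.N ∧ s = D.N) := by
    intro r s h hp
    have h3 : r ≤ s ∧ s ≤ D.N := by
      rcases h with h | h
      · omega
      · have := D.lt h
        have := D.le h
        omega
    refine ⟨h3.1, h3.2, ?_⟩
    by_cases hs : s = 0
    · have hr : r = 0 := by omega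
      rw [hr, hs, Cell, if_pos rfl] at hp
      exact Or.inr (Or.inr (Or.inl ⟨hp, hr, hs⟩))
    by_cases hs' : r = D.N
    · have hr : s = D.N := by omega
      rw [hr, hs', Cell, if_pos rfl] at hp
      exact Or.inr (Or.inr (Or.inr ⟨hp, hs', hr⟩))
    by_cases h4 : r = 0 ∧ s = D.N
    · exact Or.inr (Or.inl h4)
    · exact Or.inl ⟨by omega, by omega, by omega, by omega, by omega⟩
  have hin : ∀ {r s : ℕ}, (r = s ∧ s ≤ D.N ∨ D.E r s) → Under r s 0 D.N → D.Cell c r s p →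
      D.Cell c 0 D.N p := fun h h3 h4 => by
    rw [Cell, if_neg hN.ne]
    exact Or.inr (reg_of_under D.root (h.imp (fun h => h.1) id) h3 hc0 hc1 h4)
  have hpos : D.pos 0 ≠ D.pos D.N := by
    rw [pos_zero, pos_N]
    simp
  obtain ⟨a1, a2, a3⟩ := hle hrs hp
  obtain ⟨b1, b2, b3⟩ := hle hrs' hp'
  rcases a3 with a3 | ⟨rfl, rfl⟩ | ⟨a3, rfl, rfl⟩ | ⟨a3, rfl, rfl⟩ <;>
    rcases b3 with b3 | ⟨rfl, rfl⟩ | ⟨b3, rfl, rfl⟩ | ⟨b3, rfl, rfl⟩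
  · exact disjoint_of_under D.root (hrs.imp (fun h => h.1) id) (hrs'.imp (fun h => h.1) id) a3 b3
      hne h1 h2 hc0 hc1 hp hp'
  · exact h1 a3
  · exact h0N (b3 ▸ hin hrs a3 hp)
  · exact h0N' (b3 ▸ hin hrs a3 hp)
  · exact h2 b3
  · exact hne ⟨rfl, rfl⟩
  · exact h0N (b3 ▸ hp)
  · exact h0N' (b3 ▸ hp)
  · exact h0N (a3 ▸ hin hrs' b3 hp')
  · exact h0N (a3 ▸ hp')
  · exact hne ⟨rfl, rfl⟩
  · exact hpos (by rw [← a3, b3])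
  · exact h0N' (a3 ▸ hin hrs' b3 hp')
  · exact h0N' (a3 ▸ hp')
  · exact hpos (by rw [← a3, b3])
  · exact hne ⟨rfl, rfl⟩

end ChordDisc

end

end SmoothOrthogonal


/-! ### Strokes in rotated coordinates -/

namespace SmoothOrthogonal

open Real Topology

/-- The point of the plane with rotated coordinates `p`. Rotated by `45°`, the ports `right`,
`top`, `left` and `bottom` of a vertex point down right, up right, up left and down left. -/
noncomputable def toC (p : ℝ × ℝ) : ℂ := ⟨(p.1 - p.2) / 2, (p.1 + p.2) / 2⟩

/-- The rotated coordinates of a point. -/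
def rot (z : ℂ) : ℝ × ℝ := (z.re + z.im, z.im - z.re)

@[simp] theorem rot_toC (p : ℝ × ℝ) : rot (toC p) = p := by
  ext <;> simp only [rot, toC] <;> ring

@[simp] theorem toC_rot (z : ℂ) : toC (rot z) = z := by
  apply Complex.ext <;> simp only [rot, toC] <;> ring

namespace Stroke

/-- The point at distance `ε * ‖velocity‖` to the right of the stroke at time `t`. -/
noncomputable def side (s : Stroke) (t ε : ℝ) : ℂ := s.point t - ε * (Complex.I * s.tangent t)

theorem side_zero (s : Stroke) (t : ℝ) : s.side t 0 = s.point t := by simp [side]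

theorem reverse_point (s : Stroke) (t : ℝ) : s.reverse.point t = s.point (1 - t) := by
  cases s with
  | segment p q =>
    simp only [reverse, point]
    push_cast
    ring
  | arc c r a b =>
    simp only [reverse, point]
    congr 4
    ring_nf

theorem reverse_tangent (s : Stroke) (t : ℝ) : s.reverse.tangent t = -s.tangent (1 - t) := by
  cases s with
  | segment p q =>
    simp only [reverse, tangent]
    ring
  | arc c r a b =>
    simp only [reverse, tangent]
    have : b + t * (a - b) = a + (1 - t) * (b - a) := by ring
    rw [this]
    push_cast
    ring

theorem reverse_reverse (s : Stroke) : s.reverse.reverse = s := by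
  cases s <;> rfl

theorem Nondegenerate.reverse {s : Stroke} (h : s.Nondegenerate) : s.reverse.Nondegenerate := by
  cases s with
  | segment p q => exact Ne.symm h
  | arc c r a b => exact ⟨h.1, h.2.1.symm, by rw [abs_sub_comm]; exact h.2.2⟩

theorem reverse_carrier (s : Stroke) : s.reverse.carrier = s.carrier := by
  have key : ∀ s : Stroke, s.reverse.carrier ⊆ s.carrier := by
    rintro s _ ⟨t, ht, rfl⟩
    exact ⟨1 - t, ⟨by linarith [ht.2], by linarith [ht.1]⟩, (reverse_point s t).symm⟩
  refine (key s).antisymm ?_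
  have := key s.reverse
  rwa [reverse_reverse] at this

theorem reverse_side (s : Stroke) (t ε : ℝ) : s.reverse.side t ε = s.side (1 - t) (-ε) := by
  rw [side, side, reverse_point, reverse_tangent]
  push_cast
  ring

theorem rot_side_arc (c : ℝ × ℝ) (r a b t ε : ℝ) : rot ((arc (toC c) r a b).side t ε) =
    (c.1 + (1 + ε * (b - a)) * r * (cos (a + t * (b - a)) + sin (a + t * (b - a))),
      c.2 + (1 + ε * (b - a)) * r * (sin (a + t * (b - a)) - cos (a + t * (b - a)))) := by
  generalize hθ : a + t * (b - a) = θ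
  have : (arc (toC c) r a b).side t ε
      = toC c + ((1 + ε * (b - a)) * r : ℝ) * Complex.exp ((θ : ℂ) * Complex.I) := by
    simp only [side, point, tangent, hθ]
    push_cast
    linear_combination (-(ε : ℂ) * r * Complex.exp (θ * Complex.I) * (b - a)) * Complex.I_mul_I
  rw [this]
  ext <;> simp only [rot, Complex.add_re, Complex.add_im, Complex.re_ofReal_mul,
    Complex.im_ofReal_mul, Complex.exp_ofReal_mul_I_re, Complex.exp_ofReal_mul_I_im, toC] <;> ring

theorem rot_side_segment (P Q : ℝ × ℝ) (t ε : ℝ) :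
    rot ((segment (toC P) (toC Q)).side t ε) =
      (P.1 + t * (Q.1 - P.1) + ε * (Q.2 - P.2), P.2 + t * (Q.2 - P.2) - ε * (Q.1 - P.1)) := by
  ext <;> simp [rot, side, point, tangent, toC] <;> ring

end Stroke

open Stroke

/-- The curve drawn for an edge from `P` to `Q`, in rotated coordinates: a quarter circle below
a horizontal edge, a quarter circle to the left of a rising and to the right of a falling vertical
edge, and otherwise a segment. -/
noncomputable def curve (P Q : ℝ × ℝ) : Stroke :=
  if P.2 = Q.2 then
    arc (toC (P.1 + (Q.1 - P.1) / 2, P.2 + (Q.1 - P.1) / 2)) ((Q.1 - P.1) / 2) (-(π / 2)) 0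
  else if P.1 = Q.1 then
    if P.2 < Q.2 then
      arc (toC (P.1 + (Q.2 - P.2) / 2, P.2 + (Q.2 - P.2) / 2)) ((Q.2 - P.2) / 2) (-(π / 2)) (-π)
    else
      arc (toC (Q.1 - (P.2 - Q.2) / 2, Q.2 + (P.2 - Q.2) / 2)) ((P.2 - Q.2) / 2) (π / 2) 0
  else segment (toC P) (toC Q)

section curve

variable {P Q : ℝ × ℝ} {t ε : ℝ}

theorem sin_cos_bounds (h0 : 0 < t) (h1 : t < 1) : 0 < sin (t * (π / 2)) ∧
    0 < cos (t * (π / 2)) ∧ sin (t * (π / 2)) ^ 2 + cos (t * (π / 2)) ^ 2 = 1 ∧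
    1 < sin (t * (π / 2)) + cos (t * (π / 2)) ∧
    sin (t * (π / 2)) + cos (t * (π / 2)) < 29 / 20 := by
  have hπ := pi_pos
  have h2 : 0 < t * (π / 2) := by positivity
  have h3 : t * (π / 2) < π / 2 := by nlinarith
  have hs := sin_pos_of_pos_of_lt_pi h2 (by linarith)
  have hc := cos_pos_of_mem_Ioo ⟨by linarith, h3⟩
  have h4 := sin_sq_add_cos_sq (t * (π / 2))
  refine ⟨hs, hc, h4, ?_, ?_⟩
  · nlinarith [mul_pos hs hc]
  · nlinarith [sq_nonneg (sin (t * (π / 2)) - cos (t * (π / 2)))]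

theorem rot_side_curve_horizontal (h : P.2 = Q.2) : rot ((curve P Q).side t ε) =
    (P.1 + (Q.1 - P.1) / 2 * (1 + (1 + ε * (π / 2)) * (sin (t * (π / 2)) - cos (t * (π / 2)))),
      P.2 + (Q.1 - P.1) / 2 *
        (1 - (1 + ε * (π / 2)) * (sin (t * (π / 2)) + cos (t * (π / 2))))) := by
  rw [curve, if_pos h, rot_side_arc]
  have : -(π / 2) + t * (0 - -(π / 2)) = t * (π / 2) - π / 2 := by ring
  rw [this, cos_sub_pi_div_two, sin_sub_pi_div_two]
  ext <;> simp only <;> ring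

theorem rot_side_curve_rising (hx : P.1 = Q.1) (h : P.2 < Q.2) : rot ((curve P Q).side t ε) =
    (P.1 + (Q.2 - P.2) / 2 * (1 - (1 - ε * (π / 2)) * (sin (t * (π / 2)) + cos (t * (π / 2)))),
      P.2 + (Q.2 - P.2) / 2 *
        (1 + (1 - ε * (π / 2)) * (sin (t * (π / 2)) - cos (t * (π / 2))))) := by
  rw [curve, if_neg h.ne, if_pos hx, if_pos h, rot_side_arc]
  have : -(π / 2) + t * (-π - -(π / 2)) = -(t * (π / 2) + π / 2) := by ring
  rw [this, cos_neg, sin_neg, cos_add_pi_div_two, sin_add_pi_div_two]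
  ext <;> simp only <;> ring

theorem rot_side_curve_falling (hx : P.1 = Q.1) (h : Q.2 < P.2) : rot ((curve P Q).side t ε) =
    (Q.1 - (P.2 - Q.2) / 2 * (1 - (1 - ε * (π / 2)) * (sin (t * (π / 2)) + cos (t * (π / 2)))),
      Q.2 + (P.2 - Q.2) / 2 *
        (1 - (1 - ε * (π / 2)) * (sin (t * (π / 2)) - cos (t * (π / 2))))) := by
  rw [curve, if_neg h.ne', if_pos hx, if_neg h.not_gt, rot_side_arc]
  have : π / 2 + t * (0 - π / 2) = π / 2 - t * (π / 2) := by ring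
  rw [this, cos_pi_div_two_sub, sin_pi_div_two_sub]
  ext <;> simp only <;> ring

theorem curve_diagonal (hy : P.2 ≠ Q.2) (hx : P.1 ≠ Q.1) :
    curve P Q = segment (toC P) (toC Q) := by
  rw [curve, if_neg hy, if_neg hx]

/-- The two ends of an edge that is drawn as a stroke `s`, with the ports `a` and `b`. -/
structure Stroke.Joins (s : Stroke) (P Q : ℝ × ℝ) (a b : ZMod 4) : Prop where
  nondegenerate : s.Nondegenerate
  start_eq : s.point 0 = toC P
  end_eq : s.point 1 = toC Q
  port_start : ∃ l : ℝ, 0 < l ∧ s.tangent 0 = l * portDir a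
  port_end : ∃ l : ℝ, 0 < l ∧ s.reverse.tangent 0 = l * portDir b

theorem portDir_zero : portDir 0 = 1 := by simp [portDir]

theorem portDir_one : portDir 1 = Complex.I := by
  rw [portDir, show (1 : ZMod 4).val = 1 from rfl, pow_one]

theorem portDir_two : portDir 2 = -1 := by
  rw [portDir, show (2 : ZMod 4).val = 2 from rfl, Complex.I_sq]

theorem portDir_three : portDir 3 = -Complex.I := by
  rw [portDir, show (3 : ZMod 4).val = 3 from rfl, Complex.I_pow_three]

theorem exp_neg_pi_div_two_mul_I :
    Complex.exp (((-(π / 2) : ℝ) : ℂ) * Complex.I) = -Complex.I := by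
  apply Complex.ext <;> simp [Complex.exp_ofReal_mul_I_re, Complex.exp_ofReal_mul_I_im,
    -Complex.ofReal_neg, -Complex.ofReal_div]

theorem exp_pi_div_two_mul_I' :
    Complex.exp (((π / 2 : ℝ) : ℂ) * Complex.I) = Complex.I := by
  apply Complex.ext <;> simp [Complex.exp_ofReal_mul_I_re, Complex.exp_ofReal_mul_I_im,
    -Complex.ofReal_neg, -Complex.ofReal_div]

theorem exp_neg_pi_mul_I : Complex.exp (((-π : ℝ) : ℂ) * Complex.I) = -1 := by
  apply Complex.ext <;> simp [Complex.exp_ofReal_mul_I_re, Complex.exp_ofReal_mul_I_im,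
    -Complex.ofReal_neg]

theorem toC_eq (x y : ℝ) : toC (x, y) = (((x - y) / 2 : ℝ) : ℂ) + ((x + y) / 2 : ℝ) * Complex.I :=
  Complex.mk_eq_add_mul_I _ _

theorem joins_horizontal (h : P.2 = Q.2) (hx : P.1 < Q.1) : (curve P Q).Joins P Q 0 3 := by
  have hπ := pi_pos
  have e0 : -(π / 2) + 0 * (0 - -(π / 2)) = -(π / 2) := by ring
  have e1 : -(π / 2) + 1 * (0 - -(π / 2)) = 0 := by ring
  have e2 : 0 + 0 * (-(π / 2) - 0) = 0 := by ring
  rw [curve, if_pos h]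
  refine ⟨⟨by linarith, by linarith, by rw [abs_of_pos] <;> linarith⟩, ?_, ?_,
    ⟨(Q.1 - P.1) / 2 * (π / 2), by have := sub_pos.2 hx; positivity, ?_⟩,
    ⟨(Q.1 - P.1) / 2 * (π / 2), by have := sub_pos.2 hx; positivity, ?_⟩⟩
  · simp only [point, e0]
    rw [exp_neg_pi_div_two_mul_I]
    apply Complex.ext <;> simp [toC, -Complex.ofReal_div]
    ring
  · simp only [point, e1]
    apply Complex.ext <;> simp [toC, -Complex.ofReal_div] <;> linarith
  · simp only [tangent, e0, portDir_zero]
    rw [exp_neg_pi_div_two_mul_I]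
    push_cast
    linear_combination (-((Q.1 - P.1) / 2 * (π / 2) : ℂ)) * Complex.I_mul_I
  · simp only [tangent, reverse, e2, portDir_three]
    push_cast
    simp only [zero_mul, Complex.exp_zero]
    ring

theorem joins_rising (hx : P.1 = Q.1) (h : P.2 < Q.2) : (curve P Q).Joins P Q 2 3 := by
  have hπ := pi_pos
  have e0 : -(π / 2) + 0 * (-π - -(π / 2)) = -(π / 2) := by ring
  have e1 : -(π / 2) + 1 * (-π - -(π / 2)) = -π := by ring
  have e2 : -π + 0 * (-(π / 2) - -π) = -π := by ring
  rw [curve, if_neg h.ne, if_pos hx, if_pos h]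
  refine ⟨⟨by linarith, by linarith, by rw [abs_of_neg] <;> linarith⟩, ?_, ?_,
    ⟨(Q.2 - P.2) / 2 * (π / 2), by have := sub_pos.2 h; positivity, ?_⟩,
    ⟨(Q.2 - P.2) / 2 * (π / 2), by have := sub_pos.2 h; positivity, ?_⟩⟩
  · simp only [point, e0]
    rw [exp_neg_pi_div_two_mul_I]
    apply Complex.ext <;> simp [toC, -Complex.ofReal_div]
    ring
  · simp only [point, e1]
    rw [exp_neg_pi_mul_I]
    apply Complex.ext <;> simp [toC, -Complex.ofReal_div] <;> linarith
  · simp only [tangent, e0, portDir_two]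
    rw [exp_neg_pi_div_two_mul_I]
    push_cast
    linear_combination (((Q.2 - P.2) / 2 * (π / 2) : ℂ)) * Complex.I_mul_I
  · simp only [tangent, reverse, e2, portDir_three]
    rw [exp_neg_pi_mul_I]
    push_cast
    ring

theorem joins_falling (hx : P.1 = Q.1) (h : Q.2 < P.2) : (curve P Q).Joins P Q 0 1 := by
  have hπ := pi_pos
  have e0 : π / 2 + 0 * (0 - π / 2) = π / 2 := by ring
  have e1 : π / 2 + 1 * (0 - π / 2) = 0 := by ring
  have e2 : 0 + 0 * (π / 2 - 0) = 0 := by ring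
  rw [curve, if_neg h.ne', if_pos hx, if_neg h.not_gt]
  refine ⟨⟨by linarith, by linarith, by rw [abs_of_neg] <;> linarith⟩, ?_, ?_,
    ⟨(P.2 - Q.2) / 2 * (π / 2), by have := sub_pos.2 h; positivity, ?_⟩,
    ⟨(P.2 - Q.2) / 2 * (π / 2), by have := sub_pos.2 h; positivity, ?_⟩⟩
  · simp only [point, e0]
    rw [exp_pi_div_two_mul_I']
    apply Complex.ext <;> simp [toC, -Complex.ofReal_div] <;> linarith
  · simp only [point, e1]
    apply Complex.ext <;> simp [toC, -Complex.ofReal_div]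
    ring
  · simp only [tangent, e0, portDir_zero]
    rw [exp_pi_div_two_mul_I']
    push_cast
    linear_combination (-((P.2 - Q.2) / 2 * (π / 2) : ℂ)) * Complex.I_mul_I
  · simp only [tangent, reverse, e2, portDir_one]
    push_cast
    simp only [zero_mul, Complex.exp_zero]
    ring

theorem joins_diagonal_rising (hx : P.1 < Q.1) (h : Q.2 - P.2 = Q.1 - P.1) :
    (curve P Q).Joins P Q 1 3 := by
  rw [curve_diagonal (by linarith) hx.ne]
  refine ⟨fun h' => ?_, by simp [point], by simp [point], ⟨Q.1 - P.1, by linarith, ?_⟩,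
    ⟨Q.1 - P.1, by linarith, ?_⟩⟩
  · have := congrArg (fun z => (rot z).1) h'
    simp only [rot_toC] at this
    linarith
  · simp only [tangent, portDir_one]
    apply Complex.ext <;> simp [toC] <;> linarith
  · simp only [tangent, reverse, portDir_three]
    apply Complex.ext <;> simp [toC] <;> linarith

theorem joins_diagonal_falling (hx : P.1 < Q.1) (h : P.2 - Q.2 = Q.1 - P.1) :
    (curve P Q).Joins P Q 0 2 := by
  rw [curve_diagonal (by linarith) hx.ne]
  refine ⟨fun h' => ?_, by simp [point], by simp [point], ⟨Q.1 - P.1, by linarith, ?_⟩,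
    ⟨Q.1 - P.1, by linarith, ?_⟩⟩
  · have := congrArg (fun z => (rot z).1) h'
    simp only [rot_toC] at this
    linarith
  · simp only [tangent, portDir_zero]
    apply Complex.ext <;> simp [toC] <;> linarith
  · simp only [tangent, reverse, portDir_two]
    apply Complex.ext <;> simp [toC] <;> linarith

end curve

namespace ChordDisc

variable {D : ChordDisc} {i j : ℕ} {t : ℝ}

theorem joins (h : D.E i j) : (curve (D.pos i) (D.pos j)).Joins (D.pos i) (D.pos j)
    (D.outL i j) (3 - D.outR i j) := by
  rcases framed_of_edge h with h | h | h | h | h <;> rw [h.outL, h.outR]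
  · simpa using joins_horizontal h.y h.x
  · simpa using joins_diagonal_rising h.x h.y
  · have := joins_diagonal_falling h.x h.y
    rwa [show (2 : ZMod 4) = 3 - (1 : ℕ) from rfl, show (0 : ZMod 4) = (0 : ℕ) from rfl] at this
  · have := joins_rising h.x h.y
    rwa [show (3 : ZMod 4) = 3 - (0 : ℕ) from rfl, show (2 : ZMod 4) = (2 : ℕ) from rfl] at this
  · have := joins_falling h.x h.y
    rwa [show (1 : ZMod 4) = 3 - (2 : ℕ) from rfl, show (0 : ZMod 4) = (0 : ℕ) from rfl] at this

/-- The interior of the curve of an edge lies in the zone of the edge. -/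
theorem zone_point (h : D.E i j) (h0 : 0 < t) (h1 : t < 1) :
    D.Zone i j (rot ((curve (D.pos i) (D.pos j)).point t)) := by
  obtain ⟨hs, hc, hsc, hb, hb'⟩ := sin_cos_bounds h0 h1
  set s := sin (t * (π / 2))
  set c := cos (t * (π / 2))
  have hs1 : s < 1 := by nlinarith
  have hc1 : c < 1 := by nlinarith
  rw [← side_zero]
  rcases framed_of_edge h with h | h | h | h | h
  · rw [h.zone_iff, rot_side_curve_horizontal h.y]
    have hx := h.x
    simp only [zero_mul, add_zero, one_mul]
    refine ⟨?_, ?_, ?_, ?_, ?_, ?_⟩ <;> nlinarith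
  · have hx := h.x
    have hy := h.y
    rw [h.zone_iff, curve_diagonal (by linarith) hx.ne, rot_side_segment]
    simp only [zero_mul, add_zero, sub_zero]
    refine ⟨?_, ?_, ?_⟩ <;> nlinarith
  · have hx := h.x
    have hy := h.y
    rw [h.zone_iff, curve_diagonal (by linarith) hx.ne, rot_side_segment]
    simp only [zero_mul, add_zero, sub_zero]
    refine ⟨?_, ?_, ?_⟩ <;> nlinarith
  · rw [h.zone_iff, rot_side_curve_rising h.x h.y]
    have hx := h.y
    simp only [zero_mul, sub_zero, one_mul]
    refine ⟨?_, ?_, ?_, ?_, ?_, ?_⟩ <;> nlinarith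
  · rw [h.zone_iff, rot_side_curve_falling h.x h.y]
    have hx := h.y
    simp only [zero_mul, sub_zero, one_mul]
    refine ⟨?_, ?_, ?_, ?_, ?_, ?_⟩ <;> nlinarith

end ChordDisc

end SmoothOrthogonal


/-! ### Ways from the outer edges to infinity -/

namespace SmoothOrthogonal

section
open Finset Topology Filter
open scoped Classical

theorem continuous_rot : Continuous rot := by
  unfold rot
  fun_prop

theorem continuous_side (s : Stroke) (t : ℝ) : Continuous (s.side t) := by
  unfold Stroke.side
  fun_prop

/-- What holds in an open set around a point of a stroke holds for the points immediately to its
left. -/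
theorem eventually_side {s : Stroke} {t : ℝ} {U : Set (ℝ × ℝ)} (hU : IsOpen U)
    (h : rot (s.point t) ∈ U) : ∀ᶠ ε : ℝ in 𝓝[>] 0, rot (s.side t (-ε)) ∈ U := by
  have hcont : Continuous fun ε : ℝ => rot (s.side t (-ε)) :=
    continuous_rot.comp ((continuous_side s t).comp continuous_neg)
  have : Tendsto (fun ε : ℝ => rot (s.side t (-ε))) (𝓝[>] 0) (𝓝 (rot (s.side t (-0)))) :=
    (hcont.tendsto 0).mono_left nhdsWithin_le_nhds
  rw [neg_zero, Stroke.side_zero] at this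
  exact this.eventually (hU.mem_nhds h)

/-- The points of a quarter circle below a horizontal edge, as seen from its centre. -/
theorem curve_horizontal_mem_circle {P Q : ℝ × ℝ} (h : P.2 = Q.2) (t ε : ℝ) :
    ((rot ((curve P Q).side t ε)).1 - (P.1 + (Q.1 - P.1) / 2)) ^ 2 +
      ((rot ((curve P Q).side t ε)).2 - (P.2 + (Q.1 - P.1) / 2)) ^ 2 =
      (1 + ε * (Real.pi / 2)) ^ 2 * ((Q.1 - P.1) ^ 2 / 2) := by
  rw [rot_side_curve_horizontal h]
  linear_combination ((1 + ε * (Real.pi / 2)) ^ 2 * ((Q.1 - P.1) ^ 2 / 2)) *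
    Real.sin_sq_add_cos_sq (t * (Real.pi / 2))

theorem curve_rising_mem_circle {P Q : ℝ × ℝ} (hx : P.1 = Q.1) (h : P.2 < Q.2) (t ε : ℝ) :
    ((rot ((curve P Q).side t ε)).1 - (P.1 + (Q.2 - P.2) / 2)) ^ 2 +
      ((rot ((curve P Q).side t ε)).2 - (P.2 + (Q.2 - P.2) / 2)) ^ 2 =
      (1 - ε * (Real.pi / 2)) ^ 2 * ((Q.2 - P.2) ^ 2 / 2) := by
  rw [rot_side_curve_rising hx h]
  linear_combination ((1 - ε * (Real.pi / 2)) ^ 2 * ((Q.2 - P.2) ^ 2 / 2)) *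
    Real.sin_sq_add_cos_sq (t * (Real.pi / 2))

theorem curve_falling_mem_circle {P Q : ℝ × ℝ} (hx : P.1 = Q.1) (h : Q.2 < P.2) (t ε : ℝ) :
    ((rot ((curve P Q).side t ε)).1 - (Q.1 - (P.2 - Q.2) / 2)) ^ 2 +
      ((rot ((curve P Q).side t ε)).2 - (Q.2 + (P.2 - Q.2) / 2)) ^ 2 =
      (1 - ε * (Real.pi / 2)) ^ 2 * ((P.2 - Q.2) ^ 2 / 2) := by
  rw [rot_side_curve_falling hx h]
  linear_combination ((1 - ε * (Real.pi / 2)) ^ 2 * ((P.2 - Q.2) ^ 2 / 2)) *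
    Real.sin_sq_add_cos_sq (t * (Real.pi / 2))

theorem eventually_small : ∀ᶠ ε : ℝ in 𝓝[>] 0, 0 < ε ∧ ε * (Real.pi / 2) < 1 := by
  have h : ∀ᶠ ε : ℝ in 𝓝[>] 0, ε < 1 / 2 :=
    eventually_nhdsWithin_of_eventually_nhds (eventually_lt_nhds (by norm_num))
  filter_upwards [self_mem_nhdsWithin, h] with ε h1 h2
  refine ⟨h1, ?_⟩
  have := Real.pi_lt_four
  have h1' : 0 < ε := h1
  nlinarith [Real.pi_pos]

theorem convex_disc (c₁ c₂ r : ℝ) :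
    Convex ℝ {p : ℝ × ℝ | (p.1 - c₁) ^ 2 + (p.2 - c₂) ^ 2 < r} := by
  rintro ⟨p₁, p₂⟩ hp ⟨q₁, q₂⟩ hq u v hu hv huv
  obtain rfl : u = 1 - v := by linarith
  simp only [Set.mem_ofPred_eq, Prod.fst_add, Prod.smul_fst, Prod.snd_add, Prod.smul_snd,
    smul_eq_mul] at *
  have e : ((1 - v) * p₁ + v * q₁ - c₁) ^ 2 + ((1 - v) * p₂ + v * q₂ - c₂) ^ 2 =
      (1 - v) * ((p₁ - c₁) ^ 2 + (p₂ - c₂) ^ 2) + v * ((q₁ - c₁) ^ 2 + (q₂ - c₂) ^ 2) -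
        (1 - v) * v * ((p₁ - q₁) ^ 2 + (p₂ - q₂) ^ 2) := by ring
  have h1 : 0 ≤ (1 - v) * v * ((p₁ - q₁) ^ 2 + (p₂ - q₂) ^ 2) := by positivity
  rcases hv.eq_or_lt with rfl | hv'
  · linarith
  · nlinarith

/-- A half-plane above a line is convex. -/
theorem convex_above (a b : ℝ) (s : ℝ) :
    Convex ℝ {p : ℝ × ℝ | s * (p.1 - a) < p.2 - b} := by
  rintro ⟨p₁, p₂⟩ hp ⟨q₁, q₂⟩ hq u v hu hv huv
  obtain rfl : u = 1 - v := by linarith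
  simp only [Set.mem_ofPred_eq, Prod.fst_add, Prod.smul_fst, Prod.snd_add, Prod.smul_snd,
    smul_eq_mul] at *
  rcases hv.eq_or_lt with rfl | hv'
  · linarith
  · nlinarith

namespace ChordDisc

variable (D : ChordDisc)

/-- The point is not a vertex, and it is not in the zone of any edge but `(k, l)`. -/
def Avoids (k l : ℕ) (w : ℝ × ℝ) : Prop :=
  (∀ s ≤ D.N, w ≠ D.pos s) ∧ ∀ r s, D.E r s → ¬ (r = k ∧ s = l) → ¬ D.Zone r s w

/-- The point can move to infinity, upwards, without meeting the drawing or, unless there is just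
one edge, the horizontal line through the root edge. -/
def Escapes (k l : ℕ) (p : ℝ × ℝ) : Prop :=
  ∃ W : Set (ℝ × ℝ), IsPreconnected W ∧ p ∈ W ∧ (∀ M, ∃ w ∈ W, M < w.2) ∧
    ∀ w ∈ W, (D.N = 1 ∨ 0 < w.2) ∧ D.Avoids k l w ∧
      ∀ t ∈ Set.Icc (0 : ℝ) 1, w ≠ rot ((curve (D.pos k) (D.pos l)).point t)

variable {D} {i j k l : ℕ} {x d R t : ℝ} {p q w : ℝ × ℝ}

/-- The way to infinity consists of a piece that contains `q` and the vertical ray above `q`. -/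
theorem escapes_of_mem {C : Set (ℝ × ℝ)} (hC : IsPreconnected C) (hp : p ∈ C) (hq : q ∈ C)
    (h1 : ∀ w ∈ C, (D.N = 1 ∨ 0 < w.2) ∧ D.Avoids k l w ∧
      ∀ t ∈ Set.Icc (0 : ℝ) 1, w ≠ rot ((curve (D.pos k) (D.pos l)).point t))
    (h2 : ∀ w : ℝ × ℝ, w.1 = q.1 → q.2 ≤ w.2 → (D.N = 1 ∨ 0 < w.2) ∧ D.Avoids k l w ∧
      ∀ t ∈ Set.Icc (0 : ℝ) 1, w ≠ rot ((curve (D.pos k) (D.pos l)).point t)) :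
    D.Escapes k l p := by
  refine ⟨C ∪ {q.1} ×ˢ Set.Ici q.2, ?_, Or.inl hp,
    fun M => ⟨(q.1, max q.2 (M + 1)), Or.inr ⟨rfl, Set.mem_Ici.2 (le_max_left _ _)⟩,
      lt_of_lt_of_le (lt_add_one M) (le_max_right _ _)⟩, ?_⟩
  · exact IsPreconnected.union q hq ⟨rfl, Set.self_mem_Ici⟩ hC
      (isPreconnected_singleton.prod isPreconnected_Ici)
  · rintro w (hw | hw)
    · exact h1 w hw
    · exact h2 w hw.1 hw.2

/-- A point in the region above an edge `(i, j)`, but in none of the cells above it except that of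
the outer edge `(k, l)`, is not in any other cell. -/
theorem IsChild.avoids (hc : D.IsChild i j k l) (hl : l = k + 1) (hw : D.Reg (1 / 2) i j w)
    (h1 : ∀ k' l', D.IsChild i j k' l' → ¬ (k' = k ∧ l' = l) → ¬ D.Cell (9 / 20) k' l' w)
    (h2 : ∀ s ∈ D.face i j, w ≠ D.pos s) : D.Avoids k l w := by
  have hij := D.lt hc.parent
  have hcij : D.Cell (1 / 2) i j w := by
    rw [Cell, if_neg hij.ne]
    exact Or.inr hw
  have key : ∀ r s, (r = s ∧ s ≤ D.N ∧ w = D.pos r ∨ D.E r s ∧ D.Zone r s w) →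
      ¬ (r = k ∧ s = l) → False := by
    intro r s hrs hne
    have hrs' : r = s ∨ D.E r s := hrs.imp (fun h => h.1) fun h => h.1
    have hcell : ∀ c, D.Cell c r s w := by
      intro c
      rw [Cell]
      rcases hrs with h | h
      · rw [if_pos h.1]
        exact h.2.2
      · rw [if_neg (D.lt h.1).ne]
        exact Or.inl h.2
    by_cases hne' : r = i ∧ s = j
    · obtain ⟨rfl, rfl⟩ := hne'
      rcases hrs with h | h
      · omega
      · exact not_reg_of_zone h.1 h.2 hw
    by_cases hu : Under r s i j
    · rcases exists_isChild hc.parent hrs' hu with ⟨rfl, h⟩ | ⟨k', l', hc', h⟩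
      · have := hcell 0
        rw [Cell, if_pos rfl] at this
        exact h2 r h this
      · by_cases hkl : k' = k ∧ l' = l
        · rw [hkl.1, hkl.2] at h
          rcases h with h | ⟨h3, h4, h5, h6, h7⟩
          · exact hne ⟨h.1.symm, h.2.symm⟩
          · rcases hrs with h8 | h8
            · omega
            · have := D.lt h8.1
              omega
        · apply h1 k' l' hc' hkl
          rcases h with h | h
          · rw [h.1, h.2]
            exact hcell _
          · exact hc'.cell_iff.2 (Or.inr
              (reg_of_under hc'.edge hrs' h le_rfl (by norm_num) (hcell _)))
    · by_cases hu' : Under i j r s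
      · rcases hrs with h | h
        · obtain ⟨h3, h4, h5, h6, h7⟩ := hu'
          omega
        · exact not_reg_of_zone h.1 h.2
            (reg_of_under h.1 (Or.inr hc.parent) hu' (by norm_num) le_rfl hcij)
      · exact cell_disjoint (hrs.imp (fun h => ⟨h.1, h.2.1⟩) fun h => h.1) (Or.inr hc.parent)
          hne' hu hu' (by norm_num) le_rfl (hcell _) hcij
  refine ⟨fun s hs h => key s s (Or.inl ⟨rfl, hs, h⟩) (by omega), fun r s hrs hne hz =>
    key r s (Or.inr ⟨hrs, hz⟩) hne⟩

theorem IsChild.pos_of_reg (hc : D.IsChild i j k l) (hw : D.Reg (1 / 2) i j w) : 0 < w.2 := by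
  have hreg : D.Reg (1 / 2) 0 D.N w := by
    by_cases h : i = 0 ∧ j = D.N
    · rwa [h.1, h.2] at hw
    · have h1 := D.lt hc.parent
      have h2 := D.le hc.parent
      refine reg_of_under D.root (Or.inr hc.parent)
        ⟨by omega, by omega, by omega, by omega, h⟩ (by norm_num) le_rfl ?_
      rw [Cell, if_neg h1.ne]
      exact Or.inr hw
  rw [isA_root.reg_iff, pos_zero] at hreg
  exact hreg.2.1

/-! ### Outer edges that are horizontal or diagonal -/

variable (D) in
/-- The three kinds of edges that run in the box below the row `R`, between the vertical lines
`a` and `a + d`. -/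
def BoxEdge (k l : ℕ) (a d R : ℝ) : Prop :=
  D.IsA k l ∧ D.pos k = (a, R) ∧ D.pos l = (a + d, R) ∨
  D.IsBL k l ∧ D.pos k = (a, R - d) ∧ D.pos l = (a + d, R) ∨
  D.IsBR k l ∧ D.pos k = (a, R) ∧ D.pos l = (a + d, R - d)

/-- Unless the child edge is vertical, the box below the row between its ends lies in the region
above the parent edge. -/
theorem IsChild.boxEdge (hc : D.IsChild i j k l) (hx : (D.pos k).1 ≠ (D.pos l).1)
    (hr : D.Row i j x d R) (he : D.Ends i j x d R) : D.BoxEdge k l (x + D.rk i j k * d) d R ∧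
    ∀ w : ℝ × ℝ, x + D.rk i j k * d < w.1 → w.1 < x + D.rk i j k * d + d → R - d < w.2 →
      D.Reg (1 / 2) i j w := by
  have hm := hc.card_face_pos
  have hm' : (1 : ℝ) ≤ #(D.face i j) := by exact_mod_cast hm
  have hne := hc.inL_parent_ne_zero
  have hd := hr.pos_d
  have ht0 : 0 ≤ D.rk i j k * d := by positivity
  have ht1 : D.rk i j k * d ≤ #(D.face i j) * d :=
    mul_le_mul_of_nonneg_right (by exact_mod_cast hc.rk_le) hd.le
  have hmd : d ≤ #(D.face i j) * d := by nlinarith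
  have ht2 : D.rk i j k ≠ 0 → d ≤ D.rk i j k * d := fun h => by
    have : (1 : ℝ) ≤ D.rk i j k := by exact_mod_cast Nat.one_le_iff_ne_zero.2 h
    nlinarith
  have ht3 : D.rk i j k ≠ #(D.face i j) → D.rk i j k * d + d ≤ #(D.face i j) * d := fun h => by
    have : (D.rk i j k : ℝ) + 1 ≤ #(D.face i j) := by
      exact_mod_cast Nat.succ_le_of_lt (lt_of_le_of_ne hc.rk_le h)
    nlinarith
  rcases he with ⟨h, hi, hj⟩ | ⟨h, hi, hj⟩ | ⟨h, hi, hj⟩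
  · refine ⟨?_, fun w h1 h2 h3 => ?_⟩
    · by_cases h0 : D.rk i j k = 0
      · right; left
        refine ⟨hc.isBL hr h0 hi h.outL h.inL, ?_, ?_⟩
        · rw [hc.left_eq h0, hi]
          simp [rk_left]
        · rw [hc.pos_right_of_rk_eq_zero hr h0, h0]
          simp
      by_cases h1 : D.rk i j k = #(D.face i j)
      · right; right
        refine ⟨hc.isBR hr h1 hj h.outR h.inR, ?_, ?_⟩
        · rw [hc.pos_left_of_rk_eq_card hr h1, h1]
        · rw [hc.right_eq h1, hj, h1]
          ext <;> simp only
          ring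
      · left
        obtain ⟨h2, h3, h4⟩ := hc.isA hr h0 h1
        refine ⟨h2, h3, ?_⟩
        rw [h4]
        ext <;> simp only
        ring
    · rw [h.reg_iff, hi, hj]
      exact ⟨hne, h3, Or.inl (by simp only; linarith), Or.inl (by simp only; linarith)⟩
  · have h0 : D.rk i j k ≠ 0 := fun h0 => by
      apply hx
      rw [hc.pos_right_of_rk_eq_zero hr h0, hc.left_eq h0, hi]
    have ht2 := ht2 h0
    refine ⟨?_, fun w h1 h2 h3 => ?_⟩
    · by_cases h1 : D.rk i j k = #(D.face i j)
      · right; right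
        refine ⟨hc.isBR hr h1 hj h.outR h.inR, ?_, ?_⟩
        · rw [hc.pos_left_of_rk_eq_card hr h1, h1]
        · rw [hc.right_eq h1, hj, h1]
          ext <;> simp only
          ring
      · left
        obtain ⟨h2, h3, h4⟩ := hc.isA hr h0 h1
        refine ⟨h2, h3, ?_⟩
        rw [h4]
        ext <;> simp only
        ring
    · rw [h.reg_iff, hi, hj]
      simp only
      exact ⟨hne, by linarith, by linarith, by linarith, Or.inl (by linarith)⟩
  · have h0 : D.rk i j k ≠ #(D.face i j) := fun h0 => by
      apply hx
      rw [hc.pos_left_of_rk_eq_card hr h0, hc.right_eq h0, hj]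
    have ht3 := ht3 h0
    refine ⟨?_, fun w h1 h2 h3 => ?_⟩
    · by_cases h1 : D.rk i j k = 0
      · right; left
        refine ⟨hc.isBL hr h1 hi h.outL h.inL, ?_, ?_⟩
        · rw [hc.left_eq h1, hi]
          simp [rk_left]
        · rw [hc.pos_right_of_rk_eq_zero hr h1, h1]
          simp
      · left
        obtain ⟨h2, h3, h4⟩ := hc.isA hr h1 h0
        refine ⟨h2, h3, ?_⟩
        rw [h4]
        ext <;> simp only
        ring
    · rw [h.reg_iff, hi, hj]
      simp only
      exact ⟨hne, by linarith, by linarith, by linarith, Or.inl (by linarith)⟩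

/-- The free part of the plane next to an outer edge in a box: the box itself up to the row, and
the vertical ray above its middle. -/
theorem IsChild.avoids_of_box (hc : D.IsChild i j k l) (hl : l = k + 1)
    (hx : (D.pos k).1 ≠ (D.pos l).1) (hr : D.Row i j x d R) (he : D.Ends i j x d R)
    (hs : ∀ c p k l, 0 ≤ c → D.IsChild i j k l → D.Cell c k l p →
      Slab c x d R (D.rk i j k) #(D.face i j) (D.inL k l) (D.inR k l) p)
    (h1 : x + D.rk i j k * d < w.1) (h2 : w.1 < x + D.rk i j k * d + d) (h3 : R - d < w.2)
    (h4 : w.2 ≤ R ∨ w.1 = x + D.rk i j k * d + d / 2) :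
    (D.N = 1 ∨ 0 < w.2) ∧ D.Avoids k l w := by
  have hw := (hc.boxEdge hx hr he).2 w h1 h2 h3
  have hd := hr.pos_d
  refine ⟨Or.inr (hc.pos_of_reg hw), hc.avoids hl hw (fun k' l' hc' hne hcell => ?_)
    fun s hs' h => ?_⟩
  · obtain ⟨h5, h6, -⟩ := hs _ _ _ _ (by norm_num) hc' hcell
    rcases lt_trichotomy (D.rk i j k') (D.rk i j k) with h7 | h7 | h7
    · have h6 := h6.resolve_left (by have := hc.rk_le; omega)
      have h8 : (D.rk i j k' + 1) * d ≤ D.rk i j k * d :=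
        mul_le_mul_of_nonneg_right (by exact_mod_cast h7) hd.le
      rcases h6 with h6 | h6
      · linarith
      · rcases h4 with h4 | h4 <;> linarith
    · exact hne (hc'.eq_of_rk_eq hc h7)
    · have h5 := h5.resolve_left (by omega)
      have h8 : ((D.rk i j k : ℝ) + 1) * d ≤ D.rk i j k' * d :=
        mul_le_mul_of_nonneg_right (by exact_mod_cast h7) hd.le
      rcases h5 with h5 | h5
      · linarith
      · rcases h4 with h4 | h4 <;> linarith
  · rw [h, hr.pos_eq s hs'] at h1 h2
    simp only [add_lt_add_iff_left] at h1
    have h5 : (D.rk i j k : ℝ) < D.rk i j s := lt_of_mul_lt_mul_right h1 hd.le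
    have h6 : ((D.rk i j k : ℝ) + 1) * d ≤ D.rk i j s * d :=
      mul_le_mul_of_nonneg_right (by exact_mod_cast h5) hd.le
    linarith

/-- A point just above a boxed edge lies in a convex part of the box which does not meet the edge
and reaches up to the middle of the row. -/
theorem BoxEdge.eventually {a : ℝ} (hE : D.E k l) (hd : 0 < d) (hb : D.BoxEdge k l a d R)
    (h0 : 0 < t) (h1 : t < 1) : ∀ᶠ ε : ℝ in 𝓝[>] 0, ∃ C : Set (ℝ × ℝ), Convex ℝ C ∧
      (∀ p ∈ C, a < p.1 ∧ p.1 < a + d ∧ R - d < p.2 ∧ p.2 ≤ R) ∧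
      (a + d / 2, R) ∈ C ∧ rot ((curve (D.pos k) (D.pos l)).side t (-ε)) ∈ C ∧
      ∀ p ∈ C, ∀ t ∈ Set.Icc (0 : ℝ) 1, p ≠ rot ((curve (D.pos k) (D.pos l)).point t) := by
  have hbox : IsOpen (Set.Ioo a (a + d) ×ˢ Set.Ioo (R - d) R) := isOpen_Ioo.prod isOpen_Ioo
  have hconv : Convex ℝ (Set.Ioo a (a + d) ×ˢ Set.Ioc (R - d) R) :=
    (convex_Ioo _ _).prod (convex_Ioc _ _)
  have hz := zone_point hE h0 h1
  rcases hb with ⟨h, hk, hl⟩ | ⟨h, hk, hl⟩ | ⟨h, hk, hl⟩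
  · rw [h.zone_iff, hk, hl] at hz
    have hz' : rot ((curve (D.pos k) (D.pos l)).point t) ∈
        Set.Ioo a (a + d) ×ˢ Set.Ioo (R - d) R := by
      rw [hk, hl]
      refine ⟨⟨?_, ?_⟩, ?_, ?_⟩ <;> simp only at * <;> linarith
    have hcirc := curve_horizontal_mem_circle h.y
    rw [hk, hl] at hcirc
    simp only [add_sub_cancel_left] at hcirc
    filter_upwards [eventually_side hbox hz', eventually_small] with ε hε hε'
    refine ⟨_, hconv.inter (convex_disc (a + d / 2) (R + d / 2) (d ^ 2 / 2)),
      fun p hp => ⟨hp.1.1.1, hp.1.1.2, hp.1.2.1, hp.1.2.2⟩,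
      ⟨⟨⟨by linarith, by linarith⟩, by linarith, le_rfl⟩, ?_⟩,
      ⟨⟨hε.1, hε.2.1, hε.2.2.le⟩, ?_⟩, ?_⟩
    · simp only [Set.mem_ofPred_eq]
      nlinarith
    · rw [Set.mem_ofPred_eq, hk, hl, hcirc]
      have : 0 < d ^ 2 / 2 := by positivity
      have h3 : 0 < ε * (Real.pi / 2) := by have := Real.pi_pos; have := hε'.1; positivity
      have : (1 + -ε * (Real.pi / 2)) ^ 2 < 1 := by nlinarith
      nlinarith
    · rintro p ⟨-, hp⟩ t' - rfl
      rw [Set.mem_ofPred_eq, ← Stroke.side_zero, hk, hl, hcirc] at hp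
      simp at hp
  · rw [h.zone_iff, hk, hl] at hz
    have hz' : rot ((curve (D.pos k) (D.pos l)).point t) ∈
        Set.Ioo a (a + d) ×ˢ Set.Ioo (R - d) R := by
      rw [hk, hl]
      refine ⟨⟨?_, ?_⟩, ?_, ?_⟩ <;> simp only at * <;> linarith
    have hx := h.x
    have hy := h.y
    have hline : ∀ t ε, rot ((curve (D.pos k) (D.pos l)).side t ε) =
        (a + t * d + ε * d, R - d + t * d - ε * d) := by
      intro t ε
      rw [curve_diagonal (by linarith) hx.ne, Stroke.rot_side_segment, hk, hl]
      ext <;> simp only <;> ring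
    filter_upwards [eventually_side hbox hz', eventually_small] with ε hε hε'
    refine ⟨_, hconv.inter (convex_above a (R - d) 1),
      fun p hp => ⟨hp.1.1.1, hp.1.1.2, hp.1.2.1, hp.1.2.2⟩,
      ⟨⟨⟨by linarith, by linarith⟩, by linarith, le_rfl⟩, ?_⟩,
      ⟨⟨hε.1, hε.2.1, hε.2.2.le⟩, ?_⟩, ?_⟩
    · simp only [Set.mem_ofPred_eq]
      linarith
    · rw [Set.mem_ofPred_eq, hline]
      have := mul_pos hε'.1 hd
      simp only
      linarith
    · rintro p ⟨-, hp⟩ t' - rfl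
      rw [Set.mem_ofPred_eq, ← Stroke.side_zero, hline] at hp
      simp only at hp
      linarith
  · rw [h.zone_iff, hk, hl] at hz
    have hz' : rot ((curve (D.pos k) (D.pos l)).point t) ∈
        Set.Ioo a (a + d) ×ˢ Set.Ioo (R - d) R := by
      rw [hk, hl]
      refine ⟨⟨?_, ?_⟩, ?_, ?_⟩ <;> simp only at * <;> linarith
    have hx := h.x
    have hy := h.y
    have hline : ∀ t ε, rot ((curve (D.pos k) (D.pos l)).side t ε) =
        (a + t * d - ε * d, R - t * d - ε * d) := by
      intro t ε
      rw [curve_diagonal (by linarith) hx.ne, Stroke.rot_side_segment, hk, hl]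
      ext <;> simp only <;> ring
    filter_upwards [eventually_side hbox hz', eventually_small] with ε hε hε'
    refine ⟨_, hconv.inter (convex_above a R (-1)),
      fun p hp => ⟨hp.1.1.1, hp.1.1.2, hp.1.2.1, hp.1.2.2⟩,
      ⟨⟨⟨by linarith, by linarith⟩, by linarith, le_rfl⟩, ?_⟩,
      ⟨⟨hε.1, hε.2.1, hε.2.2.le⟩, ?_⟩, ?_⟩
    · simp only [Set.mem_ofPred_eq]
      linarith
    · rw [Set.mem_ofPred_eq, hline]
      have := mul_pos hε'.1 hd
      simp only
      linarith
    · rintro p ⟨-, hp⟩ t' - rfl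
      rw [Set.mem_ofPred_eq, ← Stroke.side_zero, hline] at hp
      simp only at hp
      linarith

/-- A boxed edge lies below the row, apart from its ends. -/
theorem BoxEdge.ne_of_le {a : ℝ} (hE : D.E k l) (hb : D.BoxEdge k l a d R)
    (h1 : a < w.1) (h2 : w.1 < a + d) (h3 : R ≤ w.2) (ht : t ∈ Set.Icc (0 : ℝ) 1) :
    w ≠ rot ((curve (D.pos k) (D.pos l)).point t) := by
  rintro rfl
  have hj := joins hE
  rcases ht.1.eq_or_lt with rfl | h4
  · rw [hj.start_eq, rot_toC] at *
    rcases hb with ⟨h, hk, hl⟩ | ⟨h, hk, hl⟩ | ⟨h, hk, hl⟩ <;> rw [hk] at h1 <;> simp at h1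
  rcases ht.2.eq_or_lt with rfl | h5
  · rw [hj.end_eq, rot_toC] at *
    rcases hb with ⟨h, hk, hl⟩ | ⟨h, hk, hl⟩ | ⟨h, hk, hl⟩ <;> rw [hl] at h2 <;> simp at h2
  have hz := zone_point hE h4 h5
  rcases hb with ⟨h, hk, hl⟩ | ⟨h, hk, hl⟩ | ⟨h, hk, hl⟩ <;>
    rw [h.zone_iff, hk] at hz <;> simp only [hk] at * <;> linarith

theorem IsChild.eventually_escapes_of_box (hc : D.IsChild i j k l) (hl : l = k + 1)
    (hx : (D.pos k).1 ≠ (D.pos l).1) (h0 : 0 < t) (h1 : t < 1) :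
    ∀ᶠ ε : ℝ in 𝓝[>] 0, D.Escapes k l (rot ((curve (D.pos k) (D.pos l)).side t (-ε))) := by
  obtain ⟨x, d, R, hr, he, hs⟩ := exists_row hc.parent hc.card_face_pos
  have hb := (hc.boxEdge hx hr he).1
  have hd := hr.pos_d
  filter_upwards [hb.eventually hc.edge hd h0 h1] with ε hε
  obtain ⟨C, hC, hbox, hq, hp, hav⟩ := hε
  refine escapes_of_mem hC.isPreconnected hp hq (fun w hw => ?_) fun w hw1 hw2 => ?_
  · obtain ⟨h2, h3, h4, h5⟩ := hbox w hw
    have := hc.avoids_of_box hl hx hr he hs h2 h3 h4 (Or.inl h5)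
    exact ⟨this.1, this.2, hav w hw⟩
  · simp only at hw1 hw2
    have := hc.avoids_of_box hl hx hr he hs (w := w) (by linarith) (by linarith) (by linarith)
      (Or.inr hw1)
    exact ⟨this.1, this.2, fun t ht => hb.ne_of_le hc.edge (by linarith) (by linarith) hw2 ht⟩

/-- The case of a single edge. -/
theorem eventually_escapes_of_single (hN : D.N = 1) (h0 : 0 < t) (h1 : t < 1) :
    ∀ᶠ ε : ℝ in 𝓝[>] 0, D.Escapes 0 1 (rot ((curve (D.pos 0) (D.pos 1)).side t (-ε))) := by
  have hE : D.E 0 1 := hN ▸ D.root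
  have hA : D.IsA 0 1 := hN ▸ isA_root
  have hk : D.pos 0 = (0, 0) := pos_zero D
  have hl : D.pos 1 = (0 + 1, 0) := by
    have := pos_N D
    rw [hN] at this
    simpa using this
  have hb : D.BoxEdge 0 1 0 1 0 := Or.inl ⟨hA, hk, hl⟩
  have hav : ∀ w : ℝ × ℝ, 0 < w.1 → w.1 < 0 + 1 → D.Avoids 0 1 w := by
    intro w h2 h3
    constructor
    · rintro s hs rfl
      obtain rfl | rfl : s = 0 ∨ s = 1 := by omega
      · rw [hk] at h2
        simp at h2
      · rw [hl] at h3
        simp at h3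
    · intro r s hrs hne
      have := D.lt hrs
      have := D.le hrs
      omega
  filter_upwards [hb.eventually hE one_pos h0 h1] with ε hε
  obtain ⟨C, hC, hbox, hq, hp, hav'⟩ := hε
  refine escapes_of_mem hC.isPreconnected hp hq (fun w hw => ?_) fun w hw1 hw2 => ?_
  · obtain ⟨h2, h3, h4, h5⟩ := hbox w hw
    exact ⟨Or.inl hN, hav w h2 h3, hav' w hw⟩
  · simp only at hw1 hw2
    exact ⟨Or.inl hN, hav w (by linarith) (by linarith),
      fun t ht => hb.ne_of_le hE (by linarith) (by linarith) hw2 ht⟩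

/-! ### Outer edges that are vertical -/

/-- A rising vertical edge only occurs above a rising diagonal edge with the same lower end. -/
theorem IsChild.parent_of_isCL (hc : D.IsChild i j k l) (hCL : D.IsCL k l)
    (hr : D.Row i j x d R) (he : D.Ends i j x d R) : D.rk i j k = 0 ∧ D.IsBL i j ∧
      D.pos i = (x + d, R - d - #(D.face i j) * d) ∧
      D.pos j = (x + (#(D.face i j) + 1) * d, R - d) := by
  have hx := hCL.x
  have h2 : D.rk i j k ≠ 0 → D.rk i j k ≠ #(D.face i j) → False := fun h h' =>
    absurd (hc.isA hr h h').1.x (by linarith)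
  rcases he with ⟨h, hi, hj⟩ | ⟨h, hi, hj⟩ | ⟨h, hi, hj⟩
  · by_cases h0 : D.rk i j k = 0
    · exact absurd (hc.isBL hr h0 hi h.outL h.inL).x (by linarith)
    · by_cases h1 : D.rk i j k = #(D.face i j)
      · exact absurd (hc.isBR hr h1 hj h.outR h.inR).x (by linarith)
      · exact (h2 h0 h1).elim
  · by_cases h0 : D.rk i j k = 0
    · exact ⟨h0, h, hi, hj⟩
    · by_cases h1 : D.rk i j k = #(D.face i j)
      · exact absurd (hc.isBR hr h1 hj h.outR h.inR).x (by linarith)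
      · exact (h2 h0 h1).elim
  · by_cases h0 : D.rk i j k = 0
    · exact absurd (hc.isBL hr h0 hi h.outL h.inL).x (by linarith)
    · by_cases h1 : D.rk i j k = #(D.face i j)
      · rw [hc.right_eq h1] at hCL
        have h3 := hc.pos_left_of_rk_eq_card hr h1
        have h4 := hCL.y
        rw [h3, hj] at h4
        have hd := hr.pos_d
        have : 0 ≤ #(D.face i j) * d := by positivity
        simp only at h4
        linarith
      · exact (h2 h0 h1).elim

/-- A falling vertical edge only occurs above a falling diagonal edge with the same lower end. -/
theorem IsChild.parent_of_isCR (hc : D.IsChild i j k l) (hCR : D.IsCR k l)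
    (hr : D.Row i j x d R) (he : D.Ends i j x d R) : D.rk i j k = #(D.face i j) ∧ D.IsBR i j ∧
      D.pos i = (x, R - d) ∧
      D.pos j = (x + #(D.face i j) * d, R - d - #(D.face i j) * d) := by
  have hx := hCR.x
  have h2 : D.rk i j k ≠ 0 → D.rk i j k ≠ #(D.face i j) → False := fun h h' =>
    absurd (hc.isA hr h h').1.x (by linarith)
  rcases he with ⟨h, hi, hj⟩ | ⟨h, hi, hj⟩ | ⟨h, hi, hj⟩
  · by_cases h0 : D.rk i j k = 0
    · exact absurd (hc.isBL hr h0 hi h.outL h.inL).x (by linarith)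
    · by_cases h1 : D.rk i j k = #(D.face i j)
      · exact absurd (hc.isBR hr h1 hj h.outR h.inR).x (by linarith)
      · exact (h2 h0 h1).elim
  · by_cases h0 : D.rk i j k = 0
    · rw [hc.left_eq h0] at hCR
      have h3 := hc.pos_right_of_rk_eq_zero hr h0
      have h4 := hCR.y
      rw [h3, hi] at h4
      have hd := hr.pos_d
      have : 0 ≤ #(D.face i j) * d := by positivity
      simp only at h4
      linarith
    · by_cases h1 : D.rk i j k = #(D.face i j)
      · exact absurd (hc.isBR hr h1 hj h.outR h.inR).x (by linarith)
      · exact (h2 h0 h1).elim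
  · by_cases h0 : D.rk i j k = 0
    · exact absurd (hc.isBL hr h0 hi h.outL h.inL).x (by linarith)
    · by_cases h1 : D.rk i j k = #(D.face i j)
      · exact ⟨h1, h, hi, hj⟩
      · exact (h2 h0 h1).elim

/-- Next to a rising vertical edge one escapes along a diagonal to the upper left until all other
edges are to the right, and then upwards. -/
theorem IsChild.eventually_escapes_of_isCL (hc : D.IsChild i j k l) (hCL : D.IsCL k l)
    (h0 : 0 < t) (h1 : t < 1) :
    ∀ᶠ ε : ℝ in 𝓝[>] 0, D.Escapes k l (rot ((curve (D.pos k) (D.pos l)).side t (-ε))) := by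
  obtain ⟨x, d, R, hr, he, hs⟩ := exists_row hc.parent hc.card_face_pos
  obtain ⟨hrk, hBL, hi, hj⟩ := hc.parent_of_isCL hCL hr he
  have hE := hc.edge
  have hl := hc.pos_right_of_rk_eq_zero hr hrk
  have hd := hr.pos_d
  have hm : (1 : ℝ) ≤ #(D.face i j) := by exact_mod_cast hc.card_face_pos
  have hk : D.pos k = (x + d, R - d - #(D.face i j) * d) := by rw [hc.left_eq hrk, hi]
  generalize hmm : (#(D.face i j) : ℝ) * d = s at *
  have hsd : d ≤ s := by nlinarith
  have hxj : (D.pos j).1 = x + d + s := by rw [hj, ← hmm]; ring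
  -- a point with these properties is in the free region above the parent edge
  have hfree : ∀ w : ℝ × ℝ, x + d - s / 2 < w.1 → w.1 < x + d → x + d - w.1 < w.2 - (R - d - s) →
      (x + d - w.1 ≥ w.2 - R ∨ w.1 ≤ x + d - 9 / 20 * d) →
      (D.N = 1 ∨ 0 < w.2) ∧ D.Avoids k l w := by
    intro w h2 h3 h4 h5
    have hw : D.Reg (1 / 2) i j w := by
      rw [hBL.reg_iff, hxj, hi]
      simp only
      exact ⟨hc.inL_parent_ne_zero, by linarith, h4, by linarith, Or.inl (by linarith)⟩
    have ht : ∀ t : ℕ, t ≠ 0 → x + d ≤ x + t * d := fun t ht => by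
      have : (1 : ℝ) ≤ t := by exact_mod_cast Nat.one_le_iff_ne_zero.2 ht
      nlinarith
    refine ⟨Or.inr (hc.pos_of_reg hw), hc.avoids hCL.succ hw (fun k' l' hc' hne hcell => ?_)
      fun r hr' h => ?_⟩
    · obtain ⟨h6, -, -⟩ := hs _ _ _ _ (by norm_num) hc' hcell
      have hk' : D.rk i j k' ≠ 0 := fun h => hne (hc'.eq_of_rk_eq hc (h.trans hrk.symm))
      have := ht _ hk'
      rcases h6.resolve_left hk' with h6 | h6
      · linarith
      · rcases h5 with h5 | h5 <;> linarith
    · rw [h, hr.pos_eq r hr'] at h3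
      have := ht _ (rk_pos (D := D) (j := j) (mem_face.1 hr').1.1).ne'
      simp only at h3
      linarith
  have hz := zone_point hE h0 h1
  rw [hCL.zone_iff, hk, hl] at hz
  simp only at hz
  have hopen : IsOpen {p : ℝ × ℝ | p.1 < x + d ∧ x + d - 9 / 40 * (d + s) < p.1 ∧
      x + d - p.1 < p.2 - (R - d - s) ∧ x + d - p.1 < R - p.2} := by
    refine .and ?_ (.and ?_ (.and ?_ ?_)) <;> exact isOpen_lt (by fun_prop) (by fun_prop)
  have hz' : rot ((curve (D.pos k) (D.pos l)).point t) ∈ {p : ℝ × ℝ | p.1 < x + d ∧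
      x + d - 9 / 40 * (d + s) < p.1 ∧
      x + d - p.1 < p.2 - (R - d - s) ∧ x + d - p.1 < R - p.2} := by
    rw [Set.mem_ofPred_eq, hk, hl]
    refine ⟨?_, ?_, ?_, ?_⟩ <;> linarith
  have hcirc := curve_rising_mem_circle hCL.x hCL.y
  rw [hk, hl] at hcirc
  simp only at hcirc
  have hlen : R - (R - d - s) = d + s := by ring
  rw [hlen] at hcirc
  filter_upwards [eventually_side hopen hz', eventually_small] with ε hε hε'
  have hp := hcirc t (-ε)
  rw [← hk, ← hl] at hp
  generalize rot ((curve (D.pos k) (D.pos l)).side t (-ε)) = p at *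
  obtain ⟨h2, h3, h4, h5⟩ := hε
  have hout : (d + s) ^ 2 / 2 < (p.1 - (x + d + (d + s) / 2)) ^ 2 +
      (p.2 - (R - d - s + (d + s) / 2)) ^ 2 := by
    rw [hp]
    have h6 : 0 < ε * (Real.pi / 2) := mul_pos hε'.1 Real.pi_div_two_pos
    have h7 : 0 < (d + s) ^ 2 / 2 := half_pos (pow_pos (by linarith) 2)
    have : 1 < (1 - -ε * (Real.pi / 2)) ^ 2 := by nlinarith
    nlinarith
  have hC : Convex ℝ ((fun u : ℝ => p + u • ((-1, 1) : ℝ × ℝ)) ''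
      Set.Icc 0 (p.1 - (x + d - 19 / 40 * s))) := by
    have := (convex_Icc (0 : ℝ) (p.1 - (x + d - 19 / 40 * s))).is_linear_image
      (IsLinearMap.isLinearMap_smul' ((-1, 1) : ℝ × ℝ))
    have := this.translate p
    rwa [Set.image_image] at this
  refine escapes_of_mem (q := (x + d - 19 / 40 * s, p.2 + (p.1 - (x + d - 19 / 40 * s))))
    hC.isPreconnected ⟨0, ⟨le_rfl, by linarith⟩, by simp⟩
    ⟨_, ⟨by linarith, le_rfl⟩, by ext <;> simp⟩ ?_ fun w hw1 hw2 => ?_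
  · rintro _ ⟨u, ⟨hu0, hu1⟩, rfl⟩
    simp only [Prod.smul_mk, smul_eq_mul, mul_neg, mul_one]
    have := hfree (p + (-u, u)) (by simp only [Prod.fst_add]; linarith)
      (by simp only [Prod.fst_add]; linarith)
      (by simp only [Prod.fst_add, Prod.snd_add]; linarith)
      (Or.inl (by simp only [Prod.fst_add, Prod.snd_add]; linarith))
    refine ⟨this.1, this.2, fun t' ht' h => ?_⟩
    have h6 := hcirc t' 0
    rw [Stroke.side_zero, ← hk, ← hl, ← h] at h6
    simp only [Prod.fst_add, Prod.snd_add, zero_mul, sub_zero, one_pow, one_mul] at h6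
    have h7 : 0 ≤ u * (p.2 - (R - d - s) - (p.1 - (x + d))) := mul_nonneg hu0 (by linarith)
    nlinarith [sq_nonneg u]
  · simp only at hw1 hw2
    have := hfree w (by linarith) (by linarith) (by linarith) (Or.inr (by linarith))
    refine ⟨this.1, this.2, fun t' ht' h => ?_⟩
    have hjoin := joins hE
    rcases ht'.1.eq_or_lt with rfl | h6
    · rw [hjoin.start_eq, rot_toC, hk] at h
      rw [h] at hw1
      simp only at hw1
      linarith
    rcases ht'.2.eq_or_lt with rfl | h7
    · rw [hjoin.end_eq, rot_toC, hl] at h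
      rw [h] at hw1
      simp only at hw1
      linarith
    have hz := zone_point hE h6 h7
    rw [← h, hCL.zone_iff, hk, hl] at hz
    simp only at hz
    linarith

/-- The mirror image of `IsChild.eventually_escapes_of_isCL`. -/
theorem IsChild.eventually_escapes_of_isCR (hc : D.IsChild i j k l) (hCR : D.IsCR k l)
    (h0 : 0 < t) (h1 : t < 1) :
    ∀ᶠ ε : ℝ in 𝓝[>] 0, D.Escapes k l (rot ((curve (D.pos k) (D.pos l)).side t (-ε))) := by
  obtain ⟨x, d, R, hr, he, hs⟩ := exists_row hc.parent hc.card_face_pos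
  obtain ⟨hrk, hBR, hi, hj⟩ := hc.parent_of_isCR hCR hr he
  have hE := hc.edge
  have hk := hc.pos_left_of_rk_eq_card hr hrk
  have hd := hr.pos_d
  have hm : (1 : ℝ) ≤ #(D.face i j) := by exact_mod_cast hc.card_face_pos
  have hl : D.pos l = (x + #(D.face i j) * d, R - d - #(D.face i j) * d) := by
    rw [hc.right_eq hrk, hj]
  generalize hmm : (#(D.face i j) : ℝ) * d = s at *
  have hsd : d ≤ s := by nlinarith
  have hfree : ∀ w : ℝ × ℝ, w.1 < x + s + s / 2 → x + s < w.1 → w.1 - (x + s) < w.2 - (R - d - s) →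
      (w.1 - (x + s) ≥ w.2 - R ∨ x + s + 9 / 20 * d ≤ w.1) →
      (D.N = 1 ∨ 0 < w.2) ∧ D.Avoids k l w := by
    intro w h2 h3 h4 h5
    have hw : D.Reg (1 / 2) i j w := by
      rw [hBR.reg_iff, hi, hj]
      simp only
      exact ⟨hc.inL_parent_ne_zero, by linarith, h4, by linarith, Or.inl (by linarith)⟩
    have ht : ∀ t : ℕ, t ≤ #(D.face i j) → x + t * d ≤ x + s := fun t ht => by
      have : (t : ℝ) ≤ #(D.face i j) := by exact_mod_cast ht
      nlinarith
    refine ⟨Or.inr (hc.pos_of_reg hw), hc.avoids hCR.succ hw (fun k' l' hc' hne hcell => ?_)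
      fun r hr' h => ?_⟩
    · obtain ⟨-, h6, -⟩ := hs _ _ _ _ (by norm_num) hc' hcell
      have hk' : D.rk i j k' ≠ #(D.face i j) :=
        fun h => hne (hc'.eq_of_rk_eq hc (h.trans hrk.symm))
      have := ht _ (Nat.succ_le_of_lt (lt_of_le_of_ne hc'.rk_le hk'))
      push_cast at this
      rcases h6.resolve_left hk' with h6 | h6
      · linarith
      · rcases h5 with h5 | h5 <;> linarith
    · rw [h, hr.pos_eq r hr'] at h3
      have := ht _ (rk_le_card hr')
      simp only at h3
      linarith
  have hz := zone_point hE h0 h1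
  rw [hCR.zone_iff, hk, hl] at hz
  simp only at hz
  have hopen : IsOpen {p : ℝ × ℝ | x + s < p.1 ∧ p.1 < x + s + 9 / 40 * (d + s) ∧
      p.1 - (x + s) < p.2 - (R - d - s) ∧ p.1 - (x + s) < R - p.2} := by
    refine .and ?_ (.and ?_ (.and ?_ ?_)) <;> exact isOpen_lt (by fun_prop) (by fun_prop)
  have hz' : rot ((curve (D.pos k) (D.pos l)).point t) ∈ {p : ℝ × ℝ | x + s < p.1 ∧
      p.1 < x + s + 9 / 40 * (d + s) ∧
      p.1 - (x + s) < p.2 - (R - d - s) ∧ p.1 - (x + s) < R - p.2} := by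
    rw [Set.mem_ofPred_eq, hk, hl]
    refine ⟨?_, ?_, ?_, ?_⟩ <;> linarith
  have hcirc := curve_falling_mem_circle hCR.x hCR.y
  rw [hk, hl] at hcirc
  simp only at hcirc
  have hlen : R - (R - d - s) = d + s := by ring
  rw [hlen] at hcirc
  filter_upwards [eventually_side hopen hz', eventually_small] with ε hε hε'
  have hp := hcirc t (-ε)
  rw [← hk, ← hl] at hp
  generalize rot ((curve (D.pos k) (D.pos l)).side t (-ε)) = p at *
  obtain ⟨h2, h3, h4, h5⟩ := hε
  have hout : (d + s) ^ 2 / 2 < (p.1 - (x + s - (d + s) / 2)) ^ 2 +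
      (p.2 - (R - d - s + (d + s) / 2)) ^ 2 := by
    rw [hp]
    have h6 : 0 < ε * (Real.pi / 2) := mul_pos hε'.1 Real.pi_div_two_pos
    have h7 : 0 < (d + s) ^ 2 / 2 := half_pos (pow_pos (by linarith) 2)
    have : 1 < (1 - -ε * (Real.pi / 2)) ^ 2 := by nlinarith
    nlinarith
  have hC : Convex ℝ ((fun u : ℝ => p + u • ((1, 1) : ℝ × ℝ)) ''
      Set.Icc 0 (x + s + 19 / 40 * s - p.1)) := by
    have := (convex_Icc (0 : ℝ) (x + s + 19 / 40 * s - p.1)).is_linear_image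
      (IsLinearMap.isLinearMap_smul' ((1, 1) : ℝ × ℝ))
    have := this.translate p
    rwa [Set.image_image] at this
  refine escapes_of_mem (q := (x + s + 19 / 40 * s, p.2 + (x + s + 19 / 40 * s - p.1)))
    hC.isPreconnected ⟨0, ⟨le_rfl, by linarith⟩, by simp⟩
    ⟨_, ⟨by linarith, le_rfl⟩, by ext <;> simp⟩ ?_ fun w hw1 hw2 => ?_
  · rintro _ ⟨u, ⟨hu0, hu1⟩, rfl⟩
    simp only [Prod.smul_mk, smul_eq_mul, mul_one]
    have := hfree (p + (u, u)) (by simp only [Prod.fst_add]; linarith)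
      (by simp only [Prod.fst_add]; linarith)
      (by simp only [Prod.fst_add, Prod.snd_add]; linarith)
      (Or.inl (by simp only [Prod.fst_add, Prod.snd_add]; linarith))
    refine ⟨this.1, this.2, fun t' ht' h => ?_⟩
    have h6 := hcirc t' 0
    rw [Stroke.side_zero, ← hk, ← hl, ← h] at h6
    simp only [Prod.fst_add, Prod.snd_add, zero_mul, sub_zero, one_pow, one_mul] at h6
    have h7 : 0 ≤ u * (p.2 - (R - d - s) + (p.1 - (x + s))) := mul_nonneg hu0 (by linarith)
    nlinarith [sq_nonneg u]
  · simp only at hw1 hw2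
    have := hfree w (by linarith) (by linarith) (by linarith) (Or.inr (by linarith))
    refine ⟨this.1, this.2, fun t' ht' h => ?_⟩
    have hjoin := joins hE
    rcases ht'.1.eq_or_lt with rfl | h6
    · rw [hjoin.start_eq, rot_toC, hk] at h
      rw [h] at hw1
      simp only at hw1
      linarith
    rcases ht'.2.eq_or_lt with rfl | h7
    · rw [hjoin.end_eq, rot_toC, hl] at h
      rw [h] at hw1
      simp only at hw1
      linarith
    have hz := zone_point hE h6 h7
    rw [← h, hCR.zone_iff, hk, hl] at hz
    simp only at hz
    linarith

/-- The points just above an outer edge are connected to infinity. -/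
theorem eventually_escapes (hE : D.E k (k + 1)) (h0 : 0 < t) (h1 : t < 1) :
    ∀ᶠ ε : ℝ in 𝓝[>] 0,
      D.Escapes k (k + 1) (rot ((curve (D.pos k) (D.pos (k + 1))).side t (-ε))) := by
  by_cases hN : k = 0 ∧ k + 1 = D.N
  · obtain ⟨rfl, hN⟩ := hN
    exact eventually_escapes_of_single hN.symm h0 h1
  · obtain ⟨i, j, hc⟩ := exists_parent hE hN
    rcases framed_of_edge hE with h | h | h | h | h
    · exact hc.eventually_escapes_of_box rfl h.x.ne h0 h1
    · exact hc.eventually_escapes_of_box rfl h.x.ne h0 h1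
    · exact hc.eventually_escapes_of_box rfl h.x.ne h0 h1
    · exact hc.eventually_escapes_of_isCL h h0 h1
    · exact hc.eventually_escapes_of_isCR h h0 h1

end ChordDisc

end

end SmoothOrthogonal


/-! ### Rotation systems and faces -/

namespace SmoothOrthogonal

section
open Finset
open scoped Classical

variable {V : Type*} {G : SimpleGraph V}

namespace RotationSystem

variable (R : RotationSystem G)

theorem faceOf_faceNext (d : G.Dart) : R.faceOf (R.faceNext d) = R.faceOf d :=
  Quotient.sound (s := Equiv.Perm.SameCycle.setoid R.faceNext) ⟨-1, by simp⟩

theorem faceOf_symm (d : G.Dart) : R.faceOf d.symm = R.faceOf (R.rot d) := by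
  rw [← faceOf_faceNext]
  rfl

theorem faceNext_fst (d : G.Dart) : (R.faceNext d).fst = d.snd := R.rot_fst d.symm

theorem exists_rot_pow_eq [Finite V] {d e : G.Dart} (h : d.fst = e.fst) :
    ∃ k : ℕ, (R.rot ^ k) d = e := by
  have := Fintype.ofFinite V
  exact (R.rot_cyclic d e h).exists_nat_pow_eq

theorem rot_pow_fst (d : G.Dart) (k : ℕ) : ((R.rot ^ k) d).fst = d.fst := by
  induction k with
  | zero => rfl
  | succ k ih => rw [pow_succ', Equiv.Perm.mul_apply, rot_fst, ih]

end RotationSystem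

theorem edge_dart (e : G.edgeSet) : ∃ d : G.Dart, d.edge = e := by
  obtain ⟨e, he⟩ := e
  induction e with
  | _ x y => exact ⟨⟨(x, y), he⟩, rfl⟩

theorem add_self_mod_two {α : Type*} (f : α → ZMod 2) : f + f = 0 := by
  ext
  exact CharTwo.add_self_eq_zero _

theorem add_cancel_left_mod_two {α : Type*} (f g : α → ZMod 2) : f + (f + g) = g := by
  rw [← add_assoc, add_self_mod_two, zero_add]

/-! ### Cycles modulo two and faces -/

namespace RotationSystem

variable (R : RotationSystem G)

/-- The set of edges that separate the faces in a set from the other ones. -/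
noncomputable def coboundaryMap : (R.Face → ZMod 2) →ₗ[ZMod 2] G.edgeSet → ZMod 2 where
  toFun φ e := φ (R.faceOf (edge_dart e).choose) + φ (R.faceOf (edge_dart e).choose.symm)
  map_add' φ ψ := by
    ext v
    simp only [Pi.add_apply]
    ring
  map_smul' a φ := by
    ext v
    simp [mul_add]

theorem coboundaryMap_apply (φ : R.Face → ZMod 2) (d : G.Dart) :
    R.coboundaryMap φ ⟨d.edge, d.edge_mem⟩ = φ (R.faceOf d) + φ (R.faceOf d.symm) := by
  have h := (edge_dart (⟨d.edge, d.edge_mem⟩ : G.edgeSet)).choose_spec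
  change φ (R.faceOf (edge_dart _).choose) + φ (R.faceOf (edge_dart _).choose.symm) = _
  rcases (SimpleGraph.dart_edge_eq_iff _ _).1 h with h | h <;> rw [h]
  rw [SimpleGraph.Dart.symm_symm, add_comm]

end RotationSystem

section Cycles

variable [Fintype V]

/-- The boundary of a set of edges modulo two, given by its characteristic function: the vertices
of odd degree. -/
noncomputable def boundary (G : SimpleGraph V) (γ : Sym2 V → ZMod 2) (v : V) : ZMod 2 :=
  ∑ d : G.Dart with d.fst = v, γ d.edge

theorem boundary_add (γ γ' : Sym2 V → ZMod 2) :
    boundary G (γ + γ') = boundary G γ + boundary G γ' := by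
  ext v
  simp [boundary, sum_add_distrib]

theorem boundary_single {x y : V} (h : G.Adj x y) :
    boundary G (Pi.single s(x, y) 1) = Pi.single x 1 + Pi.single y 1 := by
  ext v
  have hxy : x ≠ y := h.ne
  let d : G.Dart := ⟨(x, y), h⟩
  have key : ∀ e : G.Dart, (Pi.single s(x, y) 1 : Sym2 V → ZMod 2) e.edge =
      (if e = d then 1 else 0) + if e = d.symm then 1 else 0 := by
    intro e
    have h1 : d ≠ d.symm := d.symm_ne.symm
    have h2 : e.edge = s(x, y) ↔ e = d ∨ e = d.symm := SimpleGraph.dart_edge_eq_iff e d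
    by_cases h3 : e = d
    · rw [if_pos h3, if_neg (by rw [h3]; exact h1), h2.2 (Or.inl h3)]
      simp
    · by_cases h4 : e = d.symm
      · rw [if_neg h3, if_pos h4, h2.2 (Or.inr h4)]
        simp
      · rw [if_neg h3, if_neg h4, Pi.single_eq_of_ne fun h => (h2.1 h).elim h3 h4]
        simp
  simp only [boundary, key, sum_add_distrib, sum_ite_eq', mem_filter, mem_univ, true_and,
    Pi.add_apply]
  change ((if x = v then 1 else 0) + if y = v then 1 else 0) = _
  simp only [Pi.single_apply, eq_comm (a := v)]

/-- The edges of a walk that are used an odd number of times have the ends of the walk as their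
boundary. -/
theorem exists_boundary_of_walk {x y : V} (p : G.Walk x y) :
    ∃ γ : Sym2 V → ZMod 2, (∀ e ∉ p.edges, γ e = 0) ∧
      boundary G γ = Pi.single x 1 + Pi.single y 1 := by
  induction p with
  | nil => exact ⟨0, fun _ _ => rfl, by
      ext v
      simp [boundary, CharTwo.add_self_eq_zero]⟩
  | @cons u v w h p ih =>
    obtain ⟨γ, h1, h2⟩ := ih
    refine ⟨Pi.single s(u, v) 1 + γ, fun e he => ?_, ?_⟩
    · rw [SimpleGraph.Walk.edges_cons, List.mem_cons, not_or] at he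
      rw [Pi.add_apply, h1 e he.2, Pi.single_eq_of_ne he.1, add_zero]
    · rw [boundary_add, h2, boundary_single h, add_assoc, add_cancel_left_mod_two]

/-- The boundary map of the graph, as a linear map. -/
noncomputable def boundaryMap (G : SimpleGraph V) :
    (G.edgeSet → ZMod 2) →ₗ[ZMod 2] V → ZMod 2 where
  toFun γ v := ∑ d : G.Dart with d.fst = v, γ ⟨d.edge, d.edge_mem⟩
  map_add' γ γ' := by
    ext v
    simp [sum_add_distrib]
  map_smul' a γ := by
    ext v
    simp [mul_sum]

/-- In a connected graph, every sum of two vertices is a boundary; the boundaries have codimension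
at most one. -/
theorem card_le_finrank_range_boundaryMap (hG : G.Connected) :
    Fintype.card V ≤ Module.finrank (ZMod 2) (LinearMap.range (boundaryMap G)) + 1 := by
  obtain ⟨x⟩ := hG.nonempty
  have h1 : LinearMap.range (boundaryMap G) ⊔ Submodule.span (ZMod 2) {Pi.single x 1} = ⊤ := by
    rw [eq_top_iff, ← (Pi.basisFun (ZMod 2) V).span_eq, Submodule.span_le]
    rintro _ ⟨y, rfl⟩
    obtain ⟨p⟩ := hG.preconnected x y
    obtain ⟨γ, -, hγ⟩ := exists_boundary_of_walk p
    have h2 : (Pi.single y 1 : V → ZMod 2) = boundary G γ + Pi.single x 1 := by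
      rw [hγ, add_comm, add_cancel_left_mod_two]
    rw [Pi.basisFun_apply, h2]
    exact Submodule.add_mem_sup ⟨fun e => γ e, rfl⟩ (Submodule.mem_span_singleton_self _)
  have h2 := Submodule.finrank_add_le_finrank_add_finrank (LinearMap.range (boundaryMap G))
    (Submodule.span (ZMod 2) {Pi.single x 1})
  rw [h1, finrank_top, Module.finrank_fintype_fun_eq_card] at h2
  have h3 : Module.finrank (ZMod 2) (Submodule.span (ZMod 2) {(Pi.single x 1 : V → ZMod 2)}) ≤ 1 :=
    (finrank_span_le_card _).trans (by simp)
  omega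

namespace RotationSystem

variable (R : RotationSystem G)

/-- The border of a set of faces is a cycle: around a vertex one enters the set as often as one
leaves it. -/
theorem boundaryMap_coboundaryMap (φ : R.Face → ZMod 2) :
    boundaryMap G (R.coboundaryMap φ) = 0 := by
  ext v
  change ∑ d : G.Dart with d.fst = v, R.coboundaryMap φ ⟨d.edge, d.edge_mem⟩ = 0
  simp only [coboundaryMap_apply, faceOf_symm, sum_add_distrib]
  have : ∑ d : G.Dart with d.fst = v, φ (R.faceOf (R.rot d)) =
      ∑ d : G.Dart with d.fst = v, φ (R.faceOf d) :=
    sum_equiv R.rot (fun d => by simp [R.rot_fst]) fun d _ => rfl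
  rw [this]
  exact CharTwo.add_self_eq_zero _

/-- The faces of a connected graph are connected through its edges. -/
theorem eq_of_coboundaryMap_eq_zero (hG : G.Connected) {φ : R.Face → ZMod 2}
    (h : R.coboundaryMap φ = 0) (d e : G.Dart) : φ (R.faceOf d) = φ (R.faceOf e) := by
  have hsymm : ∀ d : G.Dart, φ (R.faceOf d) = φ (R.faceOf d.symm) := fun d => by
    have h1 := R.coboundaryMap_apply φ d
    rw [h] at h1
    exact CharTwo.add_eq_zero.1 h1.symm
  have hrot : ∀ d e : G.Dart, d.fst = e.fst → φ (R.faceOf d) = φ (R.faceOf e) := by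
    intro d e hde
    obtain ⟨k, rfl⟩ := R.exists_rot_pow_eq hde
    clear hde
    induction k with
    | zero => rfl
    | succ k ih => rw [ih, pow_succ', Equiv.Perm.mul_apply, ← faceOf_symm, ← hsymm]
  obtain ⟨p⟩ := hG.preconnected d.fst e.fst
  generalize hx : d.fst = x at p
  generalize hy : e.fst = y at p
  induction p generalizing d with
  | nil => exact hrot d e (hx.trans hy.symm)
  | @cons u v w h p ih =>
    rw [hrot d ⟨(u, v), h⟩ hx, hsymm]
    exact ih _ rfl hy

end RotationSystem

/-- In an embedding of genus zero every cycle separates: there is a set of faces whose borders to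
the other faces are the edges of the cycle. -/
theorem OuterplaneEmbedding.exists_potential (hG : G.Connected) (E : OuterplaneEmbedding G)
    {γ : Sym2 V → ZMod 2} (hγ : boundary G γ = 0) :
    ∃ φ : E.Face → ZMod 2, φ E.outer = 0 ∧
      ∀ d, φ (E.faceOf (E.rot d)) = φ (E.faceOf d) + γ d.edge := by
  have : Finite E.Face := Quotient.finite _
  have := Fintype.ofFinite E.Face
  have h1 : Module.finrank (ZMod 2) (LinearMap.ker E.coboundaryMap) ≤ 1 := by
    refine (Submodule.finrank_mono ?_).trans
      ((finrank_span_le_card {fun _ => (1 : ZMod 2)}).trans (by simp))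
    intro φ hφ
    rw [Submodule.mem_span_singleton]
    refine ⟨φ E.outer, ?_⟩
    ext F
    obtain ⟨d, rfl⟩ := Quotient.exists_rep F
    obtain ⟨x⟩ := hG.nonempty
    obtain ⟨e, -, he⟩ := E.mem_outer x
    rw [← he]
    exact (mul_one _).trans (E.eq_of_coboundaryMap_eq_zero hG hφ e d)
  have h2 := LinearMap.finrank_range_add_finrank_ker E.coboundaryMap
  have h3 := LinearMap.finrank_range_add_finrank_ker (boundaryMap G)
  have h4 := card_le_finrank_range_boundaryMap hG
  have h5 := E.euler
  rw [Nat.card_eq_fintype_card, Nat.card_eq_fintype_card, Nat.card_eq_fintype_card] at h5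
  rw [Module.finrank_fintype_fun_eq_card] at h2 h3
  -- by Euler's formula, the borders and the cycles have the same dimension,
  -- `|F| - 1 = |E| - |V| + 1`
  have h6 : LinearMap.range E.coboundaryMap = LinearMap.ker (boundaryMap G) := by
    refine Submodule.eq_of_le_of_finrank_le ?_ (by omega)
    rintro _ ⟨φ, rfl⟩
    exact E.boundaryMap_coboundaryMap φ
  have h7 : (fun e : G.edgeSet => γ e) ∈ LinearMap.ker (boundaryMap G) := hγ
  rw [← h6] at h7
  obtain ⟨φ, hφ⟩ := h7
  refine ⟨fun F => φ F + φ E.outer, CharTwo.add_self_eq_zero _, fun d => ?_⟩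
  have h8 := E.coboundaryMap_apply φ d
  rw [hφ, RotationSystem.faceOf_symm] at h8
  change γ d.edge = _ at h8
  rw [h8]
  linear_combination -CharTwo.add_self_eq_zero (φ (E.faceOf d))

end Cycles

end

end SmoothOrthogonal


/-! ### The outer cycle -/

namespace SmoothOrthogonal

section
open Finset
open scoped Classical

variable {V : Type*} {G : SimpleGraph V}

/-- Going around a vertex from `d` to `d'`, the potential changes at `d` only, if no other edge of
the cycle is met; the dart before `d` is not met. -/
theorem RotationSystem.potential_eq [Finite V] (R : RotationSystem G) {φ : R.Face → ZMod 2}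
    {γ : Sym2 V → ZMod 2} (hφ : ∀ d, φ (R.faceOf (R.rot d)) = φ (R.faceOf d) + γ d.edge)
    {d d' : G.Dart} (hdd : d.fst = d'.fst) (hne : d ≠ d')
    (h0 : ∀ e : G.Dart, e.fst = d.fst → e ≠ d → e ≠ d' → R.rot e ≠ d → γ e.edge = 0) :
    φ (R.faceOf d') = φ (R.faceOf d) + γ d.edge := by
  have hex := R.exists_rot_pow_eq hdd
  have hk := Nat.find_spec hex
  have hmin := fun m => Nat.find_min hex (m := m)
  generalize Nat.find hex = k at *
  have hret : ∀ i, 0 < i → i ≤ k → (R.rot ^ i) d ≠ d := by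
    intro i h1 h2 h3
    refine hmin (k - i) (by omega) ?_
    rw [← hk, ← Nat.sub_add_cancel h2, pow_add, Equiv.Perm.mul_apply, h3, Nat.add_sub_cancel]
  have key : ∀ i, i < k → φ (R.faceOf ((R.rot ^ (i + 1)) d)) = φ (R.faceOf d) + γ d.edge := by
    intro i hi
    induction i with
    | zero => simpa using hφ d
    | succ i ih =>
      rw [pow_succ', Equiv.Perm.mul_apply, hφ, ih (by omega),
        h0 _ (R.rot_pow_fst d _) (hret _ (by omega) (by omega)) (hmin _ hi), add_zero]
      have := hret (i + 2) (by omega) (by omega)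
      rwa [pow_succ', Equiv.Perm.mul_apply] at this
  rcases Nat.eq_zero_or_pos k with rfl | h
  · exact absurd hk hne
  · rw [← hk]
    have := key (k - 1) (by omega)
    rwa [Nat.sub_add_cancel h] at this

theorem dart_eq_of_snd {d e : G.Dart} (h1 : d.fst = e.fst) (h2 : d.snd = e.snd) : d = e :=
  SimpleGraph.Dart.ext _ _ (Prod.ext h1 h2)

theorem dart_edge (d : G.Dart) : d.edge = s(d.fst, d.snd) := rfl

namespace OuterplaneEmbedding

variable (E : OuterplaneEmbedding G)

/-- The darts of the outer face, in reverse order, from `o` on. -/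
def outDart (o : G.Dart) (i : ℕ) : G.Dart := E.faceNext.symm^[i] o

/-- The vertices of the outer face, in counterclockwise order, from the tail of `o` on. -/
def outVert (o : G.Dart) (i : ℕ) : V := (E.outDart o i).fst

variable {E} {o : G.Dart} {p q r i j : ℕ}

theorem outDart_shift (b i : ℕ) : E.outDart (E.outDart o b) i = E.outDart o (b + i) := by
  rw [outDart, outDart, outDart, add_comm, Function.iterate_add_apply]

theorem outVert_shift (b i : ℕ) : E.outVert (E.outDart o b) i = E.outVert o (b + i) := by
  rw [outVert, outVert, outDart_shift]

theorem faceNext_outDart (i : ℕ) : E.faceNext (E.outDart o (i + 1)) = E.outDart o i := by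
  rw [outDart, Function.iterate_succ_apply', Equiv.apply_symm_apply]
  rfl

theorem outDart_succ_snd (i : ℕ) : (E.outDart o (i + 1)).snd = E.outVert o i := by
  rw [← E.faceNext_fst, faceNext_outDart]
  rfl

theorem adj_outVert (i : ℕ) : G.Adj (E.outVert o i) (E.outVert o (i + 1)) := by
  rw [← outDart_succ_snd]
  exact (E.outDart o (i + 1)).adj.symm

theorem rot_symm_outDart (i : ℕ) : E.rot (E.outDart o (i + 1)).symm = E.outDart o i :=
  faceNext_outDart i

theorem faceOf_outDart (ho : E.faceOf o = E.outer) (i : ℕ) :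
    E.faceOf (E.outDart o i) = E.outer := by
  induction i with
  | zero => exact ho
  | succ i ih => rw [← E.faceOf_faceNext, faceNext_outDart, ih]

theorem exists_outDart_eq [Finite V] (ho : E.faceOf o = E.outer) {d : G.Dart}
    (hd : E.faceOf d = E.outer) :
    ∃ i, E.outDart o i = d := by
  have h : E.faceNext.SameCycle o d := Quotient.exact (ho.trans hd.symm)
  have := Fintype.ofFinite V
  obtain ⟨k, hk⟩ := (Equiv.Perm.sameCycle_inv.2 h).exists_nat_pow_eq
  refine ⟨k, ?_⟩
  rw [← hk, outDart, ← Equiv.Perm.iterate_eq_pow]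
  rfl

variable [Fintype V]

/-- The outer face has only one corner at a vertex: otherwise a closed curve through the outer
face and the vertex would show that it is a cut vertex. -/
theorem eq_of_faceOf_eq_outer (hG : Biconnected G) {d d' : G.Dart} (h : d.fst = d'.fst)
    (hd : E.faceOf d = E.outer) (hd' : E.faceOf d' = E.outer) : d = d' := by
  by_contra hne
  have hv : d.snd ≠ d.fst := d.snd_ne_fst
  have hv' : d'.snd ≠ d.fst := h ▸ d'.snd_ne_fst
  obtain ⟨p⟩ := hG.2 d.fst ⟨d.snd, hv⟩ ⟨d'.snd, hv'⟩
  -- the curve runs from `d.snd` to `d'.snd` off the vertex, and back through it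
  obtain ⟨γ, hγ, hb⟩ := exists_boundary_of_walk (p.map (SimpleGraph.Embedding.induce _).toHom)
  have hγ' : ∀ e : G.Dart, e.fst = d.fst → γ e.edge = 0 := by
    intro e he
    apply hγ
    intro hmem
    rw [dart_edge] at hmem
    have := SimpleGraph.Walk.fst_mem_support_of_mem_edges _ hmem
    rw [SimpleGraph.Walk.support_map, List.mem_map] at this
    obtain ⟨z, -, hz⟩ := this
    exact z.2 (hz.trans he)
  have hadj : G.Adj d.fst d'.snd := by
    rw [h]
    exact d'.adj
  have hb' : boundary G (γ + (Pi.single s(d.fst, d.snd) 1 + Pi.single s(d.fst, d'.snd) 1)) = 0 := by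
    rw [boundary_add, boundary_add, hb, boundary_single d.adj, boundary_single hadj]
    ext v
    change (Pi.single d.snd 1 + Pi.single d'.snd 1 + _ : V → ZMod 2) v = 0
    simp only [Pi.add_apply]
    linear_combination CharTwo.add_self_eq_zero ((Pi.single d.snd 1 : V → ZMod 2) v) +
      CharTwo.add_self_eq_zero ((Pi.single d'.snd 1 : V → ZMod 2) v) +
      CharTwo.add_self_eq_zero ((Pi.single d.fst 1 : V → ZMod 2) v)
  obtain ⟨φ, h0, hφ⟩ := E.exists_potential hG.1 hb'
  have hother : ∀ e e' : G.Dart, e.fst = d.fst → e'.fst = d.fst → e ≠ e' →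
      e.edge ≠ s(d.fst, e'.snd) := by
    intro e e' he he' hee h
    rw [dart_edge, he, Sym2.congr_right] at h
    exact hee (dart_eq_of_snd (he.trans he'.symm) h)
  have := E.potential_eq hφ h hne fun e he h1 h2 _ => by
    rw [Pi.add_apply, Pi.add_apply, hγ' e he, Pi.single_eq_of_ne (hother _ _ he rfl h1),
      Pi.single_eq_of_ne (hother _ _ he h.symm h2)]
    simp
  rw [hd, hd', h0, Pi.add_apply, Pi.add_apply, hγ' d rfl, ← dart_edge, Pi.single_eq_same,
    Pi.single_eq_of_ne (hother _ _ rfl h.symm hne)] at this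
  simp at this

/-- Around the outer face one meets every vertex exactly once. -/
theorem outVert_bijOn (hG : Biconnected G) (ho : E.faceOf o = E.outer) :
    (∀ i, E.outDart o (i + Fintype.card V) = E.outDart o i) ∧
    (∀ i < Fintype.card V, ∀ j < Fintype.card V, E.outVert o i = E.outVert o j → i = j) ∧
    ∀ v, ∃ i < Fintype.card V, E.outVert o i = v := by
  set n := Function.minimalPeriod E.faceNext.symm o with hn
  have hper : ∀ i, E.outDart o (i % n) = E.outDart o i := fun i =>
    Function.iterate_mod_minimalPeriod_eq
  have hpos : 0 < n := Function.minimalPeriod_pos_of_mem_periodicPts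
    (Function.Injective.mem_periodicPts E.faceNext.symm.injective o)
  have hinj : ∀ i < n, ∀ j < n, E.outVert o i = E.outVert o j → i = j := fun i hi j hj h =>
    Function.iterate_injOn_Iio_minimalPeriod hi hj
      (eq_of_faceOf_eq_outer hG h (faceOf_outDart ho i) (faceOf_outDart ho j))
  have hsurj : ∀ v, ∃ i < n, E.outVert o i = v := by
    intro v
    obtain ⟨d, rfl, hd⟩ := E.mem_outer v
    obtain ⟨i, rfl⟩ := exists_outDart_eq ho hd
    exact ⟨i % n, Nat.mod_lt _ hpos, by rw [outVert, hper]⟩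
  have hcard : Fintype.card V = n := by
    have : Function.Bijective fun i : Fin n => E.outVert o i :=
      ⟨fun i j h => Fin.ext (hinj i i.2 j j.2 h), fun v => by
        obtain ⟨i, hi, h⟩ := hsurj v
        exact ⟨⟨i, hi⟩, h⟩⟩
    rw [← Fintype.card_of_bijective this, Fintype.card_fin]
  rw [hcard]
  refine ⟨fun i => ?_, hinj, hsurj⟩
  rw [← hper, Nat.add_mod_right, hper]

theorem snd_eq_outVert (hG : Biconnected G) (ho : E.faceOf o = E.outer) :
    o.snd = E.outVert o (Fintype.card V - 1) := by
  have := Fintype.card_pos_iff.2 ⟨o.fst⟩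
  have h := (outVert_bijOn hG ho).1 0
  rw [zero_add] at h
  rw [← outDart_succ_snd, Nat.sub_add_cancel this, h]
  rfl

section Chord

variable (hG : Biconnected G) (ho : E.faceOf o = E.outer)
include hG ho

theorem outVert_card : E.outVert o (Fintype.card V) = E.outVert o 0 := by
  rw [outVert, ← zero_add (Fintype.card V), (outVert_bijOn hG ho).1]
  rfl

theorem outVert_inj (hi : i < Fintype.card V) (hj : j < Fintype.card V) :
    E.outVert o i = E.outVert o j ↔ i = j :=
  ⟨(outVert_bijOn hG ho).2.1 i hi j hj, fun h => h ▸ rfl⟩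

theorem outVert_edge_iff (hq : q < Fintype.card V) (hr : r < Fintype.card V)
    (hi : i < Fintype.card V) :
    s(E.outVert o q, E.outVert o r) = s(E.outVert o i, E.outVert o (i + 1)) ↔
      q = i ∧ r = i + 1 ∨ q = i + 1 ∧ r = i ∨
        i + 1 = Fintype.card V ∧ (q = i ∧ r = 0 ∨ q = 0 ∧ r = i) := by
  rw [Sym2.eq_iff]
  rcases (Nat.succ_le_of_lt hi).lt_or_eq with h | h
  · rw [outVert_inj hG ho hq hi, outVert_inj hG ho hr hi, outVert_inj hG ho hq h,
      outVert_inj hG ho hr h]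
    omega
  · have h0 : 0 < Fintype.card V := by omega
    rw [show i + 1 = Fintype.card V from h, outVert_card hG ho, outVert_inj hG ho hq hi,
      outVert_inj hG ho hr hi, outVert_inj hG ho hq h0, outVert_inj hG ho hr h0]
    omega

end Chord

variable (E o) in
/-- The cycle that consists of the edge from `0` to `p` and the part of the outer cycle from `p`
back to `0`, numbering the vertices along the outer cycle. -/
noncomputable def chordCycle (p : ℕ) : Sym2 V → ZMod 2 :=
  Pi.single s(E.outVert o 0, E.outVert o p) 1 +
    ∑ i ∈ Ico p (Fintype.card V), Pi.single s(E.outVert o i, E.outVert o (i + 1)) 1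

theorem boundary_chordCycle (hG : Biconnected G) (ho : E.faceOf o = E.outer)
    (hp : p < Fintype.card V) (hadj : G.Adj (E.outVert o 0) (E.outVert o p)) :
    boundary G (E.chordCycle o p) = 0 := by
  have key : ∀ m, p ≤ m → boundary G (∑ i ∈ Ico p m,
      Pi.single s(E.outVert o i, E.outVert o (i + 1)) 1) =
      Pi.single (E.outVert o p) 1 + Pi.single (E.outVert o m) 1 := by
    intro m hm
    induction m, hm using Nat.le_induction with
    | base =>
      ext
      simp [boundary, CharTwo.add_self_eq_zero]
    | succ m hm ih =>
      rw [sum_Ico_succ_top hm, boundary_add, ih, boundary_single (adj_outVert m), add_assoc,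
        add_cancel_left_mod_two]
  rw [chordCycle, boundary_add, boundary_single hadj, key _ hp.le, outVert_card hG ho, add_assoc,
    add_cancel_left_mod_two, add_self_mod_two]

theorem chordCycle_apply (hG : Biconnected G) (ho : E.faceOf o = E.outer) (h0 : 0 < p)
    (hp : p + 1 < Fintype.card V) (hq : q < Fintype.card V) (hr : r < Fintype.card V) :
    E.chordCycle o p s(E.outVert o q, E.outVert o r) =
      if q = 0 ∧ r = p ∨ q = p ∧ r = 0 ∨ p ≤ q ∧ r = q + 1 ∨ p ≤ r ∧ q = r + 1 ∨
        q = 0 ∧ r + 1 = Fintype.card V ∨ q + 1 = Fintype.card V ∧ r = 0 then 1 else 0 := by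
  have hchord : s(E.outVert o q, E.outVert o r) = s(E.outVert o 0, E.outVert o p) ↔
      q = 0 ∧ r = p ∨ q = p ∧ r = 0 := by
    rw [Sym2.eq_iff, outVert_inj hG ho hq (by omega), outVert_inj hG ho hr (by omega),
      outVert_inj hG ho hq (by omega), outVert_inj hG ho hr (by omega)]
  have hedge := fun i (hi : i < Fintype.card V) => outVert_edge_iff hG ho hq hr hi
  rw [chordCycle, Pi.add_apply, Finset.sum_apply]
  simp only [Pi.single_apply]
  by_cases h1 : q = 0 ∧ r = p ∨ q = p ∧ r = 0
  · rw [if_pos (hchord.2 h1), if_pos (by tauto), sum_eq_zero, add_zero]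
    intro i hi
    rw [mem_Ico] at hi
    rw [if_neg]
    rw [hedge i hi.2]
    omega
  rw [if_neg (fun h => h1 (hchord.1 h)), zero_add]
  by_cases h2 : ∃ i ∈ Ico p (Fintype.card V),
      s(E.outVert o q, E.outVert o r) = s(E.outVert o i, E.outVert o (i + 1))
  · obtain ⟨i, hi, h⟩ := h2
    rw [sum_eq_single_of_mem i hi, if_pos h, if_pos]
    · rw [mem_Ico] at hi
      rw [hedge i hi.2] at h
      omega
    · intro j hj hji
      rw [mem_Ico] at hi hj
      rw [hedge i hi.2] at h
      rw [if_neg]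
      rw [hedge j hj.2]
      omega
  · rw [sum_eq_zero, if_neg]
    · rintro (h | h | h | h | h | h)
      · exact h1 (Or.inl h)
      · exact h1 (Or.inr h)
      · exact h2 ⟨q, mem_Ico.2 ⟨by omega, by omega⟩, (hedge q hq).2 (by omega)⟩
      · exact h2 ⟨r, mem_Ico.2 ⟨by omega, by omega⟩, (hedge r hr).2 (by omega)⟩
      · exact h2 ⟨r, mem_Ico.2 ⟨by omega, by omega⟩, (hedge r hr).2 (by omega)⟩
      · exact h2 ⟨q, mem_Ico.2 ⟨by omega, by omega⟩, (hedge q hq).2 (by omega)⟩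
    · exact fun i hi => if_neg fun h => h2 ⟨i, hi, h⟩

/-- The chord `f` from `0` to `p` separates the inner faces at the vertices up to `p` from those at
the vertices from `p` on. -/
theorem exists_chord_potential (hG : Biconnected G) (ho : E.faceOf o = E.outer) (h0 : 0 < p)
    (hp : p + 1 < Fintype.card V) {f : G.Dart} (hf0 : f.fst = E.outVert o 0)
    (hfp : f.snd = E.outVert o p) : ∃ φ : E.Face → ZMod 2,
      (∀ q d, p < q → q < Fintype.card V → d.fst = E.outVert o q → d ≠ E.outDart o q →
        φ (E.faceOf d) = 1) ∧
      (∀ q d, 0 < q → q < p → d.fst = E.outVert o q → φ (E.faceOf d) = 0) ∧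
      φ (E.faceOf (E.rot f)) = 0 ∧
      (∀ q d, 0 < q → q < p → d.fst = E.outVert o q →
        φ (E.faceOf d.symm) = φ (E.faceOf d)) ∧
      ∀ d, d.fst = E.outVert o 0 → d ≠ f → d ≠ o → φ (E.faceOf d.symm) = φ (E.faceOf d) := by
  have hadj : G.Adj (E.outVert o 0) (E.outVert o p) := by
    rw [← hf0, ← hfp]
    exact f.adj
  obtain ⟨φ, hout, hφ⟩ := E.exists_potential hG.1 (boundary_chordCycle hG ho (by omega) hadj)
  have hsurj := (outVert_bijOn hG ho).2.2
  have hinj := fun i j => outVert_inj hG ho (i := i) (j := j)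
  -- the values of the cycle at the darts with tail `q`, and their heads
  have hval : ∀ (q) (d : G.Dart), q < Fintype.card V → d.fst = E.outVert o q → ∃ r < Fintype.card V,
      d.snd = E.outVert o r ∧ E.chordCycle o p d.edge =
        if q = 0 ∧ r = p ∨ q = p ∧ r = 0 ∨ p ≤ q ∧ r = q + 1 ∨ p ≤ r ∧ q = r + 1 ∨
          q = 0 ∧ r + 1 = Fintype.card V ∨ q + 1 = Fintype.card V ∧ r = 0 then 1 else 0 := by
    intro q d hq hd
    obtain ⟨r, hr, h⟩ := hsurj d.snd
    refine ⟨r, hr, h.symm, ?_⟩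
    rw [dart_edge, hd, ← h, chordCycle_apply hG ho h0 hp hq hr]
  have hzero : ∀ (q) (d : G.Dart), 0 < q → q < p → d.fst = E.outVert o q →
      E.chordCycle o p d.edge = 0 := by
    intro q d hq hqp hd
    obtain ⟨r, hr, h, hv⟩ := hval q d (by omega) hd
    rw [hv, if_neg]
    omega
  have hlast := (snd_eq_outVert hG ho).symm
  have hzero' : ∀ d : G.Dart, d.fst = E.outVert o 0 → d ≠ f → d ≠ o →
      E.chordCycle o p d.edge = 0 := by
    intro d hd hdf hdo
    obtain ⟨r, hr, h, hv⟩ := hval 0 d (by omega) hd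
    have h1 : r ≠ p := by
      rintro rfl
      exact hdf (dart_eq_of_snd (hd.trans hf0.symm) (h.trans hfp.symm))
    have h2 : r ≠ Fintype.card V - 1 := by
      rintro rfl
      exact hdo (dart_eq_of_snd hd (h.trans hlast))
    rw [hv, if_neg]
    omega
  have hsymm : ∀ d : G.Dart, E.chordCycle o p d.edge = 0 →
      φ (E.faceOf d.symm) = φ (E.faceOf d) := by
    intro d hd
    rw [E.faceOf_symm, hφ, hd, add_zero]
  refine ⟨φ, ?_, ?_, ?_, fun q d h1 h2 h3 => hsymm d (hzero q d h1 h2 h3),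
    fun d h1 h2 h3 => hsymm d (hzero' d h1 h2 h3)⟩
  · intro q d hq hqn hd hne
    have hprev : E.rot (E.outDart o (q + 1)).symm = E.outDart o q := rot_symm_outDart q
    have hq1 : E.chordCycle o p (E.outDart o q).edge = 1 := by
      obtain ⟨r, hr, h, hv⟩ := hval q (E.outDart o q) hqn rfl
      rw [hv, if_pos]
      obtain ⟨q', rfl⟩ : ∃ q', q = q' + 1 := ⟨q - 1, by omega⟩
      rw [outDart_succ_snd, hinj _ _ (by omega) hr] at h
      omega
    have := E.potential_eq hφ (d := E.outDart o q) (d' := d) hd.symm hne.symm ?_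
    · rw [this, faceOf_outDart ho, hout, hq1, zero_add]
    intro e he h1 h2 h3
    obtain ⟨r, hr, h, hv⟩ := hval q e hqn he
    have h4 : r + 1 ≠ q := by
      rintro rfl
      exact h1 (dart_eq_of_snd he (h.trans (outDart_succ_snd r).symm))
    have h5 : E.outVert o r ≠ E.outVert o (q + 1) := by
      intro h5
      apply h3
      rw [← hprev]
      congr 1
      exact dart_eq_of_snd (he.trans (outDart_succ_snd q).symm) (h.trans h5)
    have h6 : r ≠ q + 1 := fun h => h5 (h ▸ rfl)
    have h7 : ¬ (q + 1 = Fintype.card V ∧ r = 0) := by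
      rintro ⟨h7, rfl⟩
      rw [h7, outVert_card hG ho] at h5
      exact h5 rfl
    rw [hv, if_neg]
    omega
  · intro q d h1 h2 hd
    by_cases hne : d = E.outDart o q
    · rw [hne, faceOf_outDart ho, hout]
    · have := E.potential_eq hφ (d := E.outDart o q) (d' := d) hd.symm (Ne.symm hne)
        fun e he _ _ _ => hzero q e h1 h2 he
      rw [this, faceOf_outDart ho, hout, hzero q _ h1 h2 rfl, zero_add]
  · have hfo : f ≠ o := by
      rintro rfl
      rw [hfp, hinj _ _ (by omega) (by omega)] at hlast
      omega
    have h1 := E.potential_eq hφ (d := o) (d' := f) hf0.symm hfo.symm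
      fun e he h1 h2 _ => hzero' e he h2 h1
    have hv1 : E.chordCycle o p f.edge = 1 := by
      rw [dart_edge, hf0, hfp, chordCycle_apply hG ho h0 hp (by omega) (by omega), if_pos]
      exact Or.inl ⟨rfl, rfl⟩
    have hv2 : E.chordCycle o p o.edge = 1 := by
      rw [dart_edge, ← hlast, show o.fst = E.outVert o 0 from rfl,
        chordCycle_apply hG ho h0 hp (by omega) (by omega), if_pos]
      omega
    rw [hφ, h1, hv1, hv2, ho, hout, zero_add, CharTwo.add_self_eq_zero]

/-- Edges do not cross: a chord at `0` and another one. -/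
theorem not_adj_of_chord (hG : Biconnected G) (ho : E.faceOf o = E.outer) (hq : 0 < q)
    (hqp : q < p) (hpr : p < r) (hr : r < Fintype.card V)
    (h : G.Adj (E.outVert o 0) (E.outVert o p)) : ¬ G.Adj (E.outVert o q) (E.outVert o r) := by
  intro h'
  obtain ⟨φ, h1, h2, -, h4, -⟩ := exists_chord_potential hG ho (p := p) (by omega) (by omega)
    (f := ⟨(E.outVert o 0, E.outVert o p), h⟩) rfl rfl
  let d : G.Dart := ⟨(E.outVert o q, E.outVert o r), h'⟩
  have h5 := h4 q d hq hqp rfl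
  rw [h2 q d hq hqp rfl, h1 r d.symm hpr hr rfl] at h5
  · exact one_ne_zero h5
  · intro h6
    obtain ⟨r, rfl⟩ : ∃ r', r = r' + 1 := ⟨r - 1, by omega⟩
    have h7 : E.outVert o q = E.outVert o r := by
      rw [← outDart_succ_snd r, ← h6]
      rfl
    rw [outVert_inj hG ho (by omega) (by omega)] at h7
    omega

theorem not_crossing (hG : Biconnected G) (ho : E.faceOf o = E.outer) {a b c d : ℕ} (hab : a < b)
    (hbc : b < c) (hcd : c < d) (hd : d < Fintype.card V)
    (h : G.Adj (E.outVert o a) (E.outVert o c)) : ¬ G.Adj (E.outVert o b) (E.outVert o d) := by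
  have := not_adj_of_chord hG (faceOf_outDart ho a) (q := b - a) (p := c - a) (r := d - a)
    (by omega) (by omega) (by omega) (by omega)
  simpa only [outVert_shift, add_zero, Nat.add_sub_cancel' hab.le,
    Nat.add_sub_cancel' (hab.trans hbc).le,
    Nat.add_sub_cancel' (hab.trans (hbc.trans hcd)).le] using this (by
      simpa only [outVert_shift, add_zero, Nat.add_sub_cancel' (hab.trans hbc).le] using h)

/-- The counterclockwise order of the darts at a vertex, starting with the dart of the outer face,
is the order of their heads along the outer cycle, from the last one to the first one. -/
theorem snd_rot_lt (hG : Biconnected G) (ho : E.faceOf o = E.outer) {f : G.Dart}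
    (hf : f.fst = E.outVert o 0) (hp : p < Fintype.card V) (hfp : f.snd = E.outVert o p)
    (hr : r < Fintype.card V) (hfr : (E.rot f).snd = E.outVert o r) (hne : E.rot f ≠ o) :
    r < p := by
  have hpos : ∀ {d : G.Dart} {i : ℕ}, d.fst = E.outVert o 0 → d.snd = E.outVert o i → 0 < i := by
    intro d i h1 h2
    rcases Nat.eq_zero_or_pos i with rfl | h
    · exact absurd (h2.trans h1.symm) d.snd_ne_fst
    · exact h
  have hp0 := hpos hf hfp
  have hrf : (E.rot f).fst = E.outVert o 0 := (E.rot_fst f).trans hf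
  have hr0 := hpos hrf hfr
  have hrp : r ≠ p := by
    rintro rfl
    have h1 : E.rot f = f := dart_eq_of_snd (E.rot_fst f) (hfr.trans hfp.symm)
    obtain ⟨k, hk⟩ := E.exists_rot_pow_eq (d := f) (e := o) hf
    rw [← hk, h1] at hne
    exact hne (by rw [Equiv.Perm.pow_apply_eq_self_of_apply_eq_self h1])
  by_contra hlt
  obtain ⟨φ, h1, -, h3, -, h5⟩ := exists_chord_potential hG ho hp0 (by omega) hf hfp
  have h6 := h5 _ hrf (fun h => hrp (by
    rw [h, hfp, outVert_inj hG ho hp hr] at hfr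
    exact hfr.symm)) hne
  rw [h3, h1 r (E.rot f).symm (by omega) hr hfr] at h6
  · exact one_ne_zero h6
  · intro h7
    obtain ⟨r, rfl⟩ : ∃ r', r = r' + 1 := ⟨r - 1, by omega⟩
    have h8 : E.outVert o 0 = E.outVert o r := by
      rw [← outDart_succ_snd r, ← h7]
      exact hrf.symm
    rw [outVert_inj hG ho (by omega) (by omega)] at h8
    omega

end OuterplaneEmbedding

end

end SmoothOrthogonal


/-! ### Unfolding an outerplane graph -/

namespace SmoothOrthogonal

section
open Finset
open scoped Classical

variable {V : Type*} {G : SimpleGraph V}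

/-- The number of steps along the cycle `0, 1, …, n - 1` from `i` to `j`. -/
def turn (n i j : ℕ) : ℕ := if i ≤ j then j - i else j + n - i

/-- The vertices of an outerplane graph numbered along the outer cycle, counterclockwise, in such a
way that `0` is adjacent to `N` and that all vertices after `N` have degree two; they will be called
leaves. There are no leaves only if there are no chords. In the field `rot_snd`, the first
alternative says that `E.rot d` is the dart of the outer face at its tail. -/
structure Unfolding (E : OuterplaneEmbedding G) where
  n : ℕ
  N : ℕ
  y : ℕ → V
  N_pos : 0 < N
  N_lt : N < n
  n_eq_two : N = 1 → n = 2
  inj : ∀ {i j}, i < n → j < n → y i = y j → i = j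
  surj : ∀ v, ∃ i < n, y i = v
  noncrossing : ∀ {a b c d}, a < b → b < c → c < d → d < n → G.Adj (y a) (y c) →
    ¬ G.Adj (y b) (y d)
  adj_succ : ∀ {i}, i + 1 < n → G.Adj (y i) (y (i + 1))
  adj_last : G.Adj (y 0) (y (n - 1))
  adj_root : G.Adj (y 0) (y N)
  leaf : ∀ {i j}, N < i → i < n → j < n → G.Adj (y i) (y j) →
    j = i + 1 ∨ i = j + 1 ∨ i + 1 = n ∧ j = 0
  chordless : N + 1 = n → ∀ {i j}, i < j → j < n → G.Adj (y i) (y j) →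
    j = i + 1 ∨ i = 0 ∧ j + 1 = n
  outer : ∀ {d}, E.faceOf d = E.outer →
    (∃ i, i + 1 < n ∧ d.fst = y (i + 1) ∧ d.snd = y i) ∨ d.fst = y 0 ∧ d.snd = y (n - 1)
  rot_snd : ∀ {i j k} {d : G.Dart}, i < n → j < n → k < n → d.fst = y i → d.snd = y j →
    (E.rot d).snd = y k → (k + 1 = i ∨ i = 0 ∧ k + 1 = n) ∨ turn n i k < turn n i j

variable {E : OuterplaneEmbedding G} {o : G.Dart}

/-- The edges are those of the disc, those of the path from `N` through all leaves, and the one from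
`0` to the last leaf. -/
theorem Unfolding.edge_cases {U : Unfolding E} {i j : ℕ} (hij : i < j) (hj : j < U.n)
    (h : G.Adj (U.y i) (U.y j)) :
    j ≤ U.N ∨ U.N ≤ i ∧ j = i + 1 ∨ U.N < j ∧ i = 0 ∧ j + 1 = U.n := by
  have hN0 := U.N_pos
  by_cases hjN : j ≤ U.N
  · exact Or.inl hjN
  · have := U.leaf (by omega) hj (by omega) h.symm
    omega

variable [Fintype V]

namespace OuterplaneEmbedding

theorem outVert_add_card (hG : Biconnected G) (ho : E.faceOf o = E.outer) (i : ℕ) :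
    E.outVert o (i + Fintype.card V) = E.outVert o i := by
  rw [outVert, outVert, (outVert_bijOn hG ho).1]

theorem outVert_turn (hG : Biconnected G) (ho : E.faceOf o = E.outer) {i j : ℕ}
    (hi : i < Fintype.card V) :
    E.outVert (E.outDart o i) (turn (Fintype.card V) i j) = E.outVert o j := by
  rw [outVert_shift, turn]
  split_ifs with h
  · rw [Nat.add_sub_cancel' h]
  · rw [show i + (j + Fintype.card V - i) = j + Fintype.card V by omega, outVert_add_card hG ho]

/-- The outer cycle, opened up at any place, is an unfolding if the conditions on the root and the
leaves hold. -/
noncomputable def unfolding (hG : Biconnected G) (ho : E.faceOf o = E.outer) {N : ℕ} (hN0 : 0 < N)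
    (hN : N < Fintype.card V) (hN1 : N = 1 → Fintype.card V = 2)
    (hroot : G.Adj (E.outVert o 0) (E.outVert o N))
    (hleaf : ∀ {i j}, N < i → i < Fintype.card V → j < Fintype.card V →
      G.Adj (E.outVert o i) (E.outVert o j) →
        j = i + 1 ∨ i = j + 1 ∨ i + 1 = Fintype.card V ∧ j = 0)
    (hchordless : N + 1 = Fintype.card V → ∀ {i j}, i < j → j < Fintype.card V →
      G.Adj (E.outVert o i) (E.outVert o j) → j = i + 1 ∨ i = 0 ∧ j + 1 = Fintype.card V) :
    Unfolding E where
  n := Fintype.card V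
  N := N
  y := E.outVert o
  N_pos := hN0
  N_lt := hN
  n_eq_two := hN1
  inj hi hj := (outVert_bijOn hG ho).2.1 _ hi _ hj
  surj := (outVert_bijOn hG ho).2.2
  noncrossing := not_crossing hG ho
  adj_succ _ := adj_outVert _
  adj_last := by
    have := adj_outVert (E := E) (o := o) (Fintype.card V - 1)
    rw [Nat.sub_add_cancel (by omega), outVert_card hG ho] at this
    exact this.symm
  adj_root := hroot
  leaf := hleaf
  chordless := hchordless
  outer := by
    intro d hd
    obtain ⟨i, hi, h⟩ := (outVert_bijOn hG ho).2.2 d.fst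
    obtain rfl := eq_of_faceOf_eq_outer hG h (faceOf_outDart ho i) hd
    rcases i with _ | i
    · exact Or.inr ⟨rfl, snd_eq_outVert hG ho⟩
    · exact Or.inl ⟨i, hi, rfl, outDart_succ_snd i⟩
  rot_snd := by
    intro i j k d hi hj hk hdi hdj hdk
    have ho' := faceOf_outDart ho i
    have hlt : ∀ {j}, j < Fintype.card V → turn (Fintype.card V) i j < Fintype.card V := by
      intro j hj
      unfold turn
      split_ifs <;> omega
    by_cases hne : E.rot d = E.outDart o i
    · left
      rw [hne] at hdk
      rcases i with _ | i
      · right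
        rw [outDart, Function.iterate_zero, id_eq, snd_eq_outVert hG ho,
          outVert_inj hG ho (by omega) hk] at hdk
        omega
      · rw [outDart_succ_snd, outVert_inj hG ho (by omega) hk] at hdk
        omega
    · right
      refine snd_rot_lt hG ho' (f := d) hdi (hlt hj) ?_ (hlt hk) ?_ hne
      · rw [outVert_turn hG ho hi, hdj]
      · rw [outVert_turn hG ho hi, hdk]

/-- One opens up the outer cycle at the far end of a chord that cuts off as few vertices as
possible. -/
theorem exists_unfolding (hG : Biconnected G) (E : OuterplaneEmbedding G) :
    Nonempty (Unfolding E) := by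
  obtain ⟨v⟩ := hG.1.nonempty
  obtain ⟨o, -, ho⟩ := E.mem_outer v
  have hcard : 2 ≤ Fintype.card V := by
    have : Nontrivial V := ⟨_, _, o.adj.ne⟩
    exact Fintype.one_lt_card
  -- without a chord the root edge belongs to the outer cycle, and there are no leaves
  by_cases hex : ∃ k, 2 ≤ k ∧ k + 2 ≤ Fintype.card V ∧
      ∃ o : G.Dart, E.faceOf o = E.outer ∧ G.Adj (E.outVert o 0) (E.outVert o k)
  · obtain ⟨h2, hkn, o, ho, hadj⟩ := Nat.find_spec hex
    have hmin := fun m => Nat.find_min hex (m := m)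
    generalize Nat.find hex = k at *
    have hshort : ∀ b c, b < c → c < b + k → c < Fintype.card V →
        G.Adj (E.outVert o b) (E.outVert o c) → c = b + 1 := by
      intro b c hbc hcb hc h
      by_contra hne
      refine hmin (c - b) (by omega)
        ⟨by omega, by omega, E.outDart o b, faceOf_outDart ho b, ?_⟩
      rwa [outVert_shift, outVert_shift, add_zero, Nat.add_sub_cancel' hbc.le]
    refine ⟨unfolding hG (faceOf_outDart ho k) (N := Fintype.card V - k) (by omega) (by omega)
      (by omega) ?_ ?_ fun h => by omega⟩
    · rw [outVert_shift, outVert_shift, add_zero, Nat.add_sub_cancel' (by omega),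
        outVert_card hG ho]
      exact hadj.symm
    · intro i j hNi hi hj h
      have hy : ∀ c, Fintype.card V ≤ k + c →
          E.outVert o (k + c) = E.outVert o (k + c - Fintype.card V) := fun c hc => by
        rw [← outVert_add_card hG ho (k + c - _), Nat.sub_add_cancel hc]
      rw [outVert_shift, outVert_shift, hy i (by omega)] at h
      by_cases hkj : k + j < Fintype.card V
      · rcases Nat.eq_zero_or_pos j with rfl | hj0
        · have := hshort _ _ (by omega) (by omega) hkj h
          omega
        · exact absurd h (not_adj_of_chord hG ho (by omega) (by omega) (by omega) hkj hadj)
      · rw [hy j (by omega)] at h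
        rcases lt_trichotomy i j with hij | rfl | hij
        · have := hshort _ _ (by omega) (by omega) (by omega) h
          omega
        · exact absurd rfl h.ne
        · have := hshort _ _ (by omega) (by omega) (by omega) h.symm
          omega
  · refine ⟨unfolding hG ho (N := Fintype.card V - 1) (by omega) (by omega) (by omega)
      ?_ (fun h1 h2 => by omega) ?_⟩
    · have := adj_outVert (E := E) (o := o) (Fintype.card V - 1)
      rw [Nat.sub_add_cancel (by omega), outVert_card hG ho] at this
      exact this.symm
    · intro _ i j hij hj h
      by_contra hne
      push Not at hne hex
      rcases Nat.lt_or_ge (Fintype.card V) (j - i + 2) with h1 | h1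
      · omega
      · refine hex (j - i) (by omega) h1 (E.outDart o i) (faceOf_outDart ho i) ?_
        rwa [outVert_shift, outVert_shift, add_zero, Nat.add_sub_cancel' hij.le]

end OuterplaneEmbedding

end

end SmoothOrthogonal


/-! ### The disc and the ports of an unfolding -/

namespace SmoothOrthogonal

section
open Finset
open scoped Classical

variable {V : Type*} {G : SimpleGraph V} [Fintype V] {E : OuterplaneEmbedding G}

namespace Unfolding

variable (U : Unfolding E) {i j k : ℕ}

theorem card_adj_le (hdeg : ∀ v, #{w | G.Adj v w} ≤ 4) (k : ℕ) :
    #{j ∈ range U.n | G.Adj (U.y k) (U.y j)} ≤ 4 := by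
  refine (card_le_card_of_injOn U.y (fun j hj => ?_) fun i hi j hj h => ?_).trans (hdeg (U.y k))
  · simp only [coe_filter, mem_range, Set.mem_ofPred_eq] at hj
    simpa using hj.2
  · simp only [coe_filter, mem_range, Set.mem_ofPred_eq] at hi hj
    exact U.inj hi.1 hj.1 h

/-- The vertices that are not leaves, as a disc with chords above the root edge. -/
def disc (hdeg : ∀ v, #{w | G.Adj v w} ≤ 4) : ChordDisc where
  N := U.N
  E i j := i < j ∧ j ≤ U.N ∧ G.Adj (U.y i) (U.y j)
  lt h := h.1
  le h := h.2.1
  succ {i} h := ⟨by omega, h, U.adj_succ (by have := U.N_lt; omega)⟩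
  root := ⟨U.N_pos, le_rfl, U.adj_root⟩
  noncrossing h1 h2 h3 h4 h5 :=
    U.noncrossing h3 h4 h5 (h2.2.1.trans_lt U.N_lt) h1.2.2 h2.2.2
  degree_le k hk0 hkN := by
    have hN := U.N_lt
    rw [← card_union_of_disjoint]
    · refine (card_le_card fun j hj => ?_).trans (U.card_adj_le hdeg k)
      simp only [mem_union, mem_filter, mem_range, mem_Ioc] at hj ⊢
      rcases hj with hj | hj
      · exact ⟨by omega, hj.2.2.2.symm⟩
      · exact ⟨by omega, hj.2.2.2⟩
    · rw [disjoint_left]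
      intro j hj hj'
      simp only [mem_filter, mem_range, mem_Ioc] at hj hj'
      omega
  root_left := by
    have hN := U.N_lt
    have hN0 := U.N_pos
    by_cases h : U.N + 1 = U.n
    · refine (card_le_card (t := {1}) fun j hj => ?_).trans (by simp)
      simp only [mem_filter, mem_Ioo, mem_singleton] at hj ⊢
      have := U.chordless h hj.2.1 (by omega) hj.2.2.2
      omega
    · have h1 : insert U.N (insert (U.n - 1) {r ∈ Ioo 0 U.N | 0 < r ∧ r ≤ U.N ∧
          G.Adj (U.y 0) (U.y r)}) ⊆ {j ∈ range U.n | G.Adj (U.y 0) (U.y j)} := by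
        intro j hj
        simp only [mem_insert, mem_filter, mem_range, mem_Ioo] at hj ⊢
        rcases hj with rfl | rfl | hj
        · exact ⟨hN, U.adj_root⟩
        · exact ⟨by omega, U.adj_last⟩
        · exact ⟨by omega, hj.2.2.2⟩
      have h2 := (card_le_card h1).trans (U.card_adj_le hdeg 0)
      rw [card_insert_of_notMem, card_insert_of_notMem] at h2
      · convert Nat.le_of_add_le_add_right (b := 2) h2
      · simp only [mem_filter, mem_Ioo]
        omega
      · simp only [mem_insert, mem_filter, mem_Ioo]
        omega
  root_right := by
    have hN := U.N_lt
    have hN0 := U.N_pos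
    by_cases h : U.N + 1 = U.n
    · refine (card_le_card (t := {U.N - 1}) fun j hj => ?_).trans (by simp)
      simp only [mem_filter, mem_Ioo, mem_singleton] at hj ⊢
      have := U.chordless h hj.2.1 (by omega) hj.2.2.2
      omega
    · have h1 : insert 0 (insert (U.N + 1) {l ∈ Ioo 0 U.N | l < U.N ∧ U.N ≤ U.N ∧
          G.Adj (U.y l) (U.y U.N)}) ⊆ {j ∈ range U.n | G.Adj (U.y U.N) (U.y j)} := by
        intro j hj
        simp only [mem_insert, mem_filter, mem_range, mem_Ioo] at hj ⊢
        rcases hj with rfl | rfl | hj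
        · exact ⟨by omega, U.adj_root.symm⟩
        · exact ⟨by omega, U.adj_succ (by omega)⟩
        · exact ⟨by omega, hj.2.2.2.symm⟩
      have h2 := (card_le_card h1).trans (U.card_adj_le hdeg U.N)
      rw [card_insert_of_notMem, card_insert_of_notMem] at h2
      · convert Nat.le_of_add_le_add_right (b := 2) h2
      · simp only [mem_filter, mem_Ioo]
        omega
      · simp only [mem_insert, mem_filter, mem_Ioo]
        omega

end Unfolding

namespace ChordDisc

variable {D : ChordDisc} {i j k : ℕ}

theorem outL_le (h : D.E i j) : D.outL i j ≤ 2 := by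
  rcases framed_of_edge h with h | h | h | h | h <;> rw [h.outL] <;> omega

theorem outR_le (h : D.E i j) : D.outR i j ≤ 2 := by
  rcases framed_of_edge h with h | h | h | h | h <;> rw [h.outR] <;> omega

theorem outL_lt (h : D.E i k) (hjk : j < k) : D.outL i k < D.outL i j := by
  refine card_lt_card ⟨fun r hr => ?_, fun hsub => ?_⟩
  · simp only [mem_filter, mem_Ioc] at hr ⊢
    exact ⟨by omega, hr.2⟩
  · have : k ∈ {r ∈ Ioc k D.N | D.E i r} :=
      hsub (mem_filter.2 ⟨mem_Ioc.2 ⟨hjk, D.le h⟩, h⟩)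
    simp at this

theorem outR_lt (h : D.E k i) (hkj : k < j) : D.outR k i < D.outR j i := by
  refine card_lt_card ⟨fun r hr => ?_, fun hsub => ?_⟩
  · simp only [mem_filter, mem_range] at hr ⊢
    exact ⟨by omega, hr.2⟩
  · have : k ∈ {l ∈ range k | D.E l i} := hsub (mem_filter.2 ⟨mem_range.2 hkj, h⟩)
    simp at this

theorem outL_add_outR_le (h : D.E i k) (h' : D.E j i) : D.outL i k + D.outR j i ≤ 2 := by
  have h1 := D.lt h
  have h2 := D.le h
  have h3 := D.lt h'
  have h4 := D.degree_le i (by omega) (by omega)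
  have h5 := outL_lt h h1
  have h6 := outR_lt h' h3
  unfold outL outR at *
  omega

end ChordDisc

namespace Unfolding

variable (U : Unfolding E) (hdeg : ∀ v, #{w | G.Adj v w} ≤ 4) {i j k : ℕ}

/-- A lift to the integers of the port at `i` of the edge to `j`, such that the order of the lifts
is the counterclockwise order from the outer face on. -/
noncomputable def key (i j : ℕ) : ℕ :=
  if U.N < i then if j + 1 = i then if j = U.N then 4 else 3 else 6
  else if j < i then 3 - (U.disc hdeg).outR j i
  else if j ≤ U.N then 4 + (U.disc hdeg).outL i j
  else if i = 0 then 3 else 4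

variable {U hdeg}

theorem key_lt_key (hi : i < U.n) (hj : j < U.n) (hk : k < U.n) (hij : G.Adj (U.y i) (U.y j))
    (hik : G.Adj (U.y i) (U.y k)) (h : turn U.n i k < turn U.n i j) :
    U.key hdeg i j < U.key hdeg i k := by
  have hN0 := U.N_pos
  have hN := U.N_lt
  have hji : j ≠ i := by
    rintro rfl
    exact hij.ne rfl
  have hki : k ≠ i := by
    rintro rfl
    exact hik.ne rfl
  unfold turn at h
  unfold key
  by_cases hiN : U.N < i
  · have h1 := U.leaf hiN hi hj hij
    have h2 := U.leaf hiN hi hk hik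
    rw [if_pos hiN, if_pos hiN]
    split_ifs at * <;> omega
  rw [if_neg hiN, if_neg hiN]
  have hEj : j < i → (U.disc hdeg).E j i := fun h => ⟨h, by omega, hij.symm⟩
  have hEk : k < i → (U.disc hdeg).E k i := fun h => ⟨h, by omega, hik.symm⟩
  rcases lt_or_gt_of_ne hji with hji | hji
  · have hji' : ¬ i ≤ j := by omega
    rw [if_neg hji'] at h
    rw [if_pos hji]
    by_cases hki : k < i
    · have hki' : ¬ i ≤ k := by omega
      rw [if_neg hki'] at h
      rw [if_pos hki]
      have h1 := ChordDisc.outR_lt (j := j) (hEk hki) (by omega)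
      have h2 := ChordDisc.outR_le (hEj hji)
      omega
    · rw [if_neg hki]
      split_ifs <;> omega
  · rw [if_pos hji.le] at h
    have hki : i < k := by
      split_ifs at h <;> omega
    rw [if_pos hki.le] at h
    rw [if_neg hji.not_gt, if_neg hki.not_gt]
    have hc1 := edge_cases hji hj hij
    have hc2 := edge_cases hki hk hik
    by_cases hjN : j ≤ U.N
    · rw [if_pos hjN, if_pos (by omega)]
      have h1 := ChordDisc.outL_lt (D := U.disc hdeg) (k := j) (j := k) ⟨hji, hjN, hij⟩ (by omega)
      omega
    · rw [if_neg hjN]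
      by_cases hkN : k ≤ U.N
      · rw [if_pos hkN]
        split_ifs <;> omega
      · rw [if_neg hkN]
        omega

/-- The ports at a vertex span less than a full turn, because of the degree bound. -/
theorem key_lt_add (hi : i < U.n) (hk : k < U.n) (hij : G.Adj (U.y i) (U.y j))
    (hik : G.Adj (U.y i) (U.y k)) : U.key hdeg i k < U.key hdeg i j + 4 := by
  have hN0 := U.N_pos
  have hN := U.N_lt
  have hji : j ≠ i := by
    rintro rfl
    exact hij.ne rfl
  have hki : k ≠ i := by
    rintro rfl
    exact hik.ne rfl
  unfold key
  by_cases hiN : U.N < i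
  · rw [if_pos hiN, if_pos hiN]
    split_ifs <;> omega
  rw [if_neg hiN, if_neg hiN]
  have hRj : j < i → (U.disc hdeg).outR j i ≤ 2 := fun h =>
    ChordDisc.outR_le ⟨h, by omega, hij.symm⟩
  have hLk : i < k → k ≤ U.N → (U.disc hdeg).outL i k ≤ 2 := fun h h' =>
    ChordDisc.outL_le ⟨h, by omega, hik⟩
  have hc1 : i < k → _ := fun h => edge_cases h hk hik
  by_cases hjlt : j < i
  · rw [if_pos hjlt]
    have := hRj hjlt
    by_cases hklt : k < i
    · rw [if_pos hklt]
      omega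
    · rw [if_neg hklt]
      by_cases hkN : k ≤ U.N
      · rw [if_pos hkN]
        have := ChordDisc.outL_add_outR_le (D := U.disc hdeg) (i := i) (k := k) (j := j)
          ⟨by omega, hkN, hik⟩ ⟨hjlt, by omega, hij.symm⟩
        omega
      · rw [if_neg hkN]
        split_ifs <;> omega
  · rw [if_neg hjlt]
    by_cases hklt : k < i
    · rw [if_pos hklt]
      split_ifs <;> omega
    · rw [if_neg hklt]
      by_cases hkN : k ≤ U.N
      · rw [if_pos hkN]
        have := hLk (by omega) hkN
        split_ifs <;> omega
      · rw [if_neg hkN]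
        split_ifs <;> omega

end Unfolding

end

end SmoothOrthogonal


/-! ### Adding the leaves -/

namespace SmoothOrthogonal

open Real Topology Filter Stroke

theorem Stroke.Joins.reverse {s : Stroke} {P Q : ℝ × ℝ} {a b : ZMod 4} (h : s.Joins P Q a b) :
    s.reverse.Joins Q P b a where
  nondegenerate := h.nondegenerate.reverse
  start_eq := by rw [reverse_point, sub_zero, h.end_eq]
  end_eq := by rw [reverse_point, sub_self, h.start_eq]
  port_start := h.port_end
  port_end := by
    rw [reverse_reverse]
    exact h.port_start

/-- The semicircle from `(1, 0)` to `(0, -1)`, in rotated coordinates, on the far side from the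
origin. -/
noncomputable def halfCircle : Stroke := arc (toC (1 / 2, -(1 / 2))) (1 / 2) (π / 2) (-(π / 2))

theorem halfCircle_joins : halfCircle.Joins (1, 0) (0, -1) 0 0 where
  nondegenerate := by
    have := pi_pos
    refine ⟨by norm_num, by linarith, ?_⟩
    rw [abs_of_neg (by linarith)]
    linarith
  start_eq := by
    simp only [halfCircle, point, zero_mul, add_zero]
    push_cast
    rw [Complex.exp_pi_div_two_mul_I]
    apply Complex.ext <;> simp [toC]
  end_eq := by
    simp only [halfCircle, point, one_mul, add_sub_cancel]
    rw [exp_neg_pi_div_two_mul_I]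
    apply Complex.ext
    · simp [toC]
    · simp [toC]
      norm_num
  port_start := by
    refine ⟨π / 2, by positivity, ?_⟩
    simp only [halfCircle, tangent, zero_mul, add_zero, portDir_zero]
    push_cast
    rw [Complex.exp_pi_div_two_mul_I]
    linear_combination (-(π : ℂ) / 2) * Complex.I_mul_I
  port_end := by
    refine ⟨π / 2, by positivity, ?_⟩
    simp only [halfCircle, reverse, tangent, zero_mul, add_zero, portDir_zero]
    rw [exp_neg_pi_div_two_mul_I]
    push_cast
    linear_combination (-(π : ℂ) / 2) * Complex.I_mul_I

theorem rot_side_halfCircle (t ε : ℝ) : rot (halfCircle.side t ε) =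
    (1 / 2 + (1 - ε * π) * (1 / 2) * (sin (t * π) + cos (t * π)),
      -(1 / 2) + (1 - ε * π) * (1 / 2) * (cos (t * π) - sin (t * π))) := by
  rw [halfCircle, rot_side_arc]
  have : π / 2 + t * (-(π / 2) - π / 2) = π / 2 - t * π := by ring
  rw [this, cos_pi_div_two_sub, sin_pi_div_two_sub]
  ext <;> simp only <;> ring

theorem halfCircle_mem_circle (t ε : ℝ) : ((rot (halfCircle.side t ε)).1 - 1 / 2) ^ 2 +
    ((rot (halfCircle.side t ε)).2 + 1 / 2) ^ 2 = (1 - ε * π) ^ 2 / 2 := by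
  rw [rot_side_halfCircle]
  linear_combination (1 - ε * π) ^ 2 / 2 * sin_sq_add_cos_sq (t * π)

theorem halfCircle_bounds {t : ℝ} (h0 : 0 < t) (h1 : t < 1) :
    (rot (halfCircle.point t)).2 < (rot (halfCircle.point t)).1 - 1 ∧
      (rot (halfCircle.point t)).2 < 0 := by
  have hπ := pi_pos
  have h2 : 0 < t * π := by positivity
  have hs := sin_pos_of_pos_of_lt_pi h2 (by nlinarith)
  rw [← side_zero, rot_side_halfCircle]
  simp only [zero_mul, sub_zero, one_mul]
  exact ⟨by linarith, by linarith [cos_le_one (t * π)]⟩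

/-- A quarter circle to the left of a rising edge. -/
theorem curve_rising_bounds {P Q : ℝ × ℝ} (hx : P.1 = Q.1) (h : P.2 < Q.2) {t : ℝ} (h0 : 0 < t)
    (h1 : t < 1) : (rot ((curve P Q).point t)).1 < P.1 ∧ P.2 < (rot ((curve P Q).point t)).2 ∧
      (rot ((curve P Q).point t)).2 < Q.2 := by
  obtain ⟨hs, hc, hsc, hb, -⟩ := sin_cos_bounds h0 h1
  rw [← side_zero, rot_side_curve_rising hx h]
  simp only [zero_mul, sub_zero, one_mul]
  refine ⟨?_, ?_, ?_⟩ <;> nlinarith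

theorem continuous_toC : Continuous toC := by
  have : toC = fun p : ℝ × ℝ =>
      (((p.1 - p.2) / 2 : ℝ) : ℂ) + ((p.1 + p.2) / 2 : ℝ) * Complex.I := funext fun p => toC_eq _ _
  rw [this]
  fun_prop

/-- The norm on `ℝ × ℝ` is the maximum norm. -/
theorem norm_rot_le (z : ℂ) : ‖rot z‖ ≤ 2 * ‖z‖ := by
  have h1 := Complex.abs_re_le_norm z
  have h2 := Complex.abs_im_le_norm z
  rw [Prod.norm_def, max_le_iff, Real.norm_eq_abs, Real.norm_eq_abs]
  constructor
  · exact (abs_add_le _ _).trans (by linarith)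
  · exact (abs_sub _ _).trans (by linarith)

section
open Finset
open scoped Classical

variable {V : Type*} {G : SimpleGraph V} {E : OuterplaneEmbedding G}

namespace Unfolding

variable (U : Unfolding E) {i j : ℕ}

/-- The pair is an edge. -/
structure IsEdge (i j : ℕ) : Prop where
  lt : i < j
  lt_n : j < U.n
  adj : G.Adj (U.y i) (U.y j)

/-- The ordinates of the leaves, which are evenly spaced on a vertical line from `-1` up to, but not
including, the vertex `0` at the origin. -/
noncomputable def height (i : ℕ) : ℝ := ((i : ℝ) - U.n) / ((U.n : ℝ) - 1 - U.N)

variable {U}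

theorem height_lt (hN : U.N + 1 < U.n) (h : i < j) : U.height i < U.height j := by
  have h1 : (U.N : ℝ) + 1 < U.n := by exact_mod_cast hN
  have h2 : (i : ℝ) < j := by exact_mod_cast h
  unfold height
  gcongr
  linarith

theorem height_n : U.height U.n = 0 := by simp [height]

theorem height_first (hN : U.N + 1 < U.n) : U.height (U.N + 1) = -1 := by
  have h1 : (U.N : ℝ) + 1 < U.n := by exact_mod_cast hN
  have : (U.n : ℝ) - 1 - U.N ≠ 0 := by linarith
  rw [height]
  push_cast
  field_simp
  ring

theorem height_bounds (h : U.N < i) (hi : i < U.n) : -1 ≤ U.height i ∧ U.height i < 0 := by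
  have hN : U.N + 1 < U.n := by omega
  refine ⟨?_, height_n (U := U) ▸ height_lt hN hi⟩
  rw [← height_first hN]
  rcases (Nat.succ_le_of_lt h).eq_or_lt with h | h
  · rw [← h]
  · exact (height_lt hN h).le

theorem height_le_zero {c : ℕ} (hc : U.N < c) (hcn : c < U.n) :
    -1 ≤ U.height c ∧ U.height (c + 1) ≤ 0 := by
  refine ⟨(height_bounds hc hcn).1, ?_⟩
  rcases (Nat.succ_le_of_lt hcn).eq_or_lt with h | h
  · rw [show c + 1 = U.n from h, height_n]
  · exact (height_bounds (by omega) h).2.le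

end Unfolding

namespace ChordDisc

variable {D : ChordDisc} {i k l : ℕ} {p : ℝ × ℝ}

theorem zone_bounds (h : D.E k l) (hz : D.Zone k l p) :
    p.1 - 1 < p.2 ∧ (0 < p.2 ∨ 0 < p.1 ∧ k = 0 ∧ l = D.N) := by
  have h1 := D.lt h
  have h2 := D.le h
  by_cases hkl : k = 0 ∧ l = D.N
  · rw [hkl.1, hkl.2, isA_root.zone_iff, pos_zero, pos_N] at hz
    exact ⟨by simp only at hz; linarith, Or.inr ⟨hz.1, hkl⟩⟩
  · have := reg_of_under D.root (Or.inr h) ⟨by omega, by omega, by omega, by omega, hkl⟩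
      (by norm_num) le_rfl (show D.Cell (1 / 2) k l p by
        rw [Cell, if_neg h1.ne]
        exact Or.inl hz)
    rw [isA_root.reg_iff, pos_zero, pos_N] at this
    simp only at this
    refine ⟨?_, Or.inl this.2.1⟩
    rcases this.2.2.2 with h | h <;> linarith

theorem pos_bounds (h : i ≤ D.N) : (D.pos i).1 - 1 ≤ (D.pos i).2 ∧ 0 ≤ (D.pos i).2 := by
  by_cases h0 : i = 0
  · rw [h0, pos_zero]
    norm_num
  by_cases hN : i = D.N
  · rw [hN, pos_N]
    norm_num
  have := reg_of_under D.root (Or.inl rfl) ⟨by omega, by omega, by omega, by omega, by omega⟩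
    (by norm_num) le_rfl (show D.Cell (1 / 2) i i (D.pos i) by rw [Cell, if_pos rfl])
  rw [isA_root.reg_iff, pos_zero, pos_N] at this
  simp only at this
  refine ⟨?_, this.2.1.le⟩
  rcases this.2.2.2 with h | h <;> linarith

theorem pos_ne (h : i ≤ D.N) (hk : k ≤ D.N) (hne : i ≠ k) : D.pos i ≠ D.pos k := fun heq =>
  cell_disjoint (c := 1 / 2) (p := D.pos i) (Or.inl ⟨rfl, h⟩) (Or.inl ⟨rfl, hk⟩)
    (fun h => hne h.1) (fun h => by obtain ⟨h1, h2, h3, h4, -⟩ := h; omega)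
    (fun h => by obtain ⟨h1, h2, h3, h4, -⟩ := h; omega) (by norm_num) le_rfl
    (by rw [Cell, if_pos rfl]) (by rw [Cell, if_pos rfl, heq])

theorem not_zone_pos (h : D.E k l) (hi : i ≤ D.N) : ¬ D.Zone k l (D.pos i) := by
  intro hz
  have h1 := D.lt h
  have hcell : D.Cell (1 / 2) k l (D.pos i) := by
    rw [Cell, if_neg h1.ne]
    exact Or.inl hz
  by_cases hki : i = k
  · exact not_cell_pos_left h (hki ▸ hcell)
  by_cases hli : i = l
  · exact not_cell_pos_right h (hli ▸ hcell)
  have hcell' : D.Cell (1 / 2) i i (D.pos i) := by rw [Cell, if_pos rfl]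
  by_cases hu : Under i i k l
  · exact not_reg_of_zone h hz (reg_of_under h (Or.inl rfl) hu (by norm_num) le_rfl hcell')
  · exact cell_disjoint (Or.inl ⟨rfl, hi⟩) (Or.inr h) (fun h => hki h.1) hu
      (fun h => by obtain ⟨h1, h2, h3, h4, -⟩ := h; omega) (by norm_num) le_rfl hcell' hcell

theorem zone_disjoint {k' l' : ℕ} (h : D.E k l) (h' : D.E k' l') (hz : D.Zone k l p)
    (hz' : D.Zone k' l' p) : k = k' ∧ l = l' := by
  by_contra hne
  have hcell : ∀ {k l}, D.E k l → D.Zone k l p → D.Cell (1 / 2) k l p := fun h hz => by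
    rw [Cell, if_neg (D.lt h).ne]
    exact Or.inl hz
  by_cases hu : Under k l k' l'
  · exact not_reg_of_zone h' hz'
      (reg_of_under h' (Or.inr h) hu (by norm_num) le_rfl (hcell h hz))
  by_cases hu' : Under k' l' k l
  · exact not_reg_of_zone h hz
      (reg_of_under h (Or.inr h') hu' (by norm_num) le_rfl (hcell h' hz'))
  · exact cell_disjoint (Or.inr h) (Or.inr h') hne hu hu' (by norm_num) le_rfl (hcell h hz)
      (hcell h' hz')

end ChordDisc

variable [Fintype V]

namespace Unfolding

variable (U : Unfolding E) (hdeg : ∀ v, #{w | G.Adj v w} ≤ 4) {i j k l : ℕ} {p : ℝ × ℝ} {t : ℝ}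

/-- The position of the vertices in rotated coordinates, including the leaves. -/
noncomputable def loc (i : ℕ) : ℝ × ℝ :=
  if i ≤ U.N then (U.disc hdeg).pos i else (0, U.height i)

/-- The stroke of the edge `(i, j)`, where `i < j`. -/
noncomputable def line (i j : ℕ) : Stroke :=
  if j ≤ U.N then curve ((U.disc hdeg).pos i) ((U.disc hdeg).pos j)
  else if i = 0 then (curve (0, U.height (U.n - 1)) (0, 0)).reverse
  else if i = U.N then halfCircle
  else curve (0, U.height i) (0, U.height j)

/-- A set that contains the interior of the stroke of the edge `(i, j)`, where `i < j`. -/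
def Zone (i j : ℕ) (p : ℝ × ℝ) : Prop :=
  if j ≤ U.N then (U.disc hdeg).Zone i j p
  else if i = 0 then p.1 < 0 ∧ U.height (U.n - 1) < p.2 ∧ p.2 < 0
  else if i = U.N then p.2 < p.1 - 1 ∧ p.2 < 0
  else p.1 < 0 ∧ U.height i < p.2 ∧ p.2 < U.height j

variable {U hdeg}

theorem loc_of_le (h : i ≤ U.N) : U.loc hdeg i = (U.disc hdeg).pos i := if_pos h

theorem loc_of_lt (h : U.N < i) : U.loc hdeg i = (0, U.height i) := if_neg (by omega)

theorem loc_zero : U.loc hdeg 0 = (0, 0) := by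
  rw [loc_of_le (Nat.zero_le _), ChordDisc.pos_zero]

theorem loc_N : U.loc hdeg U.N = (1, 0) := by
  rw [loc_of_le le_rfl]
  exact ChordDisc.pos_N _

theorem loc_injOn (hi : i < U.n) (hj : j < U.n) (h : U.loc hdeg i = U.loc hdeg j) : i = j := by
  by_contra hne
  have hb : ∀ {i j}, i ≤ U.N → U.N < j → j < U.n → U.loc hdeg i ≠ U.loc hdeg j := by
    intro i j hi hj hjn h
    rw [loc_of_le hi, loc_of_lt hj] at h
    have h1 := (ChordDisc.pos_bounds (D := U.disc hdeg) hi).2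
    rw [h] at h1
    have := height_bounds hj hjn
    simp only at h1
    linarith
  by_cases hiN : i ≤ U.N
  · by_cases hjN : j ≤ U.N
    · rw [loc_of_le hiN, loc_of_le hjN] at h
      exact ChordDisc.pos_ne (D := U.disc hdeg) hiN hjN hne h
    · exact hb hiN (by omega) hj h
  · by_cases hjN : j ≤ U.N
    · exact hb hjN (by omega) hi h.symm
    · rw [loc_of_lt (by omega), loc_of_lt (by omega)] at h
      have h1 : U.height i = U.height j := congrArg Prod.snd h
      rcases lt_or_gt_of_ne hne with h2 | h2
      · exact (height_lt (by omega) h2).ne h1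
      · exact (height_lt (by omega) h2).ne' h1

theorem IsEdge.cases (h : U.IsEdge i j) :
    (j ≤ U.N ∧ (U.disc hdeg).E i j) ∨ (U.N + 1 < U.n ∧ ¬ j ≤ U.N ∧
      (i = 0 ∧ j = U.n - 1 ∨ i ≠ 0 ∧ i = U.N ∧ j = U.N + 1 ∨
        i ≠ 0 ∧ i ≠ U.N ∧ U.N < i ∧ j = i + 1)) := by
  have h1 := h.lt
  have h2 := h.lt_n
  have h3 := U.N_pos
  have := edge_cases h.lt h.lt_n h.adj
  by_cases hj : j ≤ U.N
  · exact Or.inl ⟨hj, h.lt, hj, h.adj⟩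
  · right
    refine ⟨by omega, hj, ?_⟩
    omega

/-- The stroke of an edge has the ends and the ports that it should have. -/
theorem line_joins (h : U.IsEdge i j) : (U.line hdeg i j).Joins (U.loc hdeg i) (U.loc hdeg j)
    (U.key hdeg i j) (U.key hdeg j i) := by
  have hN0 := U.N_pos
  have h1 := h.lt
  have h2 := h.lt_n
  rcases h.cases (hdeg := hdeg) with
    ⟨hj, hE⟩ | ⟨hN, hj, ⟨hi, hjn⟩ | ⟨hi, hiN, hjn⟩ | ⟨hi, hiN, hNi, hjn⟩⟩
  · rw [line, if_pos hj, loc_of_le hj, loc_of_le (by omega), key, if_neg (by omega),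
      if_neg (by omega), if_pos hj, key, if_neg (by omega), if_pos h1]
    have h3 := ChordDisc.outR_le hE
    rw [Nat.cast_sub (by omega), Nat.cast_add]
    have : ((4 : ℕ) : ZMod 4) = 0 := rfl
    rw [this, zero_add]
    exact ChordDisc.joins hE
  · rw [line, if_neg hj, if_pos hi, hi, loc_zero, loc_of_lt (U := U) (i := j) (by omega), hjn, key,
      if_neg (by omega), if_neg (by omega), if_neg (by omega), if_pos rfl, key, if_pos (by omega),
      if_neg (by omega)]
    exact (joins_rising (P := (0, U.height (U.n - 1))) (Q := (0, 0)) rfl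
      (height_bounds (by omega) (by omega)).2).reverse
  · rw [line, if_neg hj, if_neg hi, if_pos hiN, hiN, loc_N,
      loc_of_lt (U := U) (i := j) (by omega), hjn,
      height_first hN, key, if_neg (by omega), if_neg (by omega), if_neg (by omega),
      if_neg (by omega), key, if_pos (by omega), if_pos rfl, if_pos rfl]
    exact halfCircle_joins
  · rw [line, if_neg hj, if_neg hi, if_neg hiN, loc_of_lt (U := U) (i := i) (by omega),
      loc_of_lt (U := U) (i := j) (by omega),
      key, if_pos hNi, if_neg (by omega), key, if_pos (by omega), if_pos (by omega),
      if_neg (by omega)]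
    exact joins_rising (P := (0, U.height i)) (Q := (0, U.height j)) rfl (height_lt hN h1)

theorem line_zone (h : U.IsEdge i j) (h0 : 0 < t) (h1 : t < 1) :
    U.Zone hdeg i j (rot ((U.line hdeg i j).point t)) := by
  have hlt := h.lt
  rcases h.cases (hdeg := hdeg) with
    ⟨hj, hE⟩ | ⟨hN, hj, ⟨hi, hjn⟩ | ⟨hi, hiN, hjn⟩ | ⟨hi, hiN, hNi, hjn⟩⟩
  · rw [line, if_pos hj, Zone, if_pos hj]
    exact ChordDisc.zone_point hE h0 h1
  · rw [line, if_neg hj, if_pos hi, Zone, if_neg hj, if_pos hi, reverse_point]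
    exact curve_rising_bounds (P := (0, U.height (U.n - 1))) (Q := (0, 0)) rfl
      (height_bounds (by omega) (by omega)).2 (by linarith) (by linarith)
  · rw [line, if_neg hj, if_neg hi, if_pos hiN, Zone, if_neg hj, if_neg hi, if_pos hiN]
    exact halfCircle_bounds h0 h1
  · rw [line, if_neg hj, if_neg hi, if_neg hiN, Zone, if_neg hj, if_neg hi, if_neg hiN]
    exact curve_rising_bounds (P := (0, U.height i)) (Q := (0, U.height j)) rfl
      (height_lt hN hlt) h0 h1

/-- The zones of the edges at leaves, all at once: a half-plane for the edge at `N`, and a strip to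
the left of the line of leaves for each of the other edges, `c` and `c + 1` being its ends if `0` is
considered as the vertex after the last leaf. -/
theorem IsEdge.zone_cases (h : U.IsEdge i j) (hz : U.Zone hdeg i j p) :
    (j ≤ U.N ∧ (U.disc hdeg).E i j ∧ (U.disc hdeg).Zone i j p) ∨
    (i = U.N ∧ j = U.N + 1 ∧ p.2 < p.1 - 1 ∧ p.2 < 0) ∨
    ∃ c, U.N < c ∧ c < U.n ∧ (i = c ∧ j = c + 1 ∨ i = 0 ∧ j = c ∧ c + 1 = U.n) ∧
      p.1 < 0 ∧ U.height c < p.2 ∧ p.2 < U.height (c + 1) := by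
  have hlt := h.lt
  have hn := h.lt_n
  rcases h.cases (hdeg := hdeg) with
    ⟨hj, hE⟩ | ⟨hN, hj, ⟨hi, hjn⟩ | ⟨hi, hiN, hjn⟩ | ⟨hi, hiN, hNi, hjn⟩⟩
  · rw [Zone, if_pos hj] at hz
    exact Or.inl ⟨hj, hE, hz⟩
  · rw [Zone, if_neg hj, if_pos hi] at hz
    refine Or.inr (Or.inr ⟨j, by omega, hn, Or.inr ⟨hi, rfl, by omega⟩, hz.1, hjn ▸ hz.2.1, ?_⟩)
    rw [show j + 1 = U.n by omega, height_n]
    exact hz.2.2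
  · rw [Zone, if_neg hj, if_neg hi, if_pos hiN] at hz
    exact Or.inr (Or.inl ⟨hiN, hjn, hz⟩)
  · rw [Zone, if_neg hj, if_neg hi, if_neg hiN] at hz
    exact Or.inr (Or.inr ⟨i, hNi, by omega, Or.inl ⟨rfl, hjn⟩, hz.1, hz.2.1, hjn ▸ hz.2.2⟩)

theorem not_zone_loc (h : U.IsEdge i j) (hk : k < U.n) : ¬ U.Zone hdeg i j (U.loc hdeg k) := by
  intro hz
  have hpos : ∀ {k}, k ≤ U.N → _ := fun h => ChordDisc.pos_bounds (D := U.disc hdeg) h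
  rcases h.zone_cases hz with ⟨hj, hE, hz⟩ | ⟨-, -, hz⟩ | ⟨c, hc, hcn, -, h1, h2, h3⟩
  · by_cases hkN : k ≤ U.N
    · rw [loc_of_le hkN] at hz
      exact ChordDisc.not_zone_pos hE hkN hz
    · have h1 := ChordDisc.zone_bounds hE hz
      rw [loc_of_lt (by omega)] at h1
      have h2 := height_bounds (U := U) (i := k) (by omega) hk
      simp only at h1
      rcases h1.2 with h3 | h3 <;> linarith
  · by_cases hkN : k ≤ U.N
    · rw [loc_of_le hkN] at hz
      have := hpos hkN
      linarith
    · rw [loc_of_lt (by omega)] at hz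
      have h2 := height_bounds (U := U) (i := k) (by omega) hk
      simp only at hz
      linarith
  · have h4 := height_le_zero hc hcn
    by_cases hkN : k ≤ U.N
    · rw [loc_of_le hkN] at h3
      have := hpos hkN
      linarith
    · rw [loc_of_lt (by omega)] at h1
      simp at h1

theorem zone_disjoint (h : U.IsEdge i j) (h' : U.IsEdge k l) (hz : U.Zone hdeg i j p)
    (hz' : U.Zone hdeg k l p) : i = k ∧ j = l := by
  have hN0 := U.N_pos
  -- a strip and what is not a strip
  have hstrip : ∀ {c}, U.N < c → c < U.n → p.1 < 0 → U.height c < p.2 →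
      p.2 < U.height (c + 1) → -1 < p.2 ∧ p.2 < 0 := by
    intro c hc hcn h1 h2 h3
    have := height_le_zero hc hcn
    exact ⟨by linarith, by linarith⟩
  rcases h.zone_cases hz with ⟨hj, hE, hz⟩ | ⟨hi, hj, hz, hz2⟩ | ⟨c, hc, hcn, hij, h1, h2, h3⟩ <;>
    rcases h'.zone_cases hz' with ⟨hl, hE', hz'⟩ | ⟨hk, hl, hz', hz2'⟩ |
      ⟨c', hc', hcn', hkl, h1', h2', h3'⟩
  · exact ChordDisc.zone_disjoint hE hE' hz hz'
  · have := ChordDisc.zone_bounds hE hz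
    linarith
  · have h4 := ChordDisc.zone_bounds hE hz
    have h5 := hstrip hc' hcn' h1' h2' h3'
    rcases h4.2 with h | h <;> linarith
  · have := ChordDisc.zone_bounds hE' hz'
    linarith
  · exact ⟨hi.trans hk.symm, hj.trans hl.symm⟩
  · have h5 := hstrip hc' hcn' h1' h2' h3'
    linarith
  · have h4 := ChordDisc.zone_bounds hE' hz'
    have h5 := hstrip hc hcn h1 h2 h3
    rcases h4.2 with h | h <;> linarith
  · have h5 := hstrip hc hcn h1 h2 h3
    linarith
  · have hcc : c = c' := by
      by_contra hne
      have hle : ∀ {a b}, a < b → U.height (a + 1) ≤ U.height b := by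
        intro a b hab
        rcases (Nat.succ_le_of_lt hab).eq_or_lt with h | h
        · rw [← h]
        · exact (height_lt (by omega) h).le
      rcases lt_or_gt_of_ne hne with h | h
      · have := hle h
        linarith
      · have := hle h
        linarith
    have h4 := h.lt_n
    have h5 := h'.lt_n
    omega

end Unfolding

end

end SmoothOrthogonal


/-! ### Ways to infinity in the presence of leaves -/

namespace SmoothOrthogonal

open Real Topology Filter Stroke

section
open Finset
open scoped Classical

variable {V : Type*} {G : SimpleGraph V} [Fintype V] {E : OuterplaneEmbedding G}

namespace Unfolding

variable (U : Unfolding E) (hdeg : ∀ v, #{w | G.Adj v w} ≤ 4) {i j k l : ℕ} {p w : ℝ × ℝ} {t : ℝ}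

/-- The point does not belong to the drawing. For edges other than `(k, l)` slightly more is
required: the point has to be outside the zone. -/
def Free (k l : ℕ) (w : ℝ × ℝ) : Prop :=
  (∀ i < U.n, w ≠ U.loc hdeg i) ∧
    (∀ i j, U.IsEdge i j → ¬ (i = k ∧ j = l) → ¬ U.Zone hdeg i j w) ∧
      ∀ t ∈ Set.Icc (0 : ℝ) 1, w ≠ rot ((U.line hdeg k l).point t)

/-- The point is connected to infinity by free points. -/
def ReachesInfinity (k l : ℕ) (p : ℝ × ℝ) : Prop :=
  ∃ W : Set (ℝ × ℝ), IsPreconnected W ∧ p ∈ W ∧ (∀ M, ∃ w ∈ W, M < ‖w‖) ∧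
    ∀ w ∈ W, U.Free hdeg k l w

variable {U hdeg}

theorem carrier_cases (h : U.IsEdge i j) {z : ℂ} (hz : z ∈ (U.line hdeg i j).carrier) :
    z = toC (U.loc hdeg i) ∨ z = toC (U.loc hdeg j) ∨ U.Zone hdeg i j (rot z) := by
  obtain ⟨t, ⟨h0, h1⟩, rfl⟩ := hz
  have hj := line_joins h (hdeg := hdeg)
  rcases h0.eq_or_lt with rfl | h0
  · exact Or.inl hj.start_eq
  rcases h1.eq_or_lt with rfl | h1
  · exact Or.inr (Or.inl hj.end_eq)
  · exact Or.inr (Or.inr (line_zone h h0 h1))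

theorem free_of_zone (h : U.IsEdge k l) (hz : U.Zone hdeg k l w)
    (hw : ∀ t ∈ Set.Icc (0 : ℝ) 1, w ≠ rot ((U.line hdeg k l).point t)) : U.Free hdeg k l w := by
  refine ⟨?_, fun i j hij hne hz' => hne (zone_disjoint hij h hz' hz), hw⟩
  rintro i hi rfl
  exact not_zone_loc h hi hz

theorem eventually_reachesInfinity_of_le (h : i + 1 ≤ U.N) (h0 : 0 < t) (h1 : t < 1) :
    ∀ᶠ ε : ℝ in 𝓝[>] 0,
      U.ReachesInfinity hdeg i (i + 1) (rot ((U.line hdeg i (i + 1)).side t (-ε))) := by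
  have hN := U.N_lt
  rw [line, if_pos h]
  have hE : (U.disc hdeg).E i (i + 1) := ⟨by omega, h, U.adj_succ (by omega)⟩
  filter_upwards [ChordDisc.eventually_escapes hE h0 h1] with ε hε
  obtain ⟨W, hW, hp, hunb, hfree⟩ := hε
  refine ⟨W, hW, hp, fun M => ?_, fun w hw => ?_⟩
  · obtain ⟨w, hw, hM⟩ := hunb M
    exact ⟨w, hw, hM.trans_le ((le_abs_self _).trans (norm_snd_le w))⟩
  obtain ⟨h2, ⟨h3, h4⟩, h5⟩ := hfree w hw
  have h2' : ∀ {c}, U.N < c → c < U.n → 0 < w.2 := fun hc hcn => by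
    refine h2.resolve_left fun h => ?_
    have := U.n_eq_two h
    change U.N = 1 at h
    omega
  refine ⟨fun k hk => ?_, fun k l hkl hne hz => ?_, ?_⟩
  · by_cases hkN : k ≤ U.N
    · rw [loc_of_le hkN]
      exact h3 k hkN
    · rintro rfl
      have h6 := h2' (by omega) hk
      rw [loc_of_lt (by omega)] at h6
      exact absurd (height_bounds (by omega) hk).2 h6.not_gt
  · rcases hkl.zone_cases hz with ⟨-, hE, hz⟩ | ⟨hk, hl, -, hz⟩ | ⟨c, hc, hcn, -, -, -, hz⟩
    · exact h4 k l hE hne hz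
    · have h6 := h2' (c := l) (by omega) hkl.lt_n
      linarith
    · have h6 := h2' hc hcn
      have := height_le_zero hc hcn
      linarith
  · rwa [line, if_pos h]

/-- Next to the semicircle one escapes in the direction in which it bulges. -/
theorem eventually_reachesInfinity_halfCircle (h : U.N + 1 < U.n) (h0 : 0 < t) (h1 : t < 1) :
    ∀ᶠ ε : ℝ in 𝓝[>] 0, U.ReachesInfinity hdeg U.N (U.N + 1)
      (rot ((U.line hdeg U.N (U.N + 1)).side t (-ε))) := by
  have hN0 := U.N_pos
  have hedge : U.IsEdge U.N (U.N + 1) := ⟨by omega, h, U.adj_succ h⟩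
  have hline : U.line hdeg U.N (U.N + 1) = halfCircle := by
    rw [line, if_neg (by omega), if_neg (by omega), if_pos rfl]
  rw [hline]
  have hopen : IsOpen {p : ℝ × ℝ | p.2 < p.1 - 1 ∧ p.2 < 0} := by
    refine .and ?_ ?_ <;> exact isOpen_lt (by fun_prop) (by fun_prop)
  filter_upwards [eventually_side hopen (halfCircle_bounds h0 h1), self_mem_nhdsWithin]
    with ε hε hε0
  have hp := halfCircle_mem_circle t (-ε)
  generalize rot (halfCircle.side t (-ε)) = p at *
  obtain ⟨h2, h3⟩ := hε
  refine ⟨(fun u : ℝ => p + u • ((1, -1) : ℝ × ℝ)) '' Set.Ici 0, ?_,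
    ⟨0, Set.self_mem_Ici, by simp⟩, fun M => ?_, ?_⟩
  · exact isPreconnected_Ici.image _ (by fun_prop)
  · refine ⟨_, ⟨|M| + |p.1| + 1, Set.mem_Ici.2 (by positivity), rfl⟩, ?_⟩
    refine lt_of_lt_of_le ?_ ((le_abs_self _).trans
      (norm_fst_le (p + (|M| + |p.1| + 1) • ((1, -1) : ℝ × ℝ))))
    simp only [Prod.fst_add, Prod.smul_fst, smul_eq_mul, mul_one]
    linarith [le_abs_self M, neg_abs_le p.1]
  · rintro _ ⟨u, hu, rfl⟩
    rw [Set.mem_Ici] at hu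
    simp only [Prod.smul_mk, smul_eq_mul, mul_neg, mul_one]
    refine free_of_zone hedge ?_ fun t' _ h => ?_
    · rw [Zone, if_neg (by omega), if_neg (by omega), if_pos rfl]
      simp only [Prod.fst_add, Prod.snd_add]
      constructor <;> linarith
    · have h4 := halfCircle_mem_circle t' 0
      rw [side_zero, ← hline, ← h] at h4
      simp only [Prod.fst_add, Prod.snd_add] at h4
      have h5 : 0 ≤ u * (p.1 - p.2 - 1) := mul_nonneg hu (by linarith)
      have h6 : 0 < ε * π := mul_pos hε0 pi_pos
      nlinarith [sq_nonneg u]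

/-- Next to the edges between leaves one escapes horizontally, in rotated coordinates. -/
theorem eventually_reachesInfinity_strip {a b : ℝ} (hab : a < b) (h : U.IsEdge k l)
    (hz : ∀ w : ℝ × ℝ, w.1 < 0 → a < w.2 → w.2 < b → U.Zone hdeg k l w)
    (hcar : (U.line hdeg k l).carrier = (curve (0, a) (0, b)).carrier)
    (h0 : 0 < t) (h1 : t < 1) :
    ∀ᶠ ε : ℝ in 𝓝[>] 0,
      U.ReachesInfinity hdeg k l (rot ((curve (0, a) (0, b)).side t (-ε))) := by
  have hopen : IsOpen {p : ℝ × ℝ | p.1 < 0 ∧ a < p.2 ∧ p.2 < b} := by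
    refine .and ?_ (.and ?_ ?_) <;> exact isOpen_lt (by fun_prop) (by fun_prop)
  have hcirc := curve_rising_mem_circle (P := (0, a)) (Q := (0, b)) rfl hab
  simp only [zero_add] at hcirc
  filter_upwards [eventually_side hopen
    (curve_rising_bounds (P := (0, a)) (Q := (0, b)) rfl hab h0 h1), eventually_small] with ε hε hε'
  have hp := hcirc t (-ε)
  generalize rot ((curve (0, a) (0, b)).side t (-ε)) = p at *
  obtain ⟨h2, h3, h4⟩ := hε
  refine ⟨Set.Iic p.1 ×ˢ {p.2}, isPreconnected_Iic.prod isPreconnected_singleton,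
    ⟨Set.self_mem_Iic, rfl⟩, fun M => ⟨(p.1 - |M| - 1, p.2), ⟨?_, rfl⟩, ?_⟩, ?_⟩
  · rw [Set.mem_Iic]
    linarith [abs_nonneg M]
  · have h5 : M < -(p.1 - |M| - 1) := by linarith [le_abs_self M]
    exact h5.trans_le ((neg_le_abs _).trans (norm_fst_le (p.1 - |M| - 1, p.2)))
  · rintro w ⟨hw1, hw2⟩
    rw [Set.mem_Iic] at hw1
    rw [Set.mem_singleton_iff] at hw2
    refine free_of_zone h (hz w (by linarith) (by linarith) (by linarith)) fun t' ht' heq => ?_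
    have hmem : (U.line hdeg k l).point t' ∈ (curve (0, a) (0, b)).carrier :=
      hcar ▸ ⟨t', ht', rfl⟩
    obtain ⟨t'', -, h5⟩ := hmem
    have h6 := hcirc t'' 0
    rw [side_zero, h5, ← heq, hw2] at h6
    have h7 : 0 < ε * (π / 2) := mul_pos hε'.1 pi_div_two_pos
    have h8 : 0 < (b - a) ^ 2 / 2 := half_pos (pow_pos (by linarith) 2)
    have h9 : 1 < (1 - -ε * (π / 2)) ^ 2 := by nlinarith
    have h10 : (p.1 - (b - a) / 2) ^ 2 ≤ (w.1 - (b - a) / 2) ^ 2 := by nlinarith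
    nlinarith

/-- If there are no leaves then one escapes from below the root edge downwards. -/
theorem eventually_reachesInfinity_root (h : U.N + 1 = U.n) (h0 : 0 < t) (h1 : t < 1) :
    ∀ᶠ ε : ℝ in 𝓝[>] 0,
      U.ReachesInfinity hdeg 0 U.N (rot ((U.line hdeg 0 U.N).side t ε)) := by
  have hE := (U.disc hdeg).root
  have hline : U.line hdeg 0 U.N = curve (0, 0) (1, 0) := by
    have h2 := (U.disc hdeg).pos_zero
    have h3 := (U.disc hdeg).pos_N
    change (U.disc hdeg).pos U.N = _ at h3
    rw [line, if_pos le_rfl, h2, h3]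
  have hz := ChordDisc.zone_point hE h0 h1
  rw [ChordDisc.isA_root.zone_iff, ChordDisc.pos_zero, ChordDisc.pos_N] at hz
  have hcirc := curve_horizontal_mem_circle (P := (0, 0)) (Q := (1, 0)) rfl
  simp only [sub_zero, zero_add, one_pow] at hcirc
  have hopen : IsOpen {p : ℝ × ℝ | p.2 < 0} := isOpen_lt (by fun_prop) (by fun_prop)
  have hev : ∀ᶠ ε : ℝ in 𝓝[>] 0, rot ((curve (0, 0) (1, 0)).side t ε) ∈ {p : ℝ × ℝ | p.2 < 0} := by
    have hcont : Continuous fun ε : ℝ => rot ((curve (0, 0) (1, 0)).side t ε) :=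
      continuous_rot.comp (continuous_side _ _)
    have : Tendsto (fun ε : ℝ => rot ((curve (0, 0) (1, 0)).side t ε)) (𝓝[>] 0)
        (𝓝 (rot ((curve (0, 0) (1, 0)).side t 0))) :=
      (hcont.tendsto 0).mono_left nhdsWithin_le_nhds
    rw [side_zero] at this
    exact this.eventually (hopen.mem_nhds hz.2.2.1)
  rw [hline]
  filter_upwards [hev, eventually_small] with ε hε hε'
  have hp := hcirc t ε
  generalize rot ((curve (0, 0) (1, 0)).side t ε) = p at *
  refine ⟨{p.1} ×ˢ Set.Iic p.2, isPreconnected_singleton.prod isPreconnected_Iic,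
    ⟨rfl, Set.self_mem_Iic⟩, fun M => ⟨(p.1, p.2 - |M| - 1), ⟨rfl, ?_⟩, ?_⟩, ?_⟩
  · rw [Set.mem_Iic]
    linarith [abs_nonneg M]
  · have h5 : M < -(p.2 - |M| - 1) := by linarith [le_abs_self M]
    exact h5.trans_le ((neg_le_abs _).trans (norm_snd_le (p.1, p.2 - |M| - 1)))
  · rintro w ⟨hw1, hw2⟩
    rw [Set.mem_Iic] at hw2
    rw [Set.mem_singleton_iff] at hw1
    refine ⟨fun i hi => ?_, fun i j hij hne hz => ?_, fun t' _ heq => ?_⟩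
    · rintro rfl
      have hi' : i ≤ U.N := by omega
      rw [loc_of_le hi'] at hw2
      have := (ChordDisc.pos_bounds (D := U.disc hdeg) hi').2
      linarith
    · rcases hij.zone_cases hz with ⟨hj, hE, hz⟩ | ⟨hk, hl, -, -⟩ | ⟨c, hc, hcn, -⟩
      · rcases (ChordDisc.zone_bounds hE hz).2 with h | h
        · linarith
        · exact hne h.2
      · have := hij.lt_n
        omega
      · omega
    · have h6 := hcirc t' 0
      rw [side_zero, ← hline, ← heq, hw1] at h6
      have h7 : 0 < ε * (π / 2) := mul_pos hε'.1 pi_div_two_pos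
      nlinarith

/-- The points to the right of the outer dart from `i + 1` to `i`, that is, to the left of the
stroke from `i` to `i + 1`, are connected to infinity. -/
theorem eventually_reachesInfinity_succ (h : i + 1 < U.n) (h0 : 0 < t) (h1 : t < 1) :
    ∀ᶠ ε : ℝ in 𝓝[>] 0,
      U.ReachesInfinity hdeg i (i + 1) (rot ((U.line hdeg i (i + 1)).side t (-ε))) := by
  rcases lt_trichotomy i U.N with hi | rfl | hi
  · exact eventually_reachesInfinity_of_le hi h0 h1
  · exact eventually_reachesInfinity_halfCircle h h0 h1
  · have hline : U.line hdeg i (i + 1) = curve (0, U.height i) (0, U.height (i + 1)) := by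
      rw [line, if_neg (by omega), if_neg (by omega), if_neg (by omega)]
    rw [hline]
    refine eventually_reachesInfinity_strip (height_lt (by omega) (by omega))
      ⟨by omega, h, U.adj_succ h⟩ (fun w h2 h3 h4 => ?_) (by rw [hline]) h0 h1
    rw [Zone, if_neg (by omega), if_neg (by omega), if_neg (by omega)]
    exact ⟨h2, h3, h4⟩

/-- The points to the right of the outer dart from `0` to `n - 1` are connected to infinity. -/
theorem eventually_reachesInfinity_last (h0 : 0 < t) (h1 : t < 1) :
    ∀ᶠ ε : ℝ in 𝓝[>] 0,
      U.ReachesInfinity hdeg 0 (U.n - 1) (rot ((U.line hdeg 0 (U.n - 1)).side t ε)) := by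
  have hN0 := U.N_pos
  have hN := U.N_lt
  by_cases h : U.N + 1 = U.n
  · rw [show U.n - 1 = U.N by omega]
    exact eventually_reachesInfinity_root h h0 h1
  · have hline : U.line hdeg 0 (U.n - 1) = (curve (0, U.height (U.n - 1)) (0, 0)).reverse := by
      rw [line, if_neg (by omega), if_pos rfl]
    rw [hline]
    simp only [reverse_side]
    refine eventually_reachesInfinity_strip (height_bounds (by omega) (by omega)).2
      ⟨by omega, by omega, U.adj_last⟩ (fun w h2 h3 h4 => ?_) (by rw [hline, reverse_carrier])
      (by linarith) (by linarith)
    rw [Zone, if_neg (by omega), if_pos rfl]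
    exact ⟨h2, h3, h4⟩

end Unfolding

end

end SmoothOrthogonal


/-! ### The layout -/

namespace SmoothOrthogonal

open Topology Filter

/-- For lifts of ports, within a full turn, the turn from one port to the other is the difference.
-/
theorem quarterTurns_natCast {a b : ℕ} (h : a < b) (h' : b ≤ a + 4) :
    quarterTurns (a : ZMod 4) b = b - a := by
  obtain ⟨c, rfl⟩ := Nat.exists_eq_add_of_lt h
  have hc : c < 4 := by omega
  have key : ∀ (x : ZMod 4) (c : Fin 4), quarterTurns x (x + (c : ℕ) + 1) = c + 1 := by decide
  have := key a ⟨c, hc⟩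
  push_cast
  rw [this]
  simp only
  omega

section
open Finset
open scoped Classical

variable {V : Type*} {G : SimpleGraph V}

namespace Unfolding

variable {E : OuterplaneEmbedding G} (U : Unfolding E)

/-- The number of a vertex. -/
noncomputable def idx (v : V) : ℕ := (U.surj v).choose

theorem idx_lt (v : V) : U.idx v < U.n := (U.surj v).choose_spec.1

theorem y_idx (v : V) : U.y (U.idx v) = v := (U.surj v).choose_spec.2

theorem idx_injective : Function.Injective U.idx := fun v w h => by
  rw [← U.y_idx v, h, U.y_idx]

variable {U} in
theorem idx_eq {i : ℕ} {v : V} (hi : i < U.n) (h : v = U.y i) : U.idx v = i :=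
  U.inj (U.idx_lt v) hi ((U.y_idx v).trans h)

theorem adj_idx (d : G.Dart) : G.Adj (U.y (U.idx d.fst)) (U.y (U.idx d.snd)) := by
  rw [U.y_idx, U.y_idx]
  exact d.adj

theorem isEdge_or (d : G.Dart) :
    U.IsEdge (U.idx d.fst) (U.idx d.snd) ∨ U.IsEdge (U.idx d.snd) (U.idx d.fst) := by
  have hne : U.idx d.fst ≠ U.idx d.snd := fun h => d.fst_ne_snd (U.idx_injective h)
  rcases lt_or_gt_of_ne hne with h | h
  · exact Or.inl ⟨h, U.idx_lt _, U.adj_idx d⟩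
  · exact Or.inr ⟨h, U.idx_lt _, (U.adj_idx d).symm⟩

end Unfolding

variable [Fintype V]

/-- If a quantity increases along the rotation at a vertex until the dart `o` is met, then the dart
after `d` realizes the next greater value, or `d` realizes the greatest value and is followed by the
least one. -/
theorem RotationSystem.rot_next (R : RotationSystem G) {o : G.Dart} {f : G.Dart → ℕ}
    (hf : ∀ d, d.fst = o.fst → R.rot d ≠ o → f d < f (R.rot d)) {d e : G.Dart}
    (hd : d.fst = o.fst) (he : e.fst = o.fst) :
    (R.rot d = o ∧ f e ≤ f d ∧ f o ≤ f e) ∨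
      (R.rot d ≠ o ∧ f d < f (R.rot d) ∧ (f e ≤ f d ∨ f (R.rot d) ≤ f e)) := by
  have key : ∀ e : G.Dart, e.fst = o.fst → ∃ j, (R.rot ^ j) o = e ∧
      ∀ i, 0 < i → i ≤ j → (R.rot ^ i) o ≠ o := by
    intro e he
    have hex := R.exists_rot_pow_eq he.symm
    refine ⟨Nat.find hex, Nat.find_spec hex, fun i h1 h2 h3 => ?_⟩
    refine Nat.find_min hex (m := Nat.find hex - i) (by omega) ?_
    conv_rhs => rw [← Nat.find_spec hex, ← Nat.sub_add_cancel h2, pow_add, Equiv.Perm.mul_apply, h3]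
  have hmono : ∀ j, (∀ i, 0 < i → i ≤ j → (R.rot ^ i) o ≠ o) →
      ∀ i ≤ j, f ((R.rot ^ i) o) ≤ f ((R.rot ^ j) o) := by
    intro j hj i hij
    induction j, hij using Nat.le_induction with
    | base => exact le_rfl
    | succ j hij ih =>
      refine (ih fun i h1 h2 => hj i h1 (by omega)).trans ?_
      have h1 := hj (j + 1) (by omega) le_rfl
      rw [pow_succ', Equiv.Perm.mul_apply] at h1 ⊢
      exact (hf _ (R.rot_pow_fst o j) h1).le
  obtain ⟨a, rfl, ha⟩ := key d hd
  obtain ⟨b, rfl, hb⟩ := key e he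
  have h0 := hmono b hb 0 (Nat.zero_le b)
  have hlt := hf _ hd
  rw [← Equiv.Perm.mul_apply, ← pow_succ'] at hlt ⊢
  rcases Nat.lt_or_ge a b with hab | hab
  · have hne := hb (a + 1) (by omega) hab
    exact Or.inr ⟨hne, hlt hne, Or.inr (hmono b hb (a + 1) hab)⟩
  · have hle := hmono a ha b hab
    by_cases hne : (R.rot ^ (a + 1)) o = o
    · exact Or.inl ⟨hne, hle, h0⟩
    · exact Or.inr ⟨hne, hlt hne, Or.inl hle⟩

variable {E : OuterplaneEmbedding G}

namespace Unfolding

variable (U : Unfolding E) (hdeg : ∀ v, #{w | G.Adj v w} ≤ 4)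

/-- The stroke of a dart. -/
noncomputable def dartStroke (d : G.Dart) : Stroke :=
  if U.idx d.fst < U.idx d.snd then U.line hdeg (U.idx d.fst) (U.idx d.snd)
  else (U.line hdeg (U.idx d.snd) (U.idx d.fst)).reverse

/-- The lifted port of a dart. -/
noncomputable def dartKey (d : G.Dart) : ℕ := U.key hdeg (U.idx d.fst) (U.idx d.snd)

variable {U hdeg}

theorem dartStroke_joins (d : G.Dart) : (U.dartStroke hdeg d).Joins (U.loc hdeg (U.idx d.fst))
    (U.loc hdeg (U.idx d.snd)) (U.dartKey hdeg d) (U.dartKey hdeg d.symm) := by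
  unfold dartStroke
  rcases U.isEdge_or d with h | h
  · rw [if_pos h.lt]
    exact line_joins h
  · rw [if_neg h.lt.not_gt]
    exact (line_joins h).reverse

theorem dartStroke_symm (d : G.Dart) :
    U.dartStroke hdeg d.symm = (U.dartStroke hdeg d).reverse := by
  have h1 : d.symm.fst = d.snd := rfl
  have h2 : d.symm.snd = d.fst := rfl
  rw [dartStroke, dartStroke, h1, h2]
  rcases U.isEdge_or d with h | h
  · rw [if_pos h.lt, if_neg h.lt.not_gt]
  · rw [if_neg h.lt.not_gt, if_pos h.lt, Stroke.reverse_reverse]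

/-- A point of a stroke is the position of one of its ends, or it is in the zone of its edge. -/
theorem exists_edge_of_mem_carrier {d : G.Dart} {z : ℂ} (hz : z ∈ (U.dartStroke hdeg d).carrier) :
    ∃ i j, U.IsEdge i j ∧ z ∈ (U.line hdeg i j).carrier ∧ d.edge = s(U.y i, U.y j) ∧
      (z = toC (U.loc hdeg (U.idx d.fst)) ∨ z = toC (U.loc hdeg (U.idx d.snd)) ∨
        U.Zone hdeg i j (rot z)) := by
  unfold dartStroke at hz
  rcases U.isEdge_or d with h | h
  · rw [if_pos h.lt] at hz
    refine ⟨_, _, h, hz, ?_, carrier_cases h hz⟩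
    rw [U.y_idx, U.y_idx]
    rfl
  · rw [if_neg h.lt.not_gt, Stroke.reverse_carrier] at hz
    refine ⟨_, _, h, hz, ?_, ?_⟩
    · rw [U.y_idx, U.y_idx, Sym2.eq_swap]
      rfl
    · have := carrier_cases h hz
      tauto

theorem dartKey_lt_dartKey {d e : G.Dart} (hde : d.fst = e.fst)
    (h : turn U.n (U.idx d.fst) (U.idx e.snd) < turn U.n (U.idx d.fst) (U.idx d.snd)) :
    U.dartKey hdeg d < U.dartKey hdeg e := by
  rw [dartKey, dartKey, ← hde]
  exact key_lt_key (U.idx_lt _) (U.idx_lt _) (U.idx_lt _) (U.adj_idx d) (hde ▸ U.adj_idx e) h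

theorem dartKey_lt_add {d e : G.Dart} (hde : d.fst = e.fst) :
    U.dartKey hdeg e < U.dartKey hdeg d + 4 := by
  rw [dartKey, dartKey, ← hde]
  exact key_lt_add (U.idx_lt _) (U.idx_lt _) (U.adj_idx d) (hde ▸ U.adj_idx e)

theorem dartKey_injOn {d e : G.Dart} (hde : d.fst = e.fst)
    (h : U.dartKey hdeg d = U.dartKey hdeg e) : d = e := by
  refine dart_eq_of_snd hde (U.idx_injective ?_)
  have h1 := U.idx_lt d.fst
  have h2 := U.idx_lt d.snd
  have h3 := U.idx_lt e.snd
  rcases lt_trichotomy (turn U.n (U.idx d.fst) (U.idx d.snd))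
    (turn U.n (U.idx d.fst) (U.idx e.snd)) with h4 | h4 | h4
  · exact absurd h (dartKey_lt_dartKey hde.symm (hde ▸ h4)).ne'
  · unfold turn at h4
    split_ifs at h4 <;> omega
  · exact absurd h (dartKey_lt_dartKey hde h4).ne

theorem eq_of_dartKey_cast_eq {d e : G.Dart} (hde : d.fst = e.fst)
    (h : (U.dartKey hdeg d : ZMod 4) = U.dartKey hdeg e) : d = e := by
  refine dartKey_injOn (U := U) (hdeg := hdeg) hde ?_
  have h1 := dartKey_lt_add (hdeg := hdeg) (U := U) hde
  have h2 := dartKey_lt_add (hdeg := hdeg) (U := U) hde.symm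
  have h3 : U.dartKey hdeg d % 4 = U.dartKey hdeg e % 4 := (ZMod.natCast_eq_natCast_iff _ _ 4).1 h
  omega

variable (U hdeg) in
/-- The drawing of the graph. -/
noncomputable def layout : SC1Layout G where
  pos v := toC (U.loc hdeg (U.idx v))
  pos_injective v w h := by
    refine U.idx_injective (loc_injOn (U.idx_lt v) (U.idx_lt w) (hdeg := hdeg) ?_)
    have h' : toC (U.loc hdeg (U.idx v)) = toC (U.loc hdeg (U.idx w)) := h
    rw [← rot_toC (U.loc hdeg (U.idx v)), h', rot_toC]
  stroke := U.dartStroke hdeg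
  stroke_symm := dartStroke_symm
  nondegenerate d := (dartStroke_joins d).nondegenerate
  start_eq d := (dartStroke_joins d).start_eq
  end_eq d := (dartStroke_joins d).end_eq
  port d := U.dartKey hdeg d
  tangent_eq d := (dartStroke_joins d).port_start
  port_injective _ _ hde h := eq_of_dartKey_cast_eq hde h
  vertex_on_edge v d hv := by
    obtain ⟨i, j, h, -, -, h1 | h1 | h1⟩ := exists_edge_of_mem_carrier hv
    · refine Or.inl (U.idx_injective (loc_injOn (U.idx_lt _) (U.idx_lt _) (hdeg := hdeg) ?_))
      rw [← rot_toC (U.loc hdeg (U.idx v)), h1, rot_toC]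
    · refine Or.inr (U.idx_injective (loc_injOn (U.idx_lt _) (U.idx_lt _) (hdeg := hdeg) ?_))
      rw [← rot_toC (U.loc hdeg (U.idx v)), h1, rot_toC]
    · rw [rot_toC] at h1
      exact absurd h1 (not_zone_loc h (U.idx_lt v))
  no_crossing d e hne z hz := by
    obtain ⟨i, j, h, -, hd, h1 | h1 | h1⟩ := exists_edge_of_mem_carrier hz.1
    · exact ⟨_, h1.symm⟩
    · exact ⟨_, h1.symm⟩
    obtain ⟨k, l, h', -, he, h2 | h2 | h2⟩ := exists_edge_of_mem_carrier hz.2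
    · exact ⟨_, h2.symm⟩
    · exact ⟨_, h2.symm⟩
    obtain ⟨rfl, rfl⟩ := zone_disjoint h h' h1 h2
    exact absurd (hd.trans he.symm) hne

/-- A way to infinity off the drawing lies in an unbounded component of the complement. -/
theorem mem_outerRegion {k l : ℕ} {z : ℂ} (h : U.ReachesInfinity hdeg k l (rot z)) :
    z ∈ (U.layout hdeg).outerRegion := by
  obtain ⟨W, hW, hz, hunb, hfree⟩ := h
  have hsub : toC '' W ⊆ (U.layout hdeg).supportᶜ := by
    rintro _ ⟨w, hw, rfl⟩ hmem
    obtain ⟨h1, h2, h3⟩ := hfree w hw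
    have hloc : ∀ v, toC w ≠ toC (U.loc hdeg (U.idx v)) := fun v h =>
      h1 _ (U.idx_lt v) (by rw [← rot_toC w, h, rot_toC])
    rcases hmem with ⟨v, hv⟩ | hmem
    · exact hloc v hv.symm
    · obtain ⟨d, hd⟩ := Set.mem_iUnion.1 hmem
      obtain ⟨i, j, h, ⟨t, ht, hcar⟩, -, h4 | h4 | h4⟩ := exists_edge_of_mem_carrier hd
      · exact hloc _ h4
      · exact hloc _ h4
      · by_cases hkl : i = k ∧ j = l
        · rw [hkl.1, hkl.2] at hcar
          exact h3 t ht (by rw [hcar, rot_toC])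
        · rw [rot_toC] at h4
          exact h2 i j h hkl h4
  have hzW : z ∈ toC '' W := ⟨rot z, hz, toC_rot z⟩
  refine ⟨hsub hzW, fun hbdd => ?_⟩
  have hcomp := (hW.image toC continuous_toC.continuousOn).subset_connectedComponentIn hzW hsub
  obtain ⟨M, hM⟩ := (hbdd.subset hcomp).exists_norm_le
  obtain ⟨w, hw, hlt⟩ := hunb (2 * M)
  have h1 := norm_rot_le (toC w)
  rw [rot_toC] at h1
  have h2 := hM _ ⟨w, hw, rfl⟩
  linarith

theorem layout_preserves : (U.layout hdeg).Preserves E := by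
  refine ⟨fun d e hed => ?_, fun d hd t ht => ?_⟩
  · change quarterTurns (U.dartKey hdeg d : ZMod 4) (U.dartKey hdeg (E.rot d)) ≤
      quarterTurns (U.dartKey hdeg d : ZMod 4) (U.dartKey hdeg e)
    obtain ⟨o, ho, hout⟩ := E.mem_outer d.fst
    have hf : ∀ f : G.Dart, f.fst = o.fst → E.rot f ≠ o →
        U.dartKey hdeg f < U.dartKey hdeg (E.rot f) := by
      intro f hfo hne
      have hrf := E.rot_fst f
      refine dartKey_lt_dartKey hrf.symm
        ((U.rot_snd (U.idx_lt _) (U.idx_lt _) (U.idx_lt _) (U.y_idx _).symm (U.y_idx _).symm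
          (U.y_idx _).symm).resolve_left fun h => hne ?_)
      refine dart_eq_of_snd (hrf.trans hfo) ?_
      have h1 := U.idx_lt f.fst
      have h2 := U.idx_lt (E.rot f).snd
      rcases U.outer hout with ⟨i, hi, h3, h4⟩ | ⟨h3, h4⟩
      · have h5 := idx_eq hi (hfo.trans h3)
        have h6 : U.idx (E.rot f).snd = i := by omega
        rw [h4, ← h6, U.y_idx]
      · have h5 := idx_eq (by omega) (hfo.trans h3)
        have h6 : U.idx (E.rot f).snd = U.n - 1 := by omega
        rw [h4, ← h6, U.y_idx]
    have hde : ∀ {f g : G.Dart}, f.fst = g.fst → _ := fun h =>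
      dartKey_lt_add (hdeg := hdeg) (U := U) h
    have hdr := E.rot_fst d
    have h1 := hde hdr
    have h2 := hde hdr.symm
    have h3 := hde hed
    have h4 := hde hed.symm
    have h5 := hde (hdr.trans hed.symm)
    have h6 := hde (hed.trans hdr.symm)
    -- a port may be replaced by the same port one turn later
    have hturn : ∀ f : G.Dart, U.dartKey hdeg f ≤ U.dartKey hdeg d →
        U.dartKey hdeg d < U.dartKey hdeg f + 4 →
        quarterTurns (U.dartKey hdeg d : ZMod 4) (U.dartKey hdeg f) =
          U.dartKey hdeg f + 4 - U.dartKey hdeg d := by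
      intro f h7 h8
      rw [← quarterTurns_natCast h8 (by omega)]
      push_cast
      rw [show (4 : ZMod 4) = 0 from rfl, add_zero]
    rcases E.rot_next hf ho.symm (hed.trans ho.symm) with ⟨h7, h8, h9⟩ | ⟨h7, h8, h9⟩
    · rw [h7] at h1 h2 h5 h6 ⊢
      rw [hturn _ (h9.trans h8) (by omega), hturn _ h8 (by omega)]
      omega
    · rw [quarterTurns_natCast h8 (by omega)]
      rcases h9 with h9 | h9
      · rw [hturn _ h9 (by omega)]
        omega
      · rw [quarterTurns_natCast (by omega) (by omega)]
        omega
  · change ∀ᶠ ε : ℝ in 𝓝[>] 0, (U.dartStroke hdeg d).side t ε ∈ (U.layout hdeg).outerRegion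
    have hn := U.N_lt
    have hN0 := U.N_pos
    rcases U.outer hd with ⟨i, hi, h1, h2⟩ | ⟨h1, h2⟩
    · rw [dartStroke, idx_eq hi h1, idx_eq (by omega) h2, if_neg (by omega)]
      filter_upwards [eventually_reachesInfinity_succ (U := U) (hdeg := hdeg) hi
        (t := 1 - t) (by linarith [ht.2]) (by linarith [ht.1])] with ε hε
      rw [Stroke.reverse_side]
      exact mem_outerRegion hε
    · rw [dartStroke, idx_eq (by omega) h1, idx_eq (by omega) h2, if_pos (by omega)]
      filter_upwards [eventually_reachesInfinity_last (U := U) (hdeg := hdeg) ht.1 ht.2] with ε hε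
      exact mem_outerRegion hε

end Unfolding

end

end SmoothOrthogonal

/-- Every biconnected outerplane graph of maximum degree at most four has an `SC₁`-layout that
preserves its outerplane embedding. -/
theorem mainTheorem4 {V : Type*} [Fintype V] (G : SimpleGraph V) [DecidableRel G.Adj]
    (hG : SmoothOrthogonal.Biconnected G) (hdeg : G.maxDegree ≤ 4)
    (E : SmoothOrthogonal.OuterplaneEmbedding G) :
    ∃ L : SmoothOrthogonal.SC1Layout G, L.Preserves E := by
  classical
  obtain ⟨U⟩ := SmoothOrthogonal.OuterplaneEmbedding.exists_unfolding hG E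
  refine ⟨U.layout fun v => ?_, SmoothOrthogonal.Unfolding.layout_preserves⟩
  have h := (G.degree_le_maxDegree v).trans hdeg
  rw [← SimpleGraph.card_neighborFinset_eq_degree, SimpleGraph.neighborFinset_eq_filter] at h
  exact le_trans (le_of_eq (by congr)) h
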